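/- **Setting.** Let $N\ge 1$ agents act in a Markov decision process with finite global state space $\mathcal S=\prod_i\mathcal S_i$, finite action space $\mathcal A=\prod_i\mathcal A_i$, transition probabilities $P_a(s,s')$, initial distribution $\xi$ and discount $\gamma\in[0,1)$. Agent $i$ has a local policy $\pi^{(i)}_{\theta_i}(a_{(i)}|s)>0$ with $\theta_i\in\mathbb R^{p_i}$ and $\log\pi^{(i)}_{\theta_i}$ differentiable in $\theta_i$; $\pi_\theta=\prod_i\pi^{(i)}_{\theta_i}$, $\theta=(\theta_1,\dots,\theta_N)$. Let $\lambda^{\pi}(s,a)=\sum_{t\ge0}\gamma^t\,\mathbb P(s^t=s,a^t=a\mid\pi,s^0\sim\xi)$, let $\lambda_{(i)}$ be its marginal on $\mathcal S_i\times\mathcal A_i$, and $F(\lambda)=\frac1N\sum_iF_i(\lambda_{(i)})$ with $F_i:\mathbb R^{\mathcal S_i\times\mathcal A_i}\to\mathbb R$. The shadow reward is $r^\pi=\partial F(\lambda^\pi)/\partial\lambda$, the local ones are $r_i^\pi=\partial F_i(\lambda^\pi_{(i)})/\partial\lambda_{(i)}$; $Q_F^\pi$ and $Q_i^\pi$ are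 the Q-functions of $\pi$ for these rewards. With features $\phi(s,a)\in\mathbb R^d$ and $Q_w=\langle\phi,w\rangle$ put $\ell(w;\pi)=\frac12\mathbb E[\sum_t\gamma^t(Q_w-Q_F^\pi)^2(s^t,a^t)\mid s^0\sim\xi,\pi]$, define $\ell_i(w;\pi)$ in the same way with $Q^\pi_i$, and let $w^*(\theta)$ be a minimizer of $\frac1N\sum_i\ell_i(\cdot;\pi_\theta)$. **Algorithm (DSAC, one communication round per iteration, $m=1$).** Start from $\theta^0$ and $w_1^0=\dots=w_N^0$. In iteration $k=0,1,\dots$ draw $B_k$ independent trajectories $s^0,a^0,\dots,s^{H_k},a^{H_k}$ under $\xi,\pi_{\theta^k}$. Agent $i$ forms $\hat\lambda_i^k=\frac1{B_k}\sum_\tau\sum_{t\le H_k}\gamma^t\mathbf e(s^t_{(i)},a^t_{(i)})$ and $\hat r_i^k=\nabla F_i(\hat\lambda_i^k)$; makes the critic step $\tilde w_i=w_i^k-\eta_w^k\frac1{B_k}\sum_\tau\sum_{t\le H_k}\gamma^t\big(Q_{w_i^k}(s^t,a^t)-\hat Q_i^t\big)\phi(s^t,a^t)$, where $\hat Q_i^t=\sum_{t'=t}^{H_k}\gamma^{t'-t}\hat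 r_i^k(s^{t'}_{(i)},a^{t'}_{(i)})$; averages, $w_i^{k+1}=\sum_jM(j,i)\tilde w_j$ over its neighbours $j$ in the communication graph; and makes the actor step $\theta_i^{k+1}=\theta_i^k+\eta_\theta^k\frac1{B_k}\sum_\tau\sum_{t\le H_k}\gamma^tQ_{w_i^{k+1}}(s^t,a^t)\nabla_{\theta_i}\log\pi^{(i)}_{\theta_i^k}(a^t_{(i)}|s^t)$. **Assumptions.** There are positive constants $C_F,L_F,L_\theta,C_\pi,\ell_\theta,C_\phi,\mu_w$ and $\rho\in[0,1)$ such that, for all $i$: (a) $\|\nabla F_i\|_\infty\le C_F$ in a neighbourhood of $\{\lambda_{(i)}^{\pi_\theta}\}_\theta$; $F_i$ is differentiable with $\|\nabla F_i(\lambda)-\nabla F_i(\lambda')\|_\infty\le L_F\|\lambda-\lambda'\|$ on the nonnegative vectors of total mass at most $\frac1{1-\gamma}$; $\theta\mapsto F(\lambda^{\pi_\theta})$ is differentiable with $L_\theta$-Lipschitz gradient; (b) $\|\nabla_{\theta_i}\log\pi^{(i)}_{\theta_i}(a_{(i)}|s)\|\le C_\pi$ for all $\theta_i,s,a_{(i)}$,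 and $\|\lambda^{\pi_\theta}-\lambda^{\pi_{\theta'}}\|\le\ell_\theta\|\theta-\theta'\|$; (c) $\|\phi(s,a)\|\le C_\phi$; (d) $M$ is symmetric and doubly stochastic, $M(i,j)>0$ exactly for the edges $(i,j)$ of the graph, and all eigenvalues of $M$ but the largest (counted with multiplicity) are at most $\rho$ in absolute value; (e) almost surely, $\ell(\cdot;\pi_{\theta^k})$ is $\mu_w$-strongly convex for all iterates $\theta^k$ (in (i) below: for $k\le T$). Let $W$ be such that for all $\theta$, $\sum_i\big\|\nabla_{\theta_i}F(\lambda^{\pi_\theta})-\mathbb E[\sum_t\gamma^tQ_{w^*(\theta)}(s^t,a^t)\nabla_{\theta_i}\log\pi^{(i)}_{\theta_i}(a^t_{(i)}|s^t)\mid\xi,\pi_\theta]\big\|^2\le W$. Put $L_w=C_\phi^2/(1-\gamma)$. **Theorem.** There is $C_0>0$ such that $\|w^*(\theta)-w^*(\theta')\|\le C_0\|\theta-\theta'\|$ whenever $\ell(\cdot;\pi_\theta)$ and $\ell(\cdot;\pi_{\theta'})$ are $\mu_w$-strongly convex, and such that the following holds for every $C_w\ge C_0$. Write $$s(\eta)=\min\Big\{\frac{(1-\gamma)\mu_w\,\eta}{C_wC_\phi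 C_\pi}\cdot\frac1{\max\{4\sqrt{3N},6\sqrt{10}\}},\frac1{4L_\theta}\Big\}.$$ Let $K\ge1$ and $D\in\mathbb R$. There are $C>0$, $q\in\mathbb N$ and $T_\varepsilon\in\mathbb N$ for $\varepsilon\in(0,1)$, with $2\le T_\varepsilon\le C\varepsilon^{-3/2}(1+\log\frac1\varepsilon)^q$, such that for all $\delta,\varepsilon\in(0,1)$ and all $\|w^0_i\|\le D$: (i) Let $T,H\in\mathbb N$ and $\eta_w>0$ satisfy $K^{-1}\varepsilon^{-3/2}\le T\le K\varepsilon^{-3/2}$, $\gamma^H\le\varepsilon$, $H\le K\frac{1+\log(1/\varepsilon)}{1-\gamma}$, $K^{-1}\sqrt\varepsilon\le\eta_w\le K\sqrt\varepsilon$, $\eta_w\le1/L_w$. With $H_k\equiv H$, $\delta_k\equiv\frac{\delta}{3N(T+1)}$, $B_k\equiv\lceil\varepsilon^{-1}\log(1/\delta_k)\rceil$, $\eta_w^k\equiv\eta_w$, $\eta_\theta^k\equiv s(\eta_w)$, with probability at least $1-\delta$ $$\frac1T\sum_{k=1}^T\|\nabla_\theta F(\lambda^{\pi_{\theta^k}})\|^2\le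 C(\varepsilon+W),$$ and the same bound holds for the $\eta_\theta^k$-weighted average. The number $\sum_{k=0}^TB_k(H_k+1)$ of samples is at most $C\varepsilon^{-5/2}(1+\log\frac1\varepsilon+\log\frac1\delta)^q=\tilde O(\varepsilon^{-2.5})$. (ii) Let $\gamma^{H_k}\le(k+1)^{-2/3}$, $H_k\le K\frac{1+\log(k+1)}{1-\gamma}$, $\delta_k=\frac{2\delta}{N\pi^2(k+1)^2}$, $B_k=\lceil(k+1)^{2/3}\log(1/\delta_k)\rceil$, $\eta_w^k=\min\{(k+1)^{-1/3},L_w^{-1}\}$, $\eta_\theta^k=s(\eta_w^{k+1})$. With probability at least $1-\delta$, simultaneously for all $T\ge2$, $$\frac{\sum_{k=1}^T\eta_\theta^k\|\nabla_\theta F(\lambda^{\pi_{\theta^k}})\|^2}{\sum_{k=1}^T\eta_\theta^k}\le C\Big(\frac{\log T}{T^{2/3}}+W\Big).$$ Moreover, for $T=T_\varepsilon$ the left-hand side is at most $C(\varepsilon+W)$ with probability at least $1-\delta$, and the number $\sum_{k=0}^{T_\varepsilon}B_k(H_k+1)$ of samples is at most $C\varepsilon^{-5/2}(1+\log\frac1\varepsilon+\log\frac1\delta)^q=\tilde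 O(\varepsilon^{-2.5})$. Here $C_0$, $C$, $q$ and $T_\varepsilon$ depend only on the sizes $N,|\mathcal S_i|,|\mathcal A_i|,d,p_i$ and on the constants $\gamma,C_F,L_F,L_\theta,C_\pi,\ell_\theta,C_\phi,\mu_w,\rho,D$ (and $C,q,T_\varepsilon$ also on $C_w,K$); they do not depend on $\varepsilon$ (except $T_\varepsilon$), $\delta$, $T$, $W$, or the particular problem. -/

import Mathlib

open MeasureTheory

universe u₁ u₂ u₃ u₄

noncomputable section

namespace DSAC


/-- A decentralized multi-agent problem with general utilities: agents `ι`, local state spaces `S i`,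
local action spaces `A i`, policy parameters `θ i ∈ ℝ^(p i)`, critic features in `ℝ^d`. A pair
`x : (∀ i, S i) × (∀ i, A i)` is a global state-action pair. -/
structure Model (ι : Type u₁) (S : ι → Type u₂) (A : ι → Type u₃) (p : ι → ℕ) (d : ℕ)
    [Fintype ι] [DecidableEq ι] [∀ i, Fintype (S i)] [∀ i, Fintype (A i)] where
  /-- discount factor -/
  γ : ℝ
  γ_nonneg : 0 ≤ γ
  γ_lt_one : γ < 1
  /-- initial distribution of the global state -/
  ξ : (∀ i, S i) → ℝ
  ξ_nonneg : ∀ s, 0 ≤ ξ s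
  ξ_sum : ∑ s, ξ s = 1
  /-- transition probabilities: `P s a s'` is the probability of moving to `s'` from `s` under `a` -/
  P : (∀ i, S i) → (∀ i, A i) → (∀ i, S i) → ℝ
  P_nonneg : ∀ s a s', 0 ≤ P s a s'
  P_sum : ∀ s a, ∑ s', P s a s' = 1
  /-- local policies: `pol i ϑ s b` is the probability that agent `i` plays `b` in global state `s` -/
  pol : ∀ i, EuclideanSpace ℝ (Fin (p i)) → (∀ j, S j) → A i → ℝ
  pol_nonneg : ∀ i ϑ s b, 0 ≤ pol i ϑ s b
  pol_sum : ∀ i ϑ s, ∑ b, pol i ϑ s b = 1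
  /-- local utilities -/
  F : ∀ i, EuclideanSpace ℝ (S i × A i) → ℝ
  /-- critic features -/
  φ : (∀ i, S i) × (∀ i, A i) → EuclideanSpace ℝ (Fin d)
  /-- edges of the communication graph (a self-loop is allowed) -/
  adj : ι → ι → Prop
  /-- mixing matrix -/
  M : Matrix ι ι ℝ

/-- Joint policy parameters `θ = (θ_1, …, θ_N)` with the Euclidean norm. -/
abbrev Param {ι : Type u₁} [Fintype ι] (p : ι → ℕ) : Type u₁ :=
  PiLp 2 (fun i => EuclideanSpace ℝ (Fin (p i)))

/-- A choice of the inputs of the algorithm: actor and critic step sizes, batch sizes, episode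
lengths, and the number of communication rounds per iteration. -/
structure Schedule where
  ηθ : ℕ → ℝ
  ηw : ℕ → ℝ
  B : ℕ → ℕ
  H : ℕ → ℕ
  rounds : ℕ

namespace Model

variable {ι : Type u₁} {S : ι → Type u₂} {A : ι → Type u₃} {p : ι → ℕ} {d : ℕ}
  [Fintype ι] [DecidableEq ι]
  [∀ i, Fintype (S i)] [∀ i, DecidableEq (S i)] [∀ i, Fintype (A i)] [∀ i, DecidableEq (A i)]

/-! ### Occupancy measures, shadow rewards and shadow Q-functions -/

/-- The global policy, the product of the local ones. -/
def jointPol (m : Model ι S A p d) (θ : Param p) (s : ∀ i, S i) (a : ∀ i, A i) : ℝ :=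
  ∏ i, m.pol i (θ i) s (a i)

/-- The law of `(s⁰, a⁰)` when `s⁰ ∼ ξ`. -/
def initLaw (m : Model ι S A p d) (θ : Param p) (x : (∀ i, S i) × (∀ i, A i)) : ℝ :=
  m.ξ x.1 * m.jointPol θ x.1 x.2

/-- One step of the state-action chain, acting on laws. -/
def stepLaw (m : Model ι S A p d) (θ : Param p) (ν : (∀ i, S i) × (∀ i, A i) → ℝ)
    (y : (∀ i, S i) × (∀ i, A i)) : ℝ :=
  ∑ x, ν x * m.P x.1 x.2 y.1 * m.jointPol θ y.1 y.2

/-- The law of `(sᵗ, aᵗ)` under `π_θ` when `(s⁰, a⁰)` has law `ν`. -/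
def saLaw (m : Model ι S A p d) (θ : Param p) (ν : (∀ i, S i) × (∀ i, A i) → ℝ) (t : ℕ) :
    (∀ i, S i) × (∀ i, A i) → ℝ :=
  (m.stepLaw θ)^[t] ν

/-- `𝔼[∑ₜ γᵗ f(sᵗ, aᵗ) | (s⁰, a⁰) ∼ ν, π_θ]`. -/
def discExp {E : Type u₄} [NormedAddCommGroup E] [NormedSpace ℝ E] (m : Model ι S A p d)
    (θ : Param p) (ν : (∀ i, S i) × (∀ i, A i) → ℝ) (f : (∀ i, S i) × (∀ i, A i) → E) : E :=
  ∑' t : ℕ, m.γ ^ t • ∑ x, m.saLaw θ ν t x • f x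

/-- The (unnormalized) discounted state-action occupancy measure `λ^{π_θ}`. -/
def occ (m : Model ι S A p d) (θ : Param p) : EuclideanSpace ℝ ((∀ i, S i) × (∀ i, A i)) :=
  WithLp.toLp 2 (fun x => ∑' t : ℕ, m.γ ^ t * m.saLaw θ (m.initLaw θ) t x)

/-- Marginalization `λ ↦ λ_(i)` onto the local state-action space of agent `i`. -/
def marg (_m : Model ι S A p d) (i : ι) (l : EuclideanSpace ℝ ((∀ i, S i) × (∀ i, A i))) :
    EuclideanSpace ℝ (S i × A i) :=
  WithLp.toLp 2 (fun y => ∑ x : (∀ i, S i) × (∀ i, A i),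
    if x.1 i = y.1 ∧ x.2 i = y.2 then l x else 0)

/-- The global utility `F(λ) = N⁻¹ ∑ᵢ Fᵢ(λ_(i))`. -/
def utility (m : Model ι S A p d) (l : EuclideanSpace ℝ ((∀ i, S i) × (∀ i, A i))) : ℝ :=
  (1 / (Fintype.card ι : ℝ)) * ∑ i, m.F i (m.marg i l)

/-- `θ ↦ F(λ^{π_θ})`. -/
def objective (m : Model ι S A p d) (θ : Param p) : ℝ := m.utility (m.occ θ)

/-- The shadow reward `∂F(λ^{π_θ}) / ∂λ(s,a)`. -/
def shadowReward (m : Model ι S A p d) (θ : Param p) (x : (∀ i, S i) × (∀ i, A i)) : ℝ :=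
  gradient m.utility (m.occ θ) x

/-- The local shadow reward `∂Fᵢ(λ_(i)^{π_θ}) / ∂λ_(i)(s_(i),a_(i))`. -/
def localShadowReward (m : Model ι S A p d) (i : ι) (θ : Param p) (y : S i × A i) : ℝ :=
  gradient (m.F i) (m.marg i (m.occ θ)) y

/-- The Q-function of `π_θ` for the reward `r`. -/
def qOf (m : Model ι S A p d) (θ : Param p) (r : (∀ i, S i) × (∀ i, A i) → ℝ)
    (x : (∀ i, S i) × (∀ i, A i)) : ℝ :=
  m.discExp θ (Pi.single x 1) r

/-- The shadow Q-function. -/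
def shadowQ (m : Model ι S A p d) (θ : Param p) : (∀ i, S i) × (∀ i, A i) → ℝ :=
  m.qOf θ (m.shadowReward θ)

/-- The local shadow Q-function of agent `i`. -/
def localShadowQ (m : Model ι S A p d) (i : ι) (θ : Param p) : (∀ i, S i) × (∀ i, A i) → ℝ :=
  m.qOf θ (fun x => m.localShadowReward i θ (x.1 i, x.2 i))

/-- The linear critic `Q_w(s,a) = ⟨φ(s,a), w⟩`. -/
def qLin (m : Model ι S A p d) (w : EuclideanSpace ℝ (Fin d)) (x : (∀ i, S i) × (∀ i, A i)) : ℝ :=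
  inner ℝ (m.φ x) w

/-- The critic objective `ℓ(w; π_θ)`. -/
def criticLoss (m : Model ι S A p d) (θ : Param p) (w : EuclideanSpace ℝ (Fin d)) : ℝ :=
  m.discExp θ (m.initLaw θ) (fun x => (1 / 2 : ℝ) * (m.qLin w x - m.shadowQ θ x) ^ 2)

/-- The local critic objective `ℓᵢ(w; π_θ)`. -/
def localCriticLoss (m : Model ι S A p d) (i : ι) (θ : Param p) (w : EuclideanSpace ℝ (Fin d)) :
    ℝ :=
  m.discExp θ (m.initLaw θ) (fun x => (1 / 2 : ℝ) * (m.qLin w x - m.localShadowQ i θ x) ^ 2)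

/-- `w` minimizes `N⁻¹ ∑ᵢ ℓᵢ(·; π_θ)`, i.e. `w = w*(θ)`. -/
def IsCriticOpt (m : Model ι S A p d) (θ : Param p) (w : EuclideanSpace ℝ (Fin d)) : Prop :=
  ∀ v, (1 / (Fintype.card ι : ℝ)) * ∑ i, m.localCriticLoss i θ w
    ≤ (1 / (Fintype.card ι : ℝ)) * ∑ i, m.localCriticLoss i θ v

/-- The score function `∇_{θᵢ} log π^{(i)}_{θᵢ}(b | s)`. -/
def score (m : Model ι S A p d) (i : ι) (ϑ : EuclideanSpace ℝ (Fin (p i))) (s : ∀ j, S j)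
    (b : A i) : EuclideanSpace ℝ (Fin (p i)) :=
  gradient (fun ϑ' => Real.log (m.pol i ϑ' s b)) ϑ

/-- The policy gradient expression of agent `i` with the critic `w` in place of the shadow
Q-function. -/
def actorDir (m : Model ι S A p d) (i : ι) (θ : Param p) (w : EuclideanSpace ℝ (Fin d)) :
    EuclideanSpace ℝ (Fin (p i)) :=
  m.discExp θ (m.initLaw θ) (fun x => m.qLin w x • m.score i (θ i) x.1 (x.2 i))

/-! ### Assumptions -/

/-- The nonnegative vectors of total mass at most `(1-γ)⁻¹`. They include all local occupancy
measures and all their truncated empirical estimates. -/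
def budget (m : Model ι S A p d) (i : ι) : Set (EuclideanSpace ℝ (S i × A i)) :=
  {l | (∀ y, 0 ≤ l y) ∧ ∑ y, l y ≤ (1 - m.γ)⁻¹}

/-- Smooth utilities with bounded gradients, and a smooth objective. -/
structure UtilityAssumption (m : Model ι S A p d) (CF LF Lθ : ℝ) : Prop where
  /-- the gradient of `Fᵢ` is bounded near the set of occupancy measures -/
  grad_bdd : ∀ i, ∃ U : Set (EuclideanSpace ℝ (S i × A i)), IsOpen U ∧
    (∀ θ, m.marg i (m.occ θ) ∈ U) ∧
    ∀ l ∈ U, DifferentiableAt ℝ (m.F i) l ∧ ∀ y, |gradient (m.F i) l y| ≤ CF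
  /-- `Fᵢ` is differentiable where the algorithm differentiates it -/
  diff : ∀ i, ∀ l ∈ m.budget i, DifferentiableAt ℝ (m.F i) l
  /-- the gradient of `Fᵢ` is Lipschitz from the Euclidean to the maximum norm -/
  grad_lip : ∀ i, ∀ l ∈ m.budget i, ∀ l' ∈ m.budget i, ∀ y,
    |gradient (m.F i) l y - gradient (m.F i) l' y| ≤ LF * ‖l - l'‖
  /-- `θ ↦ F(λ^{π_θ})` is `Lθ`-smooth -/
  obj_diff : Differentiable ℝ m.objective
  obj_smooth : ∀ θ θ', ‖gradient m.objective θ - gradient m.objective θ'‖ ≤ Lθ * ‖θ - θ'‖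

/-- Bounded score functions, and occupancy measures that are Lipschitz in the parameter. -/
structure PolicyAssumption (m : Model ι S A p d) (Cπ lθ : ℝ) : Prop where
  pos : ∀ i ϑ s b, 0 < m.pol i ϑ s b
  diff : ∀ i s b, Differentiable ℝ (fun ϑ => Real.log (m.pol i ϑ s b))
  score_bdd : ∀ i ϑ s b, ‖m.score i ϑ s b‖ ≤ Cπ
  occ_lip : ∀ θ θ', ‖m.occ θ - m.occ θ'‖ ≤ lθ * ‖θ - θ'‖

/-- Bounded features. -/
def FeatureAssumption (m : Model ι S A p d) (Cφ : ℝ) : Prop := ∀ x, ‖m.φ x‖ ≤ Cφ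

/-- The mixing matrix is symmetric and doubly stochastic, its positive entries are the edges of the
graph, and all its eigenvalues but the largest one are at most `ρ` in absolute value
(`eigenvalues₀` lists the eigenvalues with multiplicity in decreasing order). -/
def MixingAssumption (m : Model ι S A p d) (ρ : ℝ) : Prop :=
  m.M ∈ doublyStochastic ℝ ι ∧ (∀ i j, 0 < m.M i j ↔ m.adj i j) ∧
    ∃ hM : m.M.IsHermitian, ∀ k : Fin (Fintype.card ι), (k : ℕ) ≠ 0 → |hM.eigenvalues₀ k| ≤ ρ

/-- The critic objective at `θ` is `μw`-strongly convex. -/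
def CriticSC (m : Model ι S A p d) (μw : ℝ) (θ : Param p) : Prop :=
  StrongConvexOn Set.univ μw (m.criticLoss θ)

/-- The feature mis-specification error is at most `W`: for the optimal critic `w = w*(θ)`, the
squared error of the resulting policy gradient is at most `W`. -/
def ModelError (m : Model ι S A p d) (W : ℝ) : Prop :=
  ∀ θ w, m.IsCriticOpt θ w → ∑ i, ‖gradient m.objective θ i - m.actorDir i θ w‖ ^ 2 ≤ W

/-- All standing assumptions on the model, with their constants (strong convexity of the critic
objective is assumed along the iterates only, and hence not here). -/
structure Assumptions (m : Model ι S A p d) (γ CF LF Lθ Cπ lθ Cφ ρ : ℝ) : Prop where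
  discount : m.γ = γ
  utility : m.UtilityAssumption CF LF Lθ
  policy : m.PolicyAssumption Cπ lθ
  feature : m.FeatureAssumption Cφ
  mixing : m.MixingAssumption ρ

/-! ### The algorithm -/

/-- The probability of the trajectory `s⁰, a⁰, …, s^H, a^H` under `ξ` and `π_θ`. -/
def trajProb (m : Model ι S A p d) (θ : Param p) {H : ℕ}
    (τ : Fin (H + 1) → (∀ i, S i) × (∀ i, A i)) : ℝ :=
  m.ξ (τ 0).1 * (∏ t, m.jointPol θ (τ t).1 (τ t).2) *
    ∏ t : Fin H, m.P (τ t.castSucc).1 (τ t.castSucc).2 (τ t.succ).1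

/-- The empirical local occupancy measure of agent `i`. -/
def empOcc (m : Model ι S A p d) (i : ι) {B H : ℕ}
    (b : Fin B → Fin (H + 1) → (∀ i, S i) × (∀ i, A i)) : EuclideanSpace ℝ (S i × A i) :=
  (1 / (B : ℝ)) • ∑ j, ∑ t : Fin (H + 1), m.γ ^ (t : ℕ) •
    EuclideanSpace.single ((b j t).1 i, (b j t).2 i) (1 : ℝ)

/-- The estimated shadow reward of agent `i`. -/
def empReward (m : Model ι S A p d) (i : ι) {B H : ℕ}
    (b : Fin B → Fin (H + 1) → (∀ i, S i) × (∀ i, A i)) (y : S i × A i) : ℝ :=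
  gradient (m.F i) (m.empOcc i b) y

/-- The discounted tail reward `Q̂ᵢᵗ` of agent `i` along the trajectory `τ`. -/
def tailReward (m : Model ι S A p d) (i : ι) {H : ℕ} (r : S i × A i → ℝ)
    (τ : Fin (H + 1) → (∀ i, S i) × (∀ i, A i)) (t : Fin (H + 1)) : ℝ :=
  ∑ t' ∈ Finset.Ici t, m.γ ^ ((t' : ℕ) - (t : ℕ)) * r ((τ t').1 i, (τ t').2 i)

/-- The stochastic critic gradient of agent `i` (the gradient of `Q_w(s,a)` in `w` is `φ(s,a)`). -/
def criticGrad (m : Model ι S A p d) (i : ι) {B H : ℕ}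
    (b : Fin B → Fin (H + 1) → (∀ i, S i) × (∀ i, A i)) (w : EuclideanSpace ℝ (Fin d)) :
    EuclideanSpace ℝ (Fin d) :=
  (1 / (B : ℝ)) • ∑ j, ∑ t : Fin (H + 1),
    (m.γ ^ (t : ℕ) * (m.qLin w (b j t) - m.tailReward i (m.empReward i b) (b j) t)) • m.φ (b j t)

open Classical in
/-- One round of weighted averaging with the neighbours. -/
def mix (m : Model ι S A p d) (w : ι → EuclideanSpace ℝ (Fin d)) (i : ι) :
    EuclideanSpace ℝ (Fin d) :=
  ∑ j with m.adj j i, m.M j i • w j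

/-- The stochastic actor gradient of agent `i`. -/
def actorGrad (m : Model ι S A p d) (i : ι) (θ : Param p) {B H : ℕ}
    (b : Fin B → Fin (H + 1) → (∀ i, S i) × (∀ i, A i)) (w : EuclideanSpace ℝ (Fin d)) :
    EuclideanSpace ℝ (Fin (p i)) :=
  (1 / (B : ℝ)) • ∑ j, ∑ t : Fin (H + 1),
    (m.γ ^ (t : ℕ) * m.qLin w (b j t)) • m.score i (θ i) (b j t).1 ((b j t).2 i)

/-- The critics after the local critic step and the communication rounds of one iteration. -/
def criticStep (m : Model ι S A p d) (η : ℝ) (rounds : ℕ) {B H : ℕ}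
    (b : Fin B → Fin (H + 1) → (∀ i, S i) × (∀ i, A i)) (w : ι → EuclideanSpace ℝ (Fin d)) :
    ι → EuclideanSpace ℝ (Fin d) :=
  m.mix^[rounds] (fun i => w i - η • m.criticGrad i b (w i))

/-- The policy parameters after the actor step; `w` are the updated critics. -/
def actorStep (m : Model ι S A p d) (η : ℝ) {B H : ℕ}
    (b : Fin B → Fin (H + 1) → (∀ i, S i) × (∀ i, A i)) (θ : Param p)
    (w : ι → EuclideanSpace ℝ (Fin d)) : Param p :=
  θ + η • WithLp.toLp 2 (fun i => m.actorGrad i θ b (w i))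

/-- The iterates `(θᵏ, (wᵢᵏ)ᵢ)` as a function of the sampled batches `x 0, x 1, …`; the `k`-th
iterate depends on `x 0, …, x (k-1)` only. -/
def iter (m : Model ι S A p d) (sch : Schedule) (θ₀ : Param p) (w₀ : EuclideanSpace ℝ (Fin d))
    (x : ∀ k, Fin (sch.B k) → Fin (sch.H k + 1) → (∀ i, S i) × (∀ i, A i)) :
    ℕ → Param p × (ι → EuclideanSpace ℝ (Fin d))
  | 0 => (θ₀, fun _ => w₀)
  | k + 1 =>
    let prev := iter m sch θ₀ w₀ x k
    let w' := m.criticStep (sch.ηw k) sch.rounds (x k) prev.2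
    (m.actorStep (sch.ηθ k) (x k) prev.1 w', w')

/-- The random batches `X` are those of a run of the algorithm: given the first `k` batches, the
`k`-th batch consists of `B k` independent trajectories of length `H k` with initial distribution `ξ`
and policy `π_{θᵏ}`. This is expressed by the joint law of the first `n` batches, for every `n`. -/
def IsRun {Ω : Type u₄} [MeasurableSpace Ω] (m : Model ι S A p d) (sch : Schedule) (θ₀ : Param p)
    (w₀ : EuclideanSpace ℝ (Fin d)) (P : Measure Ω)
    (X : Ω → ∀ k, Fin (sch.B k) → Fin (sch.H k + 1) → (∀ i, S i) × (∀ i, A i)) : Prop :=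
  ∀ (n : ℕ) (x : ∀ k, Fin (sch.B k) → Fin (sch.H k + 1) → (∀ i, S i) × (∀ i, A i)),
    MeasurableSet {ω | ∀ k < n, X ω k = x k} ∧
    P.real {ω | ∀ k < n, X ω k = x k} =
      ∏ k ∈ Finset.range n, ∏ j, m.trajProb (m.iter sch θ₀ w₀ x k).1 (x k j)

/-- `‖∇_θ F(λ^{π_{θᵏ}})‖²` along a run. -/
def gradSq (m : Model ι S A p d) (sch : Schedule) (θ₀ : Param p) (w₀ : EuclideanSpace ℝ (Fin d))
    (x : ∀ k, Fin (sch.B k) → Fin (sch.H k + 1) → (∀ i, S i) × (∀ i, A i)) (k : ℕ) : ℝ :=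
  ‖gradient m.objective (m.iter sch θ₀ w₀ x k).1‖ ^ 2

/-- The step-size-weighted average of `‖∇_θ F(λ^{π_{θᵏ}})‖²` over `1 ≤ k ≤ T`. -/
def weightedAvg (m : Model ι S A p d) (sch : Schedule) (θ₀ : Param p)
    (w₀ : EuclideanSpace ℝ (Fin d))
    (x : ∀ k, Fin (sch.B k) → Fin (sch.H k + 1) → (∀ i, S i) × (∀ i, A i)) (T : ℕ) : ℝ :=
  (∑ k ∈ Finset.Icc 1 T, sch.ηθ k * m.gradSq sch θ₀ w₀ x k) / ∑ k ∈ Finset.Icc 1 T, sch.ηθ k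

end Model

/-! ### Parameter selections -/

/-- The number of state-action samples drawn in the iterations `0, …, T`. -/
def Schedule.samples (sch : Schedule) (T : ℕ) : ℕ :=
  ∑ k ∈ Finset.range (T + 1), sch.B k * (sch.H k + 1)

/-- The actor step size that belongs to the critic step size `η`, for `N` agents. -/
def actorStepSize (N : ℕ) (γ Lθ Cπ Cφ μw Cw η : ℝ) : ℝ :=
  min ((1 - γ) * μw * η / (Cw * Cφ * Cπ) * (1 / max (4 * √(3 * N)) (6 * √10))) (1 / (4 * Lθ))

/-- The smoothness constant `L_w` of the critic objective. -/
def criticLip (γ Cφ : ℝ) : ℝ := Cφ ^ 2 / (1 - γ)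

/-- Constant parameters: `δₖ = δ / (3N(T+1))`, `Bₖ = log(1/δₖ)/ε` (rounded up), `Hₖ = H`, critic step
size `η`, one communication round. -/
def constSchedule (N : ℕ) (γ Lθ Cπ Cφ μw Cw δ ε : ℝ) (T H : ℕ) (η : ℝ) : Schedule where
  ηθ := fun _ => actorStepSize N γ Lθ Cπ Cφ μw Cw η
  ηw := fun _ => η
  B := fun _ => ⌈Real.log (1 / (δ / (3 * N * (T + 1)))) / ε⌉₊
  H := fun _ => H
  rounds := 1

/-- The diminishing critic step size `min {(k+1)^(-1/3), 1/L_w}`. -/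
def dimStep (γ Cφ : ℝ) (k : ℕ) : ℝ :=
  min (((k : ℝ) + 1) ^ (-(1 / 3) : ℝ)) (criticLip γ Cφ)⁻¹

/-- Adaptive parameters: `δₖ = 2δ / (Nπ²(k+1)²)`, `Bₖ = log(1/δₖ)(k+1)^(2/3)` (rounded up), episode
lengths `H k`, diminishing step sizes, one communication round. -/
def adaptiveSchedule (N : ℕ) (γ Lθ Cπ Cφ μw Cw δ : ℝ) (H : ℕ → ℕ) : Schedule where
  ηθ := fun k => actorStepSize N γ Lθ Cπ Cφ μw Cw (dimStep γ Cφ (k + 1))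
  ηw := fun k => dimStep γ Cφ k
  B := fun k => ⌈Real.log (1 / (2 * δ / (N * Real.pi ^ 2 * ((k : ℝ) + 1) ^ 2))) *
    ((k : ℝ) + 1) ^ (2 / 3 : ℝ)⌉₊
  H := H
  rounds := 1

end DSAC

end

/-! The argument separates the randomness from the dynamics. For given parameters and critics,
everything an iteration computes depends on its batch only through two finite families of averages:
the discounted numbers of visits to the state-action pairs, and the discounted numbers of ordered
pairs of visits (`empOcc_eq`, `criticGrad_eq`, `actorGrad_eq`). It is enough that these finitely
many bounded scalars concentrate. No uniformity over the critics is needed, and it does no harm that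
the estimated reward is correlated with the trajectories it is applied to. Hoeffding's inequality,
the truncation bias and a union bound make a batch accurate up to a multiple of `e` with high
probability for each fixed policy (`exists_sum_not_accurate_le`); summing over histories carries
this over to the random policy of a run (`IsRun.measureReal_bad_le`).

Along accurate batches the analysis is deterministic. The critic objectives are quadratic, and all
agents share the Hessian `criticOp`; strong convexity of the global critic objective is a lower
bound for this operator alone. Hence the optimal critic solves a linear system and is Lipschitz in
the policy parameter (`exists_isCriticOpt_lipschitz`), and the averaged critic performs a
contracting gradient step, up to sampling noise, in which the disagreement of the agents does not
appear (`norm_avg_criticStep_sub_le`). The disagreement itself contracts by the spectral gap and is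
refilled at order `η ^ 2` (`consensusSq_criticStep_le`). The objective ascends by smoothness
(`objective_actorStep_ge`), with an error made of critic error, disagreement, model error and noise
(`norm_actorVec_sub_sq_le`).

The critic target moves with the policy, so the recursions are coupled: the drift of the target is
proportional to the actor displacement. The ascent inequality keeps a multiple of the squared actor
direction, and the prescribed ratio of the step sizes lets this term pay for the drift. Objective
minus a multiple of the squared critic error is then a Lyapunov function, and `sum_le_of_recursions`
bounds the weighted sum of squared gradients by a constant plus multiples of `∑ η e²`, `∑ η³` and `W
∑ ηθ`. With `η` and `e` of order `√ε` and `ε ^ (-3/2)` iterations, both sums are bounded while the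
actor steps add up to order `1 / ε`. With `η` at most and `e` equal to `(k + 1) ^ (-1/3)`, both sums
are at most harmonic and the actor steps add up to at least order `T ^ (2/3)`. -/

namespace DSAC

/-! ### Finite Markov chains -/

section Chain

variable {X : Type*} [Fintype X]

/-- One step of the chain with kernel `K`, acting on laws. -/
def chainStep (K : X → X → ℝ) (ν : X → ℝ) (y : X) : ℝ := ∑ x, ν x * K x y

/-- The law at time `t` of the chain with kernel `K` and initial law `ν`. -/
def chainLaw (K : X → X → ℝ) (ν : X → ℝ) (t : ℕ) : X → ℝ := (chainStep K)^[t] ν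

/-- The expected discounted number of visits of the chain to each state. -/
noncomputable def discVisits (γ : ℝ) (K : X → X → ℝ) (ν : X → ℝ) (y : X) : ℝ :=
  ∑' t : ℕ, γ ^ t * chainLaw K ν t y

/-- Probability vectors. -/
structure IsLaw (ν : X → ℝ) : Prop where
  nonneg : ∀ x, 0 ≤ ν x
  sum_eq_one : ∑ x, ν x = 1

theorem IsLaw.le_one {ν : X → ℝ} (h : IsLaw ν) (x : X) : ν x ≤ 1 := by
  rw [← h.sum_eq_one]
  exact Finset.single_le_sum (fun i _ => h.nonneg i) (Finset.mem_univ x)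

theorem isLaw_single [DecidableEq X] (x : X) : IsLaw (Pi.single x (1 : ℝ) : X → ℝ) where
  nonneg y := by
    by_cases h : y = x
    · subst h; simp
    · simp [h]
  sum_eq_one := by simp

theorem chainLaw_zero (K : X → X → ℝ) (ν : X → ℝ) : chainLaw K ν 0 = ν := rfl

theorem chainLaw_succ (K : X → X → ℝ) (ν : X → ℝ) (t : ℕ) (y : X) :
    chainLaw K ν (t + 1) y = ∑ x, chainLaw K ν t x * K x y := by
  rw [chainLaw, Function.iterate_succ_apply']; rfl

theorem chainLaw_succ' (K : X → X → ℝ) (ν : X → ℝ) (t : ℕ) :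
    chainLaw K ν (t + 1) = chainLaw K (chainStep K ν) t := rfl

theorem IsLaw.chainStep {K : X → X → ℝ} {ν : X → ℝ} (hν : IsLaw ν) (hK : ∀ x, IsLaw (K x)) :
    IsLaw (chainStep K ν) where
  nonneg y := Finset.sum_nonneg fun x _ => mul_nonneg (hν.nonneg x) ((hK x).nonneg y)
  sum_eq_one := by
    simp only [DSAC.chainStep]
    rw [Finset.sum_comm]
    simp [← Finset.mul_sum, (hK _).sum_eq_one, hν.sum_eq_one]

theorem IsLaw.chainLaw {K : X → X → ℝ} {ν : X → ℝ} (hν : IsLaw ν) (hK : ∀ x, IsLaw (K x))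
    (t : ℕ) : IsLaw (chainLaw K ν t) := by
  induction t generalizing ν with
  | zero => exact hν
  | succ t ih => rw [chainLaw_succ']; exact ih (hν.chainStep hK)

/-- The chain acts linearly on laws, so point masses determine everything; this is what turns a
first step into the recursion of `discVisits_single`. -/
theorem chainLaw_eq_sum_single [DecidableEq X] (K : X → X → ℝ) (ν : X → ℝ) (t : ℕ) (y : X) :
    chainLaw K ν t y = ∑ x, ν x * chainLaw K (Pi.single x 1) t y := by
  induction t generalizing y with
  | zero => simp [chainLaw_zero, Pi.single_apply]
  | succ t ih =>
    simp only [chainLaw_succ, ih, Finset.sum_mul, Finset.mul_sum]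
    rw [Finset.sum_comm]
    simp only [mul_assoc]

theorem chainStep_single [DecidableEq X] (K : X → X → ℝ) (x : X) :
    chainStep K (Pi.single x 1) = K x := by
  ext y; simp [chainStep, Pi.single_apply]

/-! ### Discounted visits, truncation and perturbation of the kernel -/

section Discount

variable {γ : ℝ} {K : X → X → ℝ} {ν : X → ℝ}

theorem summable_discVisits (hγ₀ : 0 ≤ γ) (hγ₁ : γ < 1) (hK : ∀ x, IsLaw (K x)) (hν : IsLaw ν)
    (y : X) : Summable fun t : ℕ => γ ^ t * chainLaw K ν t y :=
  (summable_geometric_of_lt_one hγ₀ hγ₁).of_nonneg_of_le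
    (fun t => mul_nonneg (pow_nonneg hγ₀ t) ((hν.chainLaw hK t).nonneg y))
    (fun t => mul_le_of_le_one_right (pow_nonneg hγ₀ t) ((hν.chainLaw hK t).le_one y))

theorem discVisits_nonneg (hγ₀ : 0 ≤ γ) (hK : ∀ x, IsLaw (K x)) (hν : IsLaw ν) (y : X) :
    0 ≤ discVisits γ K ν y :=
  tsum_nonneg fun t => mul_nonneg (pow_nonneg hγ₀ t) ((hν.chainLaw hK t).nonneg y)

theorem sum_discVisits (hγ₀ : 0 ≤ γ) (hγ₁ : γ < 1) (hK : ∀ x, IsLaw (K x)) (hν : IsLaw ν) :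
    ∑ y, discVisits γ K ν y = (1 - γ)⁻¹ := by
  simp only [discVisits]
  rw [← Summable.tsum_finsetSum fun y _ => summable_discVisits hγ₀ hγ₁ hK hν y]
  simp only [← Finset.mul_sum, (hν.chainLaw hK _).sum_eq_one, mul_one]
  exact tsum_geometric_of_lt_one hγ₀ hγ₁

theorem discVisits_le (hγ₀ : 0 ≤ γ) (hγ₁ : γ < 1) (hK : ∀ x, IsLaw (K x)) (hν : IsLaw ν) (y : X) :
    discVisits γ K ν y ≤ (1 - γ)⁻¹ := by
  rw [← sum_discVisits hγ₀ hγ₁ hK hν]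
  exact Finset.single_le_sum (fun i _ => discVisits_nonneg hγ₀ hK hν i) (Finset.mem_univ y)

theorem discVisits_eq_sum_add (hγ₀ : 0 ≤ γ) (hγ₁ : γ < 1) (hK : ∀ x, IsLaw (K x)) (hν : IsLaw ν)
    (n : ℕ) (y : X) : discVisits γ K ν y =
      ∑ t ∈ Finset.range n, γ ^ t * chainLaw K ν t y
        + ∑' t : ℕ, γ ^ (t + n) * chainLaw K ν (t + n) y :=
  ((summable_discVisits hγ₀ hγ₁ hK hν y).sum_add_tsum_nat_add n).symm

/-- What is cut off is a geometric tail of probabilities, each at most one. -/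
theorem abs_discVisits_sub_le (hγ₀ : 0 ≤ γ) (hγ₁ : γ < 1) (hK : ∀ x, IsLaw (K x)) (hν : IsLaw ν)
    (n : ℕ) (y : X) :
    |∑ t ∈ Finset.range n, γ ^ t * chainLaw K ν t y - discVisits γ K ν y| ≤ γ ^ n * (1 - γ)⁻¹ := by
  rw [discVisits_eq_sum_add hγ₀ hγ₁ hK hν n y, sub_add_cancel_left, abs_neg, abs_of_nonneg
    (tsum_nonneg fun t => mul_nonneg (pow_nonneg hγ₀ _) ((hν.chainLaw hK _).nonneg y)),
    ← tsum_geometric_of_lt_one hγ₀ hγ₁, ← tsum_mul_left]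
  refine Summable.tsum_le_tsum (fun t => ?_)
    ((summable_nat_add_iff n).2 (summable_discVisits hγ₀ hγ₁ hK hν y))
    ((summable_geometric_of_lt_one hγ₀ hγ₁).mul_left _)
  rw [← pow_add, add_comm n t]
  exact mul_le_of_le_one_right (pow_nonneg hγ₀ _) ((hν.chainLaw hK _).le_one y)

/-- First-step analysis, i.e. the Bellman equation of the resolvent: split off time zero and restart
the chain after one transition. -/
theorem discVisits_single [DecidableEq X] (hγ₀ : 0 ≤ γ) (hγ₁ : γ < 1) (hK : ∀ x, IsLaw (K x))
    (x y : X) : discVisits γ K (Pi.single x 1) y =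
      (Pi.single x (1 : ℝ) : X → ℝ) y + γ * ∑ z, K x z * discVisits γ K (Pi.single z 1) y := by
  have hs := summable_discVisits hγ₀ hγ₁ hK (isLaw_single x) y
  rw [discVisits, hs.tsum_eq_zero_add]
  simp only [pow_zero, chainLaw_zero, one_mul, chainLaw_succ', chainStep_single]
  congr 1
  simp only [discVisits, ← tsum_mul_left]
  rw [← Summable.tsum_finsetSum fun z _ =>
    (summable_discVisits hγ₀ hγ₁ hK (isLaw_single z) y).mul_left _, ← tsum_mul_left]
  congr 1; ext t
  rw [chainLaw_eq_sum_single, Finset.mul_sum, Finset.mul_sum]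
  exact Finset.sum_congr rfl fun z _ => by ring

/-- The resolvent of a finite chain is Lipschitz in the kernel. -/
theorem abs_discVisits_single_sub_le [DecidableEq X] (hγ₀ : 0 ≤ γ) (hγ₁ : γ < 1)
    (hK : ∀ x, IsLaw (K x)) {K' : X → X → ℝ} (hK' : ∀ x, IsLaw (K' x)) {c : ℝ}
    (hc : ∀ x y, |K x y - K' x y| ≤ c) (x y : X) :
    |discVisits γ K (Pi.single x 1) y - discVisits γ K' (Pi.single x 1) y| ≤
      Fintype.card X * c * (1 - γ)⁻¹ ^ 2 := by
  have : Nonempty X := ⟨x⟩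
  have hg : 0 < 1 - γ := by linarith
  -- At a starting state where the discrepancy is largest, the Bellman equation bounds the
  -- discrepancy by `γ` times itself plus the effect of the changed kernel. Solving this costs one
  -- factor `(1 - γ)⁻¹`; the size of the resolvent costs the other.
  obtain ⟨x₀, hx₀⟩ := Finite.exists_max
    fun x => |discVisits γ K (Pi.single x 1) y - discVisits γ K' (Pi.single x 1) y|
  refine (hx₀ x).trans ?_
  set u := fun x => discVisits γ K (Pi.single x 1) y with hu
  set u' := fun x => discVisits γ K' (Pi.single x 1) y with hu'
  have h0 : ∀ z, 0 ≤ u' z := fun z => discVisits_nonneg hγ₀ hK' (isLaw_single z) y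
  have h1 : ∀ z, u' z ≤ (1 - γ)⁻¹ := fun z => discVisits_le hγ₀ hγ₁ hK' (isLaw_single z) y
  have hc0 : 0 ≤ c := (abs_nonneg _).trans (hc x x)
  have key : u x₀ - u' x₀ =
      γ * (∑ z, K x₀ z * (u z - u' z) + ∑ z, (K x₀ z - K' x₀ z) * u' z) := by
    simp only [hu, hu']
    rw [discVisits_single hγ₀ hγ₁ hK, discVisits_single hγ₀ hγ₁ hK', ← Finset.sum_add_distrib]
    rw [add_sub_add_left_eq_sub, ← mul_sub, ← Finset.sum_sub_distrib]
    congr 1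
    exact Finset.sum_congr rfl fun z _ => by ring
  have b1 : |∑ z, K x₀ z * (u z - u' z)| ≤ |u x₀ - u' x₀| := by
    refine (Finset.abs_sum_le_sum_abs _ _).trans ?_
    calc ∑ z, |K x₀ z * (u z - u' z)| ≤ ∑ z, K x₀ z * |u x₀ - u' x₀| := by
          refine Finset.sum_le_sum fun z _ => ?_
          rw [abs_mul, abs_of_nonneg ((hK x₀).nonneg z)]
          exact mul_le_mul_of_nonneg_left (hx₀ z) ((hK x₀).nonneg z)
      _ = _ := by rw [← Finset.sum_mul, (hK x₀).sum_eq_one, one_mul]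
  have b2 : |∑ z, (K x₀ z - K' x₀ z) * u' z| ≤ Fintype.card X * c * (1 - γ)⁻¹ := by
    refine (Finset.abs_sum_le_sum_abs _ _).trans ?_
    calc ∑ z, |(K x₀ z - K' x₀ z) * u' z| ≤ ∑ z : X, c * (1 - γ)⁻¹ := by
          refine Finset.sum_le_sum fun z _ => ?_
          rw [abs_mul, abs_of_nonneg (h0 z)]
          exact mul_le_mul (hc _ _) (h1 z) (h0 z) hc0
      _ = _ := by simp [mul_assoc]
  have b3 : |u x₀ - u' x₀| ≤ γ * |u x₀ - u' x₀| + Fintype.card X * c * (1 - γ)⁻¹ := by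
    have hb : (0 : ℝ) ≤ Fintype.card X * c * (1 - γ)⁻¹ := by positivity
    calc |u x₀ - u' x₀| = γ * |∑ z, K x₀ z * (u z - u' z) + ∑ z, (K x₀ z - K' x₀ z) * u' z| := by
          conv_lhs => rw [key]
          rw [abs_mul, abs_of_nonneg hγ₀]
      _ ≤ γ * (|u x₀ - u' x₀| + Fintype.card X * c * (1 - γ)⁻¹) := by
          gcongr
          exact (abs_add_le _ _).trans (add_le_add b1 b2)
      _ ≤ _ := by nlinarith
  change |u x₀ - u' x₀| ≤ _
  rw [pow_two, ← mul_assoc, ← div_eq_mul_inv _ (1 - γ), le_div_iff₀ hg]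
  linarith

end Discount

/-! ### Paths of a finite chain -/

/-- The probability of a path. -/
def pathProb (K : X → X → ℝ) (ν : X → ℝ) {H : ℕ} (τ : Fin (H + 1) → X) : ℝ :=
  ν (τ 0) * ∏ t : Fin H, K (τ t.castSucc) (τ t.succ)

theorem pathProb_nonneg {K : X → X → ℝ} {ν : X → ℝ} (hK : ∀ x, IsLaw (K x)) (hν : IsLaw ν)
    {H : ℕ} (τ : Fin (H + 1) → X) : 0 ≤ pathProb K ν τ :=
  mul_nonneg (hν.nonneg _) (Finset.prod_nonneg fun _ _ => (hK _).nonneg _)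

/-- Peeling off the last state drives every induction on the path length below: a last state that is
not observed sums to one, and one that is observed is replaced by its conditional expectation given
its predecessor. -/
theorem pathProb_snoc (K : X → X → ℝ) (ν : X → ℝ) {H : ℕ} (τ : Fin (H + 1) → X) (y : X) :
    pathProb K ν (Fin.snoc τ y : Fin (H + 2) → X) = pathProb K ν τ * K (τ (Fin.last H)) y := by
  have h0 : (Fin.snoc τ y : Fin (H + 2) → X) 0 = τ 0 := by
    rw [← Fin.castSucc_zero, Fin.snoc_castSucc (α := fun _ => X)]
  simp only [pathProb, h0, Fin.prod_univ_castSucc (n := H), Fin.snoc_castSucc (α := fun _ => X),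
    Fin.succ_last, Fin.snoc_last, Fin.succ_castSucc, mul_assoc]

theorem sum_path_snoc {H : ℕ} (f : (Fin (H + 2) → X) → ℝ) :
    ∑ τ, f τ = ∑ τ : Fin (H + 1) → X, ∑ y, f (Fin.snoc τ y) := by
  rw [← (Fin.snocEquiv fun _ : Fin (H + 2) => X).sum_comp, Fintype.sum_prod_type, Finset.sum_comm]
  rfl

theorem sum_pathProb {K : X → X → ℝ} {ν : X → ℝ} (hK : ∀ x, IsLaw (K x)) (hν : IsLaw ν)
    (H : ℕ) : ∑ τ : Fin (H + 1) → X, pathProb K ν τ = 1 := by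
  induction H with
  | zero =>
    rw [← (Equiv.funUnique (Fin 1) X).symm.sum_comp]
    simpa [pathProb] using hν.sum_eq_one
  | succ H ih =>
    rw [sum_path_snoc]
    simpa [pathProb_snoc, ← Finset.mul_sum, (hK _).sum_eq_one] using ih

theorem isLaw_pathProb {K : X → X → ℝ} {ν : X → ℝ} (hK : ∀ x, IsLaw (K x)) (hν : IsLaw ν)
    (H : ℕ) : IsLaw (pathProb K ν : (Fin (H + 1) → X) → ℝ) :=
  ⟨pathProb_nonneg hK hν, sum_pathProb hK hν H⟩

theorem sum_chainLaw_succ_mul (K : X → X → ℝ) (ν : X → ℝ) (t : ℕ) (g : X → ℝ) :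
    ∑ z, chainLaw K ν t z * ∑ y, K z y * g y = ∑ y, chainLaw K ν (t + 1) y * g y := by
  simp only [chainLaw_succ, Finset.mul_sum, Finset.sum_mul]
  rw [Finset.sum_comm]
  simp only [mul_assoc]

/-- The law of a path at one time. -/
theorem sum_pathProb_mul {K : X → X → ℝ} {ν : X → ℝ} (hK : ∀ x, IsLaw (K x))
    {H : ℕ} (t : Fin (H + 1)) (g : X → ℝ) :
    ∑ τ : Fin (H + 1) → X, pathProb K ν τ * g (τ t) = ∑ x, chainLaw K ν t x * g x := by
  induction H generalizing g with
  | zero =>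
    obtain rfl : t = 0 := Fin.fin_one_eq_zero t
    rw [← (Equiv.funUnique (Fin 1) X).symm.sum_comp]
    simp [pathProb, chainLaw_zero]
  | succ H ih =>
    rw [sum_path_snoc]
    refine Fin.lastCases ?_ (fun s => ?_) t
    · simp only [pathProb_snoc, Fin.snoc_last, mul_assoc, ← Finset.mul_sum]
      rw [ih (Fin.last H) fun z => ∑ y, K z y * g y]
      simpa using sum_chainLaw_succ_mul K ν H g
    · simp only [pathProb_snoc, Fin.snoc_castSucc (α := fun _ => X), mul_right_comm _ (K _ _),
        ← Finset.mul_sum, (hK _).sum_eq_one, mul_one]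
      simpa using ih s g

/-- The joint law of a path at two times. -/
theorem sum_pathProb_mul_mul [DecidableEq X] {K : X → X → ℝ} {ν : X → ℝ} (hK : ∀ x, IsLaw (K x))
    {H : ℕ} (t t' : Fin (H + 1)) (h : t ≤ t') (f g : X → ℝ) :
    ∑ τ : Fin (H + 1) → X, pathProb K ν τ * (f (τ t) * g (τ t')) =
      ∑ x, chainLaw K ν t x * (f x *
        ∑ y, chainLaw K (Pi.single x 1) ((t' : ℕ) - t) y * g y) := by
  induction H generalizing g with
  | zero =>
    obtain rfl : t = 0 := Fin.fin_one_eq_zero t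
    obtain rfl : t' = 0 := Fin.fin_one_eq_zero t'
    rw [← (Equiv.funUnique (Fin 1) X).symm.sum_comp]
    simp [pathProb, chainLaw_zero, Pi.single_apply]
  | succ H ih =>
    -- Here the later time is the final one and the earlier time is not. Integrating out the final
    -- state replaces `g` by its conditional expectation at the previous time, to which the
    -- induction hypothesis applies.
    have hlast : ∀ s : Fin (H + 1), ∑ τ : Fin (H + 2) → X, pathProb K ν τ *
        (f (τ s.castSucc) * g (τ (Fin.last _))) = ∑ x, chainLaw K ν s x * (f x *
        ∑ y, chainLaw K (Pi.single x 1) (H + 1 - s) y * g y) := by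
      intro s
      rw [sum_path_snoc]
      simp only [pathProb_snoc, Fin.snoc_castSucc (α := fun _ => X), Fin.snoc_last, mul_assoc,
        mul_left_comm (K _ _), ← Finset.mul_sum]
      rw [ih s (Fin.last H) (Fin.le_last s) fun z => ∑ y, K z y * g y]
      refine Finset.sum_congr rfl fun x _ => ?_
      rw [sum_chainLaw_succ_mul, Fin.val_last, Nat.succ_sub (Fin.is_le s)]
    induction t' using Fin.lastCases with
    | last =>
      induction t using Fin.lastCases with
      | last =>
        rw [sum_pathProb_mul hK (Fin.last (H + 1)) fun x => f x * g x]
        simp [chainLaw_zero, Pi.single_apply]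
      | cast s => simpa using hlast s
    | cast s' =>
      induction t using Fin.lastCases with
      | last => exact absurd h (not_le.2 (Fin.castSucc_lt_last s'))
      | cast s =>
        rw [sum_path_snoc]
        simp only [pathProb_snoc, Fin.snoc_castSucc (α := fun _ => X), mul_right_comm _ (K _ _),
          ← Finset.mul_sum, (hK _).sum_eq_one, mul_one]
        simpa using ih s s' (by simpa using h) g

/-! ### Discounted visit statistics of truncated paths -/

section Statistics

variable [DecidableEq X] (γ : ℝ)

/-- The discounted number of visits of a path to `x`. -/
def visitStat {H : ℕ} (τ : Fin (H + 1) → X) (x : X) : ℝ :=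
  ∑ t : Fin (H + 1), γ ^ (t : ℕ) * if τ t = x then 1 else 0

/-- The discounted number of pairs of visits of a path, first to `x` and then to `y`. -/
def pairStat {H : ℕ} (τ : Fin (H + 1) → X) (x y : X) : ℝ :=
  ∑ t : Fin (H + 1), γ ^ (t : ℕ) * ((if τ t = x then 1 else 0) *
    ∑ t' ∈ Finset.Ici t, γ ^ ((t' : ℕ) - t) * if τ t' = y then 1 else 0)

variable {γ} {K : X → X → ℝ} {ν : X → ℝ}

theorem sum_pow_fin_le (hγ₀ : 0 ≤ γ) (hγ₁ : γ < 1) (n : ℕ) :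
    ∑ t : Fin n, γ ^ (t : ℕ) ≤ (1 - γ)⁻¹ := by
  rw [Fin.sum_univ_eq_sum_range (fun t => γ ^ t) n, ← tsum_geometric_of_lt_one hγ₀ hγ₁]
  exact (summable_geometric_of_lt_one hγ₀ hγ₁).sum_le_tsum _ fun t _ => pow_nonneg hγ₀ t

theorem sum_Ici_eq {H : ℕ} (t : Fin (H + 1)) (f : ℕ → ℝ) :
    ∑ t' ∈ Finset.Ici t, f ((t' : ℕ) - t) = ∑ u ∈ Finset.range (H + 1 - t), f u := by
  refine Finset.sum_bij' (fun t' _ => (t' : ℕ) - t)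
    (fun u hu => ⟨t + u, by have := Finset.mem_range.1 hu; omega⟩) ?_ ?_ ?_ ?_ ?_
  · intro t' ht'
    have : (t : ℕ) ≤ t' := by simpa using ht'
    simp only [Finset.mem_range]; omega
  · intro u hu
    simp [Fin.le_def]
  · intro t' ht'
    have : (t : ℕ) ≤ t' := by simpa using ht'
    ext; simp; omega
  · intro u hu; simp
  · intro t' ht'; rfl

theorem sum_Ici_pow_le (hγ₀ : 0 ≤ γ) (hγ₁ : γ < 1) {H : ℕ} (t : Fin (H + 1)) :
    ∑ t' ∈ Finset.Ici t, γ ^ ((t' : ℕ) - t) ≤ (1 - γ)⁻¹ := by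
  rw [sum_Ici_eq t fun u => γ ^ u, ← Fin.sum_univ_eq_sum_range]
  exact sum_pow_fin_le hγ₀ hγ₁ _

theorem visitStat_nonneg (hγ₀ : 0 ≤ γ) {H : ℕ} (τ : Fin (H + 1) → X) (x : X) :
    0 ≤ visitStat γ τ x :=
  Finset.sum_nonneg fun t _ => mul_nonneg (pow_nonneg hγ₀ _) (by split_ifs <;> simp)

theorem visitStat_le (hγ₀ : 0 ≤ γ) (hγ₁ : γ < 1) {H : ℕ} (τ : Fin (H + 1) → X) (x : X) :
    visitStat γ τ x ≤ (1 - γ)⁻¹ := by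
  refine le_trans (Finset.sum_le_sum fun t _ => ?_) (sum_pow_fin_le hγ₀ hγ₁ (H + 1))
  exact mul_le_of_le_one_right (pow_nonneg hγ₀ _) (by split_ifs <;> simp)

theorem pairStat_nonneg (hγ₀ : 0 ≤ γ) {H : ℕ} (τ : Fin (H + 1) → X) (x y : X) :
    0 ≤ pairStat γ τ x y :=
  Finset.sum_nonneg fun t _ => mul_nonneg (pow_nonneg hγ₀ _) (mul_nonneg (by split_ifs <;> simp)
    (Finset.sum_nonneg fun t' _ => mul_nonneg (pow_nonneg hγ₀ _) (by split_ifs <;> simp)))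

theorem pairStat_le (hγ₀ : 0 ≤ γ) (hγ₁ : γ < 1) {H : ℕ} (τ : Fin (H + 1) → X) (x y : X) :
    pairStat γ τ x y ≤ (1 - γ)⁻¹ ^ 2 := by
  have hg : 0 ≤ (1 - γ)⁻¹ := inv_nonneg.2 (by linarith)
  have h1 : ∀ t : Fin (H + 1), ∑ t' ∈ Finset.Ici t, γ ^ ((t' : ℕ) - t) *
      (if τ t' = y then (1 : ℝ) else 0) ≤ (1 - γ)⁻¹ := fun t =>
    le_trans (Finset.sum_le_sum fun t' _ => mul_le_of_le_one_right (pow_nonneg hγ₀ _)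
      (by split_ifs <;> simp)) (sum_Ici_pow_le hγ₀ hγ₁ t)
  calc pairStat γ τ x y ≤ ∑ t : Fin (H + 1), γ ^ (t : ℕ) * (1 - γ)⁻¹ := by
        refine Finset.sum_le_sum fun t _ => mul_le_mul_of_nonneg_left ?_ (pow_nonneg hγ₀ _)
        split_ifs
        · rw [one_mul]; exact h1 t
        · rwa [zero_mul]
    _ ≤ _ := by
        rw [← Finset.sum_mul, pow_two]
        exact mul_le_mul_of_nonneg_right (sum_pow_fin_le hγ₀ hγ₁ _) hg

theorem sum_pathProb_visitStat (hK : ∀ x, IsLaw (K x)) (H : ℕ) (x : X) :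
    ∑ τ : Fin (H + 1) → X, pathProb K ν τ * visitStat γ τ x =
      ∑ t ∈ Finset.range (H + 1), γ ^ t * chainLaw K ν t x := by
  simp only [visitStat, Finset.mul_sum, mul_left_comm _ (γ ^ _)]
  rw [Finset.sum_comm, ← Fin.sum_univ_eq_sum_range fun t => γ ^ t * chainLaw K ν t x]
  refine Finset.sum_congr rfl fun t _ => ?_
  rw [← Finset.mul_sum, sum_pathProb_mul hK t fun z => if z = x then 1 else 0]
  simp

/-- By the Markov property, given a visit to `x` at time `t` the state after `u` further steps has
the law of the chain restarted at `x`. Only the lags that fit into the remaining horizon occur. -/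
theorem sum_pathProb_pairStat (hK : ∀ x, IsLaw (K x)) (H : ℕ) (x y : X) :
    ∑ τ : Fin (H + 1) → X, pathProb K ν τ * pairStat γ τ x y =
      ∑ t : Fin (H + 1), γ ^ (t : ℕ) * chainLaw K ν t x *
        ∑ u ∈ Finset.range (H + 1 - t), γ ^ u * chainLaw K (Pi.single x 1) u y := by
  simp only [pairStat, Finset.mul_sum]
  rw [Finset.sum_comm]
  refine Finset.sum_congr rfl fun t _ => ?_
  rw [Finset.sum_comm, ← sum_Ici_eq t fun u => γ ^ (t : ℕ) * chainLaw K ν t x *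
    (γ ^ u * chainLaw K (Pi.single x 1) u y)]
  refine Finset.sum_congr rfl fun t' ht' => ?_
  have h := sum_pathProb_mul_mul (ν := ν) hK t t' (by simpa using ht')
    (fun z => if z = x then 1 else 0) (fun z => if z = y then 1 else 0)
  simp only [mul_ite, mul_one, mul_zero, ite_mul, one_mul, zero_mul, Finset.sum_ite_eq',
    Finset.mem_univ, if_true] at h ⊢
  rw [mul_mul_mul_comm, ← h, Finset.mul_sum]
  refine Finset.sum_congr rfl fun τ _ => ?_
  split_ifs <;> ring

/-- Each of the first `H + 1` terms of the geometric series is at least `γ ^ H`. -/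
theorem mul_pow_le_inv (hγ₀ : 0 ≤ γ) (hγ₁ : γ < 1) (H : ℕ) : (H + 1) * γ ^ H ≤ (1 - γ)⁻¹ := by
  refine le_trans ?_ (sum_pow_fin_le hγ₀ hγ₁ (H + 1))
  calc (H + 1) * γ ^ H = ∑ _t : Fin (H + 1), γ ^ H := by simp
    _ ≤ _ := Finset.sum_le_sum fun t _ => pow_le_pow_of_le_one hγ₀ hγ₁.le (Fin.is_le t)

/-- Write `γ ^ H` as the square of `√γ ^ H`: one factor absorbs the linear term `H + 1`, the other
is at most `e`. In this way the truncation bias needs no logarithmic correction. -/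
theorem mul_pow_le_of_pow_le_sq (hγ₀ : 0 ≤ γ) (hγ₁ : γ < 1) {H : ℕ} {e : ℝ} (he : 0 ≤ e)
    (hH : γ ^ H ≤ e ^ 2) : (H + 1) * γ ^ H ≤ (1 - √γ)⁻¹ * e := by
  have h1 : √γ < 1 := by rw [Real.sqrt_lt' one_pos]; simpa
  have h2 : γ ^ H = √γ ^ H * √γ ^ H := by rw [← mul_pow, Real.mul_self_sqrt hγ₀]
  have h3 : √γ ^ H ≤ e := by
    refine le_of_sq_le_sq ?_ he
    rwa [pow_two, ← h2]
  have := mul_pow_le_inv (Real.sqrt_nonneg γ) h1 H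
  rw [h2, ← mul_assoc]
  exact mul_le_mul this h3 (pow_nonneg (Real.sqrt_nonneg _) _) (inv_nonneg.2 (by linarith))

/-- The truncation bias of the visit statistics. -/
theorem abs_sum_visitStat_sub_le (hγ₀ : 0 ≤ γ) (hγ₁ : γ < 1) (hK : ∀ x, IsLaw (K x))
    (hν : IsLaw ν) {H : ℕ} {e : ℝ} (he : 0 ≤ e) (hH : γ ^ H ≤ e ^ 2) (x : X) :
    |∑ τ : Fin (H + 1) → X, pathProb K ν τ * visitStat γ τ x - discVisits γ K ν x| ≤
      (1 - √γ)⁻¹ * (1 - γ)⁻¹ * e := by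
  rw [sum_pathProb_visitStat hK]
  have h0 : 0 ≤ γ ^ H := pow_nonneg hγ₀ H
  have hg : 0 ≤ (1 - γ)⁻¹ := inv_nonneg.2 (by linarith)
  have h1 := mul_pow_le_of_pow_le_sq hγ₀ hγ₁ he hH
  refine (abs_discVisits_sub_le hγ₀ hγ₁ hK hν (H + 1) x).trans ?_
  rw [mul_right_comm]
  refine mul_le_mul_of_nonneg_right (le_trans ?_ h1) hg
  calc γ ^ (H + 1) ≤ γ ^ H := pow_le_pow_of_le_one hγ₀ hγ₁.le (Nat.le_succ H)
    _ ≤ (H + 1) * γ ^ H := le_mul_of_one_le_left h0 (by linarith [Nat.cast_nonneg (α := ℝ) H])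

/-- The truncation bias of the pair statistics. -/
theorem abs_sum_pairStat_sub_le (hγ₀ : 0 ≤ γ) (hγ₁ : γ < 1) (hK : ∀ x, IsLaw (K x))
    (hν : IsLaw ν) {H : ℕ} {e : ℝ} (he : 0 ≤ e) (hH : γ ^ H ≤ e ^ 2) (x y : X) :
    |∑ τ : Fin (H + 1) → X, pathProb K ν τ * pairStat γ τ x y -
      discVisits γ K ν x * discVisits γ K (Pi.single x 1) y| ≤
      2 * (1 - √γ)⁻¹ * (1 - γ)⁻¹ ^ 2 * e := by
  have hg : 1 ≤ (1 - γ)⁻¹ := by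
    rw [one_le_inv₀ (by linarith)]; linarith
  have hg0 := zero_le_one.trans hg
  have h1 := mul_pow_le_of_pow_le_sq hγ₀ hγ₁ he hH
  set G := discVisits γ K (Pi.single x 1) y with hG
  have hG0 : 0 ≤ G := discVisits_nonneg hγ₀ hK (isLaw_single x) y
  have hG1 : G ≤ (1 - γ)⁻¹ := discVisits_le hγ₀ hγ₁ hK (isLaw_single x) y
  have a1 := abs_sum_visitStat_sub_le hγ₀ hγ₁ hK hν he hH x
  rw [sum_pathProb_visitStat hK, ← Fin.sum_univ_eq_sum_range fun t => γ ^ t * chainLaw K ν t x]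
    at a1
  rw [sum_pathProb_pairStat hK]
  set V := ∑ t : Fin (H + 1), γ ^ (t : ℕ) * chainLaw K ν t x with hV
  -- Completing the inner sum at time `t` costs `γ ^ t * γ ^ (H + 1 - t)` up to a constant. This
  -- does not depend on `t`, so the `H + 1` terms add up to a multiple of `(H + 1) * γ ^ H`.
  have a2 : |∑ t : Fin (H + 1), γ ^ (t : ℕ) * chainLaw K ν t x *
        ∑ u ∈ Finset.range (H + 1 - t), γ ^ u * chainLaw K (Pi.single x 1) u y - V * G| ≤
        (1 - √γ)⁻¹ * (1 - γ)⁻¹ * e := by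
    rw [hV, Finset.sum_mul, ← Finset.sum_sub_distrib]
    refine (Finset.abs_sum_le_sum_abs _ _).trans ?_
    calc _ ≤ ∑ t : Fin (H + 1), γ ^ H * (1 - γ)⁻¹ := by
          refine Finset.sum_le_sum fun t _ => ?_
          rw [← mul_sub, abs_mul, abs_of_nonneg (mul_nonneg (pow_nonneg hγ₀ _)
            ((hν.chainLaw hK _).nonneg x))]
          have b1 := abs_discVisits_sub_le hγ₀ hγ₁ hK (isLaw_single x) (H + 1 - t) y
          calc _ ≤ γ ^ (t : ℕ) * (γ ^ (H + 1 - t) * (1 - γ)⁻¹) :=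
                mul_le_mul (mul_le_of_le_one_right (pow_nonneg hγ₀ _)
                  ((hν.chainLaw hK _).le_one x)) b1 (abs_nonneg _) (pow_nonneg hγ₀ _)
            _ = γ ^ (H + 1) * (1 - γ)⁻¹ := by
                rw [← mul_assoc, ← pow_add]; congr 2; omega
            _ ≤ _ := mul_le_mul_of_nonneg_right
                (pow_le_pow_of_le_one hγ₀ hγ₁.le (Nat.le_succ H)) hg0
      _ = ((H + 1) * γ ^ H) * (1 - γ)⁻¹ := by simp; ring
      _ ≤ _ := by rw [mul_right_comm _ _ e]; exact mul_le_mul_of_nonneg_right h1 hg0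
  -- The outer sum is then completed with the first-order estimate, at the price of the bound for
  -- the resolvent.
  have a3 : |V * G - discVisits γ K ν x * G| ≤ (1 - √γ)⁻¹ * (1 - γ)⁻¹ * e * (1 - γ)⁻¹ := by
    rw [← sub_mul, abs_mul, abs_of_nonneg hG0]
    exact mul_le_mul a1 hG1 hG0 ((abs_nonneg _).trans a1)
  refine (abs_sub_le _ (V * G) _).trans ((add_le_add a2 a3).trans ?_)
  have : 0 ≤ (1 - √γ)⁻¹ * (1 - γ)⁻¹ * e := (abs_nonneg _).trans a1
  nlinarith

end Statistics

end Chain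

/-! ### Concentration of averages -/

section Concentration

variable {Y : Type*} [Fintype Y]

theorem IsLaw.sum_prod {q : Y → ℝ} (hq : IsLaw q) (B : ℕ) :
    ∑ b : Fin B → Y, ∏ j, q (b j) = 1 := by
  classical
  have := Finset.prod_univ_sum (fun _ : Fin B => (Finset.univ : Finset Y)) (fun _ => q)
  rw [Fintype.piFinset_univ] at this
  rw [← this]; simp [hq.sum_eq_one]

/-- Hoeffding's lemma. -/
theorem IsLaw.sum_mul_exp_le {q : Y → ℝ} (hq : IsLaw q) {g : Y → ℝ} {R : ℝ} (hR : 0 < R)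
    (hg : ∀ y, |g y| ≤ R) (hmean : ∑ y, q y * g y = 0) (s : ℝ) :
    ∑ y, q y * Real.exp (s * g y) ≤ Real.exp (s ^ 2 * R ^ 2 / 2) := by
  -- The exponential lies below its chord over `[-sR, sR]`. The chord is affine in `g y`, so the
  -- centring removes the `sinh` term from the expectation.
  have h1 : ∀ y, Real.exp (s * g y) ≤ Real.cosh (s * R) + g y / R * Real.sinh (s * R) := by
    intro y
    have hy := abs_le.1 (hg y)
    have ha : 0 ≤ (1 + g y / R) / 2 := by
      have : -1 ≤ g y / R := by rw [le_div_iff₀ hR]; linarith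
      linarith
    have hb : 0 ≤ (1 - g y / R) / 2 := by
      have : g y / R ≤ 1 := by rw [div_le_iff₀ hR]; linarith
      linarith
    have h2 := convexOn_exp.2 (Set.mem_univ (s * R)) (Set.mem_univ (-(s * R))) ha hb (by ring)
    simp only [smul_eq_mul] at h2
    have h3 : (1 + g y / R) / 2 * (s * R) + (1 - g y / R) / 2 * -(s * R) = s * g y := by
      field_simp; ring
    rw [h3] at h2
    refine h2.trans (le_of_eq ?_)
    rw [Real.cosh_eq, Real.sinh_eq]; ring
  calc ∑ y, q y * Real.exp (s * g y)
      ≤ ∑ y, q y * (Real.cosh (s * R) + g y / R * Real.sinh (s * R)) :=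
        Finset.sum_le_sum fun y _ => mul_le_mul_of_nonneg_left (h1 y) (hq.nonneg y)
    _ = (∑ y, q y) * Real.cosh (s * R) + (∑ y, q y * g y) * (Real.sinh (s * R) / R) := by
        rw [Finset.sum_mul, Finset.sum_mul, ← Finset.sum_add_distrib]
        exact Finset.sum_congr rfl fun y _ => by ring
    _ = Real.cosh (s * R) := by rw [hq.sum_eq_one, hmean]; ring
    _ ≤ _ := by
        refine (Real.cosh_le_exp_half_sq _).trans (le_of_eq ?_)
        congr 1; ring

/-- The Chernoff bound for sums of independent centred bounded variables. -/
theorem IsLaw.sum_filter_le_exp {q : Y → ℝ} (hq : IsLaw q) {g : Y → ℝ} {R : ℝ} (hR : 0 < R)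
    (hg : ∀ y, |g y| ≤ R) (hmean : ∑ y, q y * g y = 0) (B : ℕ) {c : ℝ} (hc : 0 ≤ c) :
    ∑ b : Fin B → Y with B * c ≤ ∑ j, g (b j), ∏ j, q (b j) ≤
      Real.exp (-(B * c ^ 2 / (2 * R ^ 2))) := by
  classical
  -- The minimizer of the Chernoff exponent `-s B c + B s² R² / 2`.
  set s := c / R ^ 2 with hs
  have hs0 : 0 ≤ s := by positivity
  have hq0 : ∀ b : Fin B → Y, 0 ≤ ∏ j, q (b j) :=
    fun b => Finset.prod_nonneg fun j _ => hq.nonneg _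
  calc ∑ b : Fin B → Y with B * c ≤ ∑ j, g (b j), ∏ j, q (b j)
      ≤ ∑ b : Fin B → Y with B * c ≤ ∑ j, g (b j),
          Real.exp (-(s * (B * c))) * ∏ j, (q (b j) * Real.exp (s * g (b j))) := by
        refine Finset.sum_le_sum fun b hb => ?_
        have hb' : B * c ≤ ∑ j, g (b j) := by simpa using hb
        rw [Finset.prod_mul_distrib, ← Real.exp_sum, ← Finset.mul_sum, mul_left_comm,
          ← Real.exp_add]
        refine le_mul_of_one_le_right (hq0 b) (Real.one_le_exp ?_)
        nlinarith
    _ ≤ ∑ b : Fin B → Y,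
          Real.exp (-(s * (B * c))) * ∏ j, (q (b j) * Real.exp (s * g (b j))) :=
        Finset.sum_le_sum_of_subset_of_nonneg (Finset.filter_subset _ _) fun b _ _ =>
          mul_nonneg (Real.exp_nonneg _) (Finset.prod_nonneg fun j _ =>
            mul_nonneg (hq.nonneg _) (Real.exp_nonneg _))
    _ = Real.exp (-(s * (B * c))) * (∑ y, q y * Real.exp (s * g y)) ^ B := by
        rw [← Finset.mul_sum]
        congr 1
        have := Finset.prod_univ_sum (fun _ : Fin B => (Finset.univ : Finset Y))
          (fun _ y => q y * Real.exp (s * g y))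
        rw [Fintype.piFinset_univ] at this
        rw [← this]; simp
    _ ≤ Real.exp (-(s * (B * c))) * Real.exp (s ^ 2 * R ^ 2 / 2) ^ B := by
        gcongr
        · exact Finset.sum_nonneg fun y _ => mul_nonneg (hq.nonneg _) (Real.exp_nonneg _)
        · exact hq.sum_mul_exp_le hR hg hmean s
    _ = _ := by
        rw [← Real.exp_nat_mul, ← Real.exp_add, hs]
        congr 1
        field_simp; ring

/-- Hoeffding's inequality for averages. -/
theorem IsLaw.sum_filter_abs_le_exp {q : Y → ℝ} (hq : IsLaw q) {f : Y → ℝ} {R : ℝ} (hR : 0 < R)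
    (hf₀ : ∀ y, 0 ≤ f y) (hf₁ : ∀ y, f y ≤ R) {B : ℕ} {c : ℝ} (hc : 0 < c) :
    ∑ b : Fin B → Y with c < |1 / (B : ℝ) * ∑ j, f (b j) - ∑ y, q y * f y|, ∏ j, q (b j) ≤
      2 * Real.exp (-(B * c ^ 2 / (2 * R ^ 2))) := by
  classical
  -- For an empty batch the right-hand side equals two, which exceeds any probability.
  rcases Nat.eq_zero_or_pos B with rfl | hB
  · refine (Finset.sum_le_sum_of_subset_of_nonneg (Finset.filter_subset _ _) fun b _ _ =>
      Finset.prod_nonneg fun j _ => hq.nonneg _).trans ?_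
    rw [hq.sum_prod]; simp
  have hB' : (0 : ℝ) < B := by exact_mod_cast hB
  set μ := ∑ y, q y * f y with hμ
  have hμ0 : 0 ≤ μ := Finset.sum_nonneg fun y _ => mul_nonneg (hq.nonneg y) (hf₀ y)
  have hμ1 : μ ≤ R := by
    calc μ ≤ ∑ y, q y * R :=
          Finset.sum_le_sum fun y _ => mul_le_mul_of_nonneg_left (hf₁ y) (hq.nonneg y)
      _ = R := by rw [← Finset.sum_mul, hq.sum_eq_one, one_mul]
  have h1 := hq.sum_filter_le_exp (g := fun y => f y - μ) hR
    (fun y => abs_le.2 ⟨by linarith [hf₀ y], by linarith [hf₁ y]⟩)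
    (by simp [mul_sub, Finset.sum_sub_distrib, ← Finset.sum_mul, hq.sum_eq_one, hμ]) B hc.le
  have h2 := hq.sum_filter_le_exp (g := fun y => μ - f y) hR
    (fun y => abs_le.2 ⟨by linarith [hf₁ y], by linarith [hf₀ y]⟩)
    (by simp [mul_sub, Finset.sum_sub_distrib, ← Finset.sum_mul, hq.sum_eq_one, hμ]) B hc.le
  rw [two_mul]
  refine le_trans ?_ (add_le_add h1 h2)
  -- The indicator of the two-sided deviation is at most the sum of the two one-sided indicators,
  -- for each batch separately.
  rw [Finset.sum_filter, Finset.sum_filter, Finset.sum_filter, ← Finset.sum_add_distrib]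
  refine Finset.sum_le_sum fun b _ => ?_
  have hp : 0 ≤ ∏ j, q (b j) := Finset.prod_nonneg fun j _ => hq.nonneg _
  have e1 : ∑ j, (f (b j) - μ) = B * (1 / (B : ℝ) * ∑ j, f (b j) - μ) := by
    rw [mul_sub, ← mul_assoc, mul_one_div_cancel hB'.ne']; simp
  have e2 : ∑ j, (μ - f (b j)) = B * -(1 / (B : ℝ) * ∑ j, f (b j) - μ) := by
    rw [mul_neg, ← e1, ← Finset.sum_neg_distrib]; simp
  rw [e1, e2]
  split_ifs with hab h3 h4 h4 <;> try linarith
  rcases lt_abs.1 hab with h | h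
  · exact absurd (mul_le_mul_of_nonneg_left h.le hB'.le) h3
  · exact absurd (mul_le_mul_of_nonneg_left h.le hB'.le) h4

end Concentration

end DSAC

namespace DSAC

namespace Model

variable {ι : Type u₁} {S : ι → Type u₂} {A : ι → Type u₃} {p : ι → ℕ} {d : ℕ}
  [Fintype ι] [DecidableEq ι]
  [∀ i, Fintype (S i)] [∀ i, DecidableEq (S i)] [∀ i, Fintype (A i)] [∀ i, DecidableEq (A i)]

/-! ### The state-action chain of a policy -/

section StateActionChain

variable (m : Model ι S A p d) (θ : Param p)

/-- The transition kernel of the state-action chain. -/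
def kernel (x y : (∀ i, S i) × (∀ i, A i)) : ℝ := m.P x.1 x.2 y.1 * m.jointPol θ y.1 y.2

/-- The expected discounted number of visits to `y` of the state-action chain started at `x`. -/
noncomputable def resolvent (x y : (∀ i, S i) × (∀ i, A i)) : ℝ :=
  discVisits m.γ (m.kernel θ) (Pi.single x 1) y

theorem isLaw_jointPol (s : ∀ i, S i) : IsLaw (m.jointPol θ s) where
  nonneg _ := Finset.prod_nonneg fun i _ => m.pol_nonneg i _ _ _
  sum_eq_one := by
    have := Finset.prod_univ_sum (fun i => (Finset.univ : Finset (A i)))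
      (fun i b => m.pol i (θ i) s b)
    rw [Fintype.piFinset_univ] at this
    simp only [jointPol, ← this, m.pol_sum, Finset.prod_const_one]

theorem isLaw_kernel (x : (∀ i, S i) × (∀ i, A i)) : IsLaw (m.kernel θ x) where
  nonneg y := mul_nonneg (m.P_nonneg _ _ _) ((m.isLaw_jointPol θ _).nonneg _)
  sum_eq_one := by
    simp only [kernel, Fintype.sum_prod_type, ← Finset.mul_sum, (m.isLaw_jointPol θ _).sum_eq_one,
      mul_one, m.P_sum]

theorem isLaw_initLaw : IsLaw (m.initLaw θ) where
  nonneg y := mul_nonneg (m.ξ_nonneg _) ((m.isLaw_jointPol θ _).nonneg _)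
  sum_eq_one := by
    simp only [initLaw, Fintype.sum_prod_type, ← Finset.mul_sum, (m.isLaw_jointPol θ _).sum_eq_one,
      mul_one, m.ξ_sum]

theorem saLaw_eq_chainLaw (ν : (∀ i, S i) × (∀ i, A i) → ℝ) (t : ℕ) :
    m.saLaw θ ν t = chainLaw (m.kernel θ) ν t := by
  have : m.stepLaw θ = chainStep (m.kernel θ) := by
    ext ν y; simp only [stepLaw, chainStep, kernel, mul_assoc]
  rw [saLaw, this, chainLaw]

theorem trajProb_eq_pathProb {H : ℕ} (τ : Fin (H + 1) → (∀ i, S i) × (∀ i, A i)) :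
    m.trajProb θ τ = pathProb (m.kernel θ) (m.initLaw θ) τ := by
  simp only [trajProb, pathProb, kernel, initLaw, Fin.prod_univ_succ (n := H),
    Finset.prod_mul_distrib]
  ring

theorem isLaw_trajProb (H : ℕ) :
    IsLaw (m.trajProb θ : (Fin (H + 1) → (∀ i, S i) × (∀ i, A i)) → ℝ) := by
  have := isLaw_pathProb (m.isLaw_kernel θ) (m.isLaw_initLaw θ) H
  rwa [← funext (m.trajProb_eq_pathProb θ)] at this

/-- Discounted expectations are finite sums against discounted visits, so no infinite series is
needed after this point. -/
theorem discExp_eq {E : Type u₄} [NormedAddCommGroup E] [NormedSpace ℝ E]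
    {ν : (∀ i, S i) × (∀ i, A i) → ℝ} (hν : IsLaw ν) (f : (∀ i, S i) × (∀ i, A i) → E) :
    m.discExp θ ν f = ∑ x, discVisits m.γ (m.kernel θ) ν x • f x := by
  refine HasSum.tsum_eq ?_
  simp only [saLaw_eq_chainLaw, Finset.smul_sum, smul_smul]
  exact hasSum_sum fun x _ => (summable_discVisits m.γ_nonneg m.γ_lt_one (m.isLaw_kernel θ) hν
    x).hasSum.smul_const (f x)

theorem occ_apply (x : (∀ i, S i) × (∀ i, A i)) :
    m.occ θ x = discVisits m.γ (m.kernel θ) (m.initLaw θ) x := by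
  simp only [occ, saLaw_eq_chainLaw, discVisits]

theorem discExp_initLaw {E : Type u₄} [NormedAddCommGroup E] [NormedSpace ℝ E]
    (f : (∀ i, S i) × (∀ i, A i) → E) :
    m.discExp θ (m.initLaw θ) f = ∑ x, m.occ θ x • f x := by
  simp only [m.discExp_eq θ (m.isLaw_initLaw θ), occ_apply]

theorem qOf_eq (r : (∀ i, S i) × (∀ i, A i) → ℝ) (x : (∀ i, S i) × (∀ i, A i)) :
    m.qOf θ r x = ∑ y, m.resolvent θ x y * r y :=
  m.discExp_eq θ (isLaw_single x) r

theorem occ_nonneg (x : (∀ i, S i) × (∀ i, A i)) : 0 ≤ m.occ θ x := by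
  rw [occ_apply]
  exact discVisits_nonneg m.γ_nonneg (m.isLaw_kernel θ) (m.isLaw_initLaw θ) x

theorem sum_occ : ∑ x, m.occ θ x = (1 - m.γ)⁻¹ := by
  simp only [occ_apply]
  exact sum_discVisits m.γ_nonneg m.γ_lt_one (m.isLaw_kernel θ) (m.isLaw_initLaw θ)

theorem occ_le (x : (∀ i, S i) × (∀ i, A i)) : m.occ θ x ≤ (1 - m.γ)⁻¹ := by
  rw [occ_apply]
  exact discVisits_le m.γ_nonneg m.γ_lt_one (m.isLaw_kernel θ) (m.isLaw_initLaw θ) x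

theorem resolvent_nonneg (x y : (∀ i, S i) × (∀ i, A i)) : 0 ≤ m.resolvent θ x y :=
  discVisits_nonneg m.γ_nonneg (m.isLaw_kernel θ) (isLaw_single x) y

theorem resolvent_le (x y : (∀ i, S i) × (∀ i, A i)) : m.resolvent θ x y ≤ (1 - m.γ)⁻¹ :=
  discVisits_le m.γ_nonneg m.γ_lt_one (m.isLaw_kernel θ) (isLaw_single x) y

end StateActionChain

theorem marg_eq_sum (m : Model ι S A p d) (i : ι)
    (l : EuclideanSpace ℝ ((∀ i, S i) × (∀ i, A i))) :
    m.marg i l = ∑ x, l x • EuclideanSpace.single (x.1 i, x.2 i) (1 : ℝ) := by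
  ext y
  simp only [marg, WithLp.ofLp_sum, WithLp.ofLp_smul, Finset.sum_apply, Pi.smul_apply, smul_eq_mul]
  refine Finset.sum_congr rfl fun x _ => ?_
  by_cases h : x.1 i = y.1 ∧ x.2 i = y.2
  · have : (x.1 i, x.2 i) = y := Prod.ext h.1 h.2
    simp [h, this]
  · have : y ≠ (x.1 i, x.2 i) := fun h' => h ⟨by rw [h'], by rw [h']⟩
    simp [h, this]

theorem norm_marg_le (m : Model ι S A p d) (i : ι)
    (l : EuclideanSpace ℝ ((∀ i, S i) × (∀ i, A i))) : ‖m.marg i l‖ ≤ ∑ x, |l x| := by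
  rw [marg_eq_sum]
  refine (norm_sum_le _ _).trans (Finset.sum_le_sum fun x _ => ?_)
  simp [norm_smul]

theorem marg_sub (m : Model ι S A p d) (i : ι)
    (l l' : EuclideanSpace ℝ ((∀ i, S i) × (∀ i, A i))) :
    m.marg i (l - l') = m.marg i l - m.marg i l' := by
  simp only [marg_eq_sum, ← Finset.sum_sub_distrib, ← sub_smul, PiLp.sub_apply]

theorem marg_mem_budget (m : Model ι S A p d) (i : ι)
    {l : EuclideanSpace ℝ ((∀ i, S i) × (∀ i, A i))} (h0 : ∀ x, 0 ≤ l x)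
    (h1 : ∑ x, l x ≤ (1 - m.γ)⁻¹) : m.marg i l ∈ m.budget i := by
  refine ⟨fun y => Finset.sum_nonneg fun x _ => ?_, ?_⟩
  · split_ifs
    · exact h0 x
    · exact le_rfl
  · refine le_of_eq_of_le ?_ h1
    simp only [marg]
    rw [Finset.sum_comm]
    refine Finset.sum_congr rfl fun x _ => ?_
    have : ∀ y : S i × A i, (x.1 i = y.1 ∧ x.2 i = y.2) ↔ (x.1 i, x.2 i) = y :=
      fun y => by rw [Prod.ext_iff]
    simp [this]

theorem marg_occ_mem_budget (m : Model ι S A p d) (i : ι) (θ : Param p) :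
    m.marg i (m.occ θ) ∈ m.budget i :=
  m.marg_mem_budget i (m.occ_nonneg θ) (m.sum_occ θ).le

/-! ### Batch averages -/

section Batch

variable (m : Model ι S A p d) {B H : ℕ} (b : Fin B → Fin (H + 1) → (∀ i, S i) × (∀ i, A i))

/-- The batch average of the visit statistics. -/
noncomputable def avgVisit (x : (∀ i, S i) × (∀ i, A i)) : ℝ := 1 / (B : ℝ) * ∑ j, visitStat m.γ (b j) x

/-- The batch average of the pair statistics. -/
noncomputable def avgPair (x y : (∀ i, S i) × (∀ i, A i)) : ℝ := 1 / (B : ℝ) * ∑ j, pairStat m.γ (b j) x y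

/-- The batch averages are within `e` of their untruncated expectations under `π_θ`. -/
def Accurate (θ : Param p) (e : ℝ) : Prop :=
  (∀ x, |m.avgVisit b x - m.occ θ x| ≤ e) ∧
    ∀ x y, |m.avgPair b x y - m.occ θ x * m.resolvent θ x y| ≤ e

theorem sum_pow_smul_eq {X E : Type*} [Fintype X] [DecidableEq X] [AddCommGroup E] [Module ℝ E]
    (γ : ℝ) (τ : Fin (H + 1) → X) (g : X → E) :
    ∑ t : Fin (H + 1), γ ^ (t : ℕ) • g (τ t) = ∑ x, visitStat γ τ x • g x := by
  simp only [visitStat, Finset.sum_smul]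
  rw [Finset.sum_comm]
  simp [ite_smul]

/-- The discounted tail rewards of a path are linear in the reward, with the pair statistics as
coefficients. -/
theorem sum_pow_mul_sum_smul_eq {X E : Type*} [Fintype X] [DecidableEq X] [AddCommGroup E]
    [Module ℝ E] (γ : ℝ) (τ : Fin (H + 1) → X) (h : X → ℝ) (g : X → E) :
    ∑ t : Fin (H + 1), (γ ^ (t : ℕ) * ∑ t' ∈ Finset.Ici t, γ ^ ((t' : ℕ) - t) * h (τ t')) •
      g (τ t) = ∑ x, (∑ y, pairStat γ τ x y * h y) • g x := by
  have h1 : ∀ x, ∑ y, pairStat γ τ x y * h y = ∑ t : Fin (H + 1), if τ t = x then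
      γ ^ (t : ℕ) * ∑ t' ∈ Finset.Ici t, γ ^ ((t' : ℕ) - t) * h (τ t') else 0 := by
    intro x
    simp only [pairStat, Finset.sum_mul]
    rw [Finset.sum_comm]
    refine Finset.sum_congr rfl fun t _ => ?_
    split_ifs
    · simp only [one_mul, mul_assoc, ← Finset.mul_sum, Finset.sum_mul]
      rw [Finset.sum_comm]
      simp
    · simp
  simp only [h1, Finset.sum_smul]
  rw [Finset.sum_comm]
  simp [ite_smul]

theorem sum_avgVisit_smul {E : Type*} [AddCommGroup E] [Module ℝ E]
    (g : (∀ i, S i) × (∀ i, A i) → E) :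
    (1 / (B : ℝ)) • ∑ j, ∑ t : Fin (H + 1), m.γ ^ (t : ℕ) • g (b j t) =
      ∑ x, m.avgVisit b x • g x := by
  simp only [sum_pow_smul_eq, avgVisit, mul_smul, ← Finset.smul_sum, Finset.sum_smul]
  rw [Finset.sum_comm]

theorem sum_avgPair_smul {E : Type*} [AddCommGroup E] [Module ℝ E]
    (h : (∀ i, S i) × (∀ i, A i) → ℝ) (g : (∀ i, S i) × (∀ i, A i) → E) :
    (1 / (B : ℝ)) • ∑ j, ∑ t : Fin (H + 1), (m.γ ^ (t : ℕ) *
      ∑ t' ∈ Finset.Ici t, m.γ ^ ((t' : ℕ) - t) * h (b j t')) • g (b j t) =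
      ∑ x, (∑ y, m.avgPair b x y * h y) • g x := by
  simp only [sum_pow_mul_sum_smul_eq]
  rw [Finset.sum_comm, Finset.smul_sum]
  refine Finset.sum_congr rfl fun x _ => ?_
  rw [← Finset.sum_smul, smul_smul, Finset.sum_comm, Finset.mul_sum]
  congr 1
  refine Finset.sum_congr rfl fun y _ => ?_
  rw [avgPair, mul_assoc, Finset.sum_mul]

/-- The estimated reward comes from the same batch as the trajectories it is evaluated on. Written
this way, it multiplies batch averages that do not involve it, so each factor can be estimated
separately and no independence is required. -/
theorem criticGrad_eq (i : ι) (w : EuclideanSpace ℝ (Fin d)) :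
    m.criticGrad i b w = ∑ x, m.avgVisit b x • (m.qLin w x • m.φ x) -
      ∑ x, (∑ y, m.avgPair b x y * m.empReward i b (y.1 i, y.2 i)) • m.φ x := by
  rw [← m.sum_avgPair_smul b (fun y => m.empReward i b (y.1 i, y.2 i)) m.φ,
    ← m.sum_avgVisit_smul b fun x => m.qLin w x • m.φ x, ← smul_sub]
  simp only [← Finset.sum_sub_distrib, smul_smul, ← sub_smul, ← mul_sub]
  rfl

theorem actorGrad_eq (i : ι) (θ : Param p) (w : EuclideanSpace ℝ (Fin d)) :
    m.actorGrad i θ b w =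
      ∑ x, m.avgVisit b x • (m.qLin w x • m.score i (θ i) x.1 (x.2 i)) := by
  rw [← m.sum_avgVisit_smul b fun x => m.qLin w x • m.score i (θ i) x.1 (x.2 i)]
  simp only [smul_smul]
  rfl

/-- The estimated occupancy is the marginal of one vector common to all agents, so accuracy of the
global averages controls every local reward. -/
theorem empOcc_eq (i : ι) : m.empOcc i b = m.marg i (WithLp.toLp 2 (m.avgVisit b)) := by
  rw [empOcc, m.sum_avgVisit_smul b fun x => EuclideanSpace.single (x.1 i, x.2 i) (1 : ℝ),
    marg_eq_sum]

theorem avgVisit_nonneg (x : (∀ i, S i) × (∀ i, A i)) : 0 ≤ m.avgVisit b x :=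
  mul_nonneg (by positivity) (Finset.sum_nonneg fun j _ => visitStat_nonneg m.γ_nonneg _ x)

theorem sum_avgVisit_le : ∑ x, m.avgVisit b x ≤ (1 - m.γ)⁻¹ := by
  have h := m.sum_avgVisit_smul b fun _ => (1 : ℝ)
  simp only [smul_eq_mul, mul_one] at h
  rw [← h]
  have hg : 0 ≤ (1 - m.γ)⁻¹ := inv_nonneg.2 (by linarith [m.γ_lt_one])
  have h1 : ∑ _j : Fin B, ∑ t : Fin (H + 1), m.γ ^ (t : ℕ) ≤ B * (1 - m.γ)⁻¹ := by
    rw [Finset.sum_const, nsmul_eq_mul, Finset.card_univ, Fintype.card_fin]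
    exact mul_le_mul_of_nonneg_left (sum_pow_fin_le m.γ_nonneg m.γ_lt_one _) (Nat.cast_nonneg _)
  rcases Nat.eq_zero_or_pos B with rfl | hB
  · simpa using hg
  · have hB' : (0 : ℝ) < B := by exact_mod_cast hB
    rw [one_div, inv_mul_le_iff₀ hB']
    exact h1

end Batch

/-! ### Concentration of the batch averages -/

section BatchConcentration

open Classical in
/-- Batches are accurate up to a multiple of `e` with probability `1 - δ` as soon as their length
and their size are adapted to `e`. -/
theorem exists_sum_not_accurate_le {γ : ℝ} (hγ₀ : 0 ≤ γ) (hγ₁ : γ < 1) :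
    ∃ c : ℝ, 0 < c ∧ ∀ m : Model ι S A p d, m.γ = γ → ∀ (θ : Param p) (B H : ℕ) (e δ : ℝ),
      0 < e → γ ^ H ≤ e ^ 2 → 0 < δ → 1 ≤ Real.log (1 / δ) → Real.log (1 / δ) ≤ B * e ^ 2 →
      ∑ b : Fin B → Fin (H + 1) → (∀ i, S i) × (∀ i, A i) with ¬ m.Accurate b θ (c * e),
        ∏ j, m.trajProb θ (b j) ≤ δ := by
  -- The number of statistics in the union bound: one for each state-action pair and one for each
  -- ordered pair of them.
  set n : ℕ := Fintype.card ((∀ i, S i) × (∀ i, A i)) +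
    Fintype.card ((∀ i, S i) × (∀ i, A i)) * Fintype.card ((∀ i, S i) × (∀ i, A i)) with hn
  set R : ℝ := (1 - γ)⁻¹ ^ 2 with hR
  -- The union bound needs an additional `log (2 * (n + 1))` in the exponent. Since `B * e ^ 2` is
  -- at least `Real.log (1 / δ)`, hence at least one, multiplying the exponent by `a` provides it.
  set a : ℝ := 1 + Real.log (2 * (n + 1)) with ha
  have hn0 : (0 : ℝ) ≤ n := Nat.cast_nonneg n
  have hlog : 0 ≤ Real.log (2 * (n + 1)) := Real.log_nonneg (by linarith)
  have ha0 : 0 < a := by linarith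
  have hg : 1 ≤ (1 - γ)⁻¹ := by
    rw [one_le_inv₀ (by linarith)]; linarith
  have hg0 := zero_lt_one.trans_le hg
  have hR0 : 0 < R := by positivity
  have hsq : √γ < 1 := by rw [Real.sqrt_lt' one_pos]; simpa
  have hs0 : 0 ≤ (1 - √γ)⁻¹ := inv_nonneg.2 (by linarith)
  have hgR : (1 - γ)⁻¹ ≤ R := by rw [hR]; nlinarith
  -- Chosen so that the Hoeffding exponent at deviation `c₁ * e` is exactly `B * e ^ 2 * a`.
  set c₁ : ℝ := √(2 * R ^ 2 * a) with hc₁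
  have hc₁0 : 0 < c₁ := Real.sqrt_pos.2 (by positivity)
  have hc₁sq : c₁ ^ 2 = 2 * R ^ 2 * a := Real.sq_sqrt (by positivity)
  -- The first summand covers the statistical error, the second the truncation bias.
  refine ⟨c₁ + 2 * (1 - √γ)⁻¹ * R, by positivity, ?_⟩
  rintro m rfl θ B H e δ he hH hδ hL hB
  have hq := m.isLaw_trajProb θ H
  have hce : 0 < c₁ * e := by positivity
  have tail : 2 * Real.exp (-(B * (c₁ * e) ^ 2 / (2 * R ^ 2))) ≤ δ / (n + 1) := by
    have h1 : B * (c₁ * e) ^ 2 / (2 * R ^ 2) = (B * e ^ 2) * a := by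
      rw [mul_pow, hc₁sq]; field_simp
    have h2 : Real.log (1 / δ) + Real.log (2 * (n + 1)) ≤ (B * e ^ 2) * a := by
      rw [ha]; nlinarith
    rw [h1]
    calc 2 * Real.exp (-(B * e ^ 2 * a))
        ≤ 2 * Real.exp (-(Real.log (1 / δ) + Real.log (2 * (n + 1)))) := by gcongr
      _ = δ / (n + 1) := by
        rw [neg_add, Real.exp_add, Real.exp_neg, Real.exp_neg, Real.exp_log (by positivity),
          Real.exp_log (by positivity)]
        field_simp
  have hv : ∀ x, ∑ b : Fin B → Fin (H + 1) → (∀ i, S i) × (∀ i, A i) with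
      c₁ * e < |m.avgVisit b x - ∑ τ, m.trajProb θ τ * visitStat m.γ τ x|,
      ∏ j, m.trajProb θ (b j) ≤ δ / (n + 1) := fun x =>
    (hq.sum_filter_abs_le_exp (f := fun τ => visitStat m.γ τ x) hR0
      (fun τ => visitStat_nonneg hγ₀ τ x)
      (fun τ => (visitStat_le hγ₀ hγ₁ τ x).trans hgR) hce).trans tail
  have hp : ∀ x y, ∑ b : Fin B → Fin (H + 1) → (∀ i, S i) × (∀ i, A i) with
      c₁ * e < |m.avgPair b x y - ∑ τ, m.trajProb θ τ * pairStat m.γ τ x y|,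
      ∏ j, m.trajProb θ (b j) ≤ δ / (n + 1) := fun x y =>
    (hq.sum_filter_abs_le_exp (f := fun τ => pairStat m.γ τ x y) hR0
      (fun τ => pairStat_nonneg hγ₀ τ x y) (fun τ => pairStat_le hγ₀ hγ₁ τ x y) hce).trans tail
  have bv : ∀ x, |∑ τ : Fin (H + 1) → _, m.trajProb θ τ * visitStat m.γ τ x - m.occ θ x| ≤
      2 * (1 - √m.γ)⁻¹ * R * e := by
    intro x
    simp only [trajProb_eq_pathProb, occ_apply]
    refine (abs_sum_visitStat_sub_le hγ₀ hγ₁ (m.isLaw_kernel θ) (m.isLaw_initLaw θ) he.le hH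
      x).trans (mul_le_mul_of_nonneg_right ?_ he.le)
    exact mul_le_mul (by linarith) hgR hg0.le (by positivity)
  have bp : ∀ x y, |∑ τ : Fin (H + 1) → _, m.trajProb θ τ * pairStat m.γ τ x y -
      m.occ θ x * m.resolvent θ x y| ≤ 2 * (1 - √m.γ)⁻¹ * R * e := by
    intro x y
    simp only [trajProb_eq_pathProb, occ_apply]
    exact abs_sum_pairStat_sub_le hγ₀ hγ₁ (m.isLaw_kernel θ) (m.isLaw_initLaw θ) he.le hH x y
  calc _ ≤ ∑ x, ∑ b : Fin B → Fin (H + 1) → (∀ i, S i) × (∀ i, A i) with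
            c₁ * e < |m.avgVisit b x - ∑ τ, m.trajProb θ τ * visitStat m.γ τ x|,
            ∏ j, m.trajProb θ (b j) +
          ∑ x, ∑ y, ∑ b : Fin B → Fin (H + 1) → (∀ i, S i) × (∀ i, A i) with
            c₁ * e < |m.avgPair b x y - ∑ τ, m.trajProb θ τ * pairStat m.γ τ x y|,
            ∏ j, m.trajProb θ (b j) := by
        rw [← Fintype.sum_prod_type']
        simp only [Finset.sum_filter]
        rw [Finset.sum_comm, Finset.sum_comm (s := (Finset.univ : Finset (_ × _))),
          ← Finset.sum_add_distrib]
        refine Finset.sum_le_sum fun b _ => ?_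
        have hw : 0 ≤ ∏ j, m.trajProb θ (b j) := Finset.prod_nonneg fun j _ => hq.nonneg _
        have hi : ∀ P : Prop, 0 ≤ if P then ∏ j, m.trajProb θ (b j) else 0 := by
          intro P; split_ifs <;> simp [hw]
        split_ifs with hbad
        · exact add_nonneg (Finset.sum_nonneg fun _ _ => hi _)
            (Finset.sum_nonneg fun _ _ => hi _)
        by_contra hcon
        refine hbad ⟨fun x => ?_, fun x y => ?_⟩
        · by_contra hx
          have h1 : c₁ * e < |m.avgVisit b x - ∑ τ : Fin (H + 1) → _, m.trajProb θ τ * visitStat m.γ τ x| := by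
            have := abs_sub_le (m.avgVisit b x) (∑ τ : Fin (H + 1) → _, m.trajProb θ τ * visitStat m.γ τ x)
              (m.occ θ x)
            linarith [bv x]
          have h2 := Finset.single_le_sum (f := fun x => if c₁ * e < |m.avgVisit b x -
            ∑ τ : Fin (H + 1) → _, m.trajProb θ τ * visitStat m.γ τ x| then ∏ j, m.trajProb θ (b j) else 0)
            (fun x _ => hi _) (Finset.mem_univ x)
          simp only [h1, if_true] at h2
          exact hcon (h2.trans (le_add_of_nonneg_right (Finset.sum_nonneg fun _ _ => hi _)))
        · by_contra hx
          have h1 : c₁ * e < |m.avgPair b x y - ∑ τ : Fin (H + 1) → _, m.trajProb θ τ * pairStat m.γ τ x y| := by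
            have := abs_sub_le (m.avgPair b x y) (∑ τ : Fin (H + 1) → _, m.trajProb θ τ * pairStat m.γ τ x y)
              (m.occ θ x * m.resolvent θ x y)
            linarith [bp x y]
          have h2 := Finset.single_le_sum (f := fun z : _ × _ => if c₁ * e < |m.avgPair b z.1 z.2 -
            ∑ τ : Fin (H + 1) → _, m.trajProb θ τ * pairStat m.γ τ z.1 z.2| then ∏ j, m.trajProb θ (b j) else 0)
            (fun x _ => hi _) (Finset.mem_univ (x, y))
          simp only [h1, if_true] at h2
          exact hcon (h2.trans (le_add_of_nonneg_left (Finset.sum_nonneg fun _ _ => hi _)))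
    _ ≤ ∑ x : (∀ i, S i) × (∀ i, A i), δ / (n + 1) +
          ∑ x : (∀ i, S i) × (∀ i, A i), ∑ y : (∀ i, S i) × (∀ i, A i), δ / (n + 1) :=
        add_le_add (Finset.sum_le_sum fun x _ => hv x)
          (Finset.sum_le_sum fun x _ => Finset.sum_le_sum fun y _ => hp x y)
    _ = n * (δ / (n + 1)) := by
        simp only [Finset.sum_const, Finset.card_univ, nsmul_eq_mul, hn]
        push_cast; ring
    _ ≤ δ := by
        rw [mul_div_assoc', div_le_iff₀ (by positivity)]; nlinarith

end BatchConcentration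

/-! ### Runs of the algorithm -/

section Run

variable {m : Model ι S A p d} {sch : Schedule} {θ₀ : Param p} {w₀ : EuclideanSpace ℝ (Fin d)}

/-- The iterates are non-anticipating; this allows the policy of an iteration to be frozen once its
history is fixed. -/
theorem iter_congr {x x' : ∀ k, Fin (sch.B k) → Fin (sch.H k + 1) → (∀ i, S i) × (∀ i, A i)}
    {n : ℕ} (h : ∀ k < n, x k = x' k) : m.iter sch θ₀ w₀ x n = m.iter sch θ₀ w₀ x' n := by
  induction n with
  | zero => rfl
  | succ n ih =>
    simp only [iter, ih fun k hk => h k (hk.trans (Nat.lt_succ_self n)), h n (Nat.lt_succ_self n)]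

open Classical in
/-- If every policy generates a bad batch with probability at most `δ`, then so does the run. -/
theorem IsRun.measureReal_bad_le {Ω : Type u₄} [MeasurableSpace Ω] {P : Measure Ω}
    [IsProbabilityMeasure P]
    {X : Ω → ∀ k, Fin (sch.B k) → Fin (sch.H k + 1) → (∀ i, S i) × (∀ i, A i)}
    (hX : m.IsRun sch θ₀ w₀ P X) (k : ℕ)
    (bad : Param p → (Fin (sch.B k) → Fin (sch.H k + 1) → (∀ i, S i) × (∀ i, A i)) → Prop)
    {δ : ℝ} (hbad : ∀ θ, ∑ b with bad θ b, ∏ j, m.trajProb θ (b j) ≤ δ) :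
    P.real {ω | bad (m.iter sch θ₀ w₀ (X ω) k).1 (X ω k)} ≤ δ := by
  obtain ⟨ω₀⟩ : Nonempty Ω := P.nonempty_of_neZero
  -- A history consists of `k` batches only. The later ones are filled in from an arbitrary sample
  -- point and never matter.
  let ext : (∀ j : Fin k, Fin (sch.B j) → Fin (sch.H j + 1) → (∀ i, S i) × (∀ i, A i)) →
      ∀ k, Fin (sch.B k) → Fin (sch.H k + 1) → (∀ i, S i) × (∀ i, A i) :=
    fun h j => if hj : j < k then h ⟨j, hj⟩ else X ω₀ j
  have hext : ∀ h (j : Fin k), ext h j = h j := fun h j => by simp [ext]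
  set th := fun h => (m.iter sch θ₀ w₀ (ext h) k).1 with hth
  set ev := fun h => {ω | ∀ j < k, X ω j = ext h j} with hev
  have hE : ∀ h, ∀ ω ∈ ev h, ∀ j : Fin k, X ω j = h j := fun h ω hω j => by
    rw [← hext h j]; exact hω j j.2
  have hsum : ∑ h, P.real (ev h) ≤ 1 := by
    rw [← measureReal_iUnion_fintype (fun h h' hne => ?_) fun h => (hX k (ext h)).1]
    · exact measureReal_le_one
    · refine Set.disjoint_left.2 fun ω hω hω' => hne ?_
      ext1 j
      rw [← hE h ω hω j, hE h' ω hω' j]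
  -- Given the history, the policy of iteration `k` is fixed, so the probability of the longer
  -- cylinder factorizes.
  have hstep : ∀ h b, P.real {ω | ∀ j < k + 1, X ω j = Function.update (ext h) k b j} =
      P.real (ev h) * ∏ j, m.trajProb (th h) (b j) := by
    intro h b
    rw [(hX (k + 1) _).2, Finset.prod_range_succ, (hX k (ext h)).2]
    have hu : ∀ j < k, Function.update (ext h) k b j = ext h j :=
      fun j hj => Function.update_of_ne hj.ne _ _
    congr 1
    · refine Finset.prod_congr rfl fun j hj => ?_
      have hj' := Finset.mem_range.1 hj
      rw [iter_congr fun l hl => hu l (hl.trans hj'), hu j hj']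
    · rw [iter_congr hu, Function.update_self]
  -- The bad event is covered by finitely many cylinders, and monotonicity of the measure suffices;
  -- the bad event itself need not be measurable.
  have hsub : {ω | bad (m.iter sch θ₀ w₀ (X ω) k).1 (X ω k)} ⊆
      ⋃ h, ⋃ b ∈ Finset.univ.filter (bad (th h)),
        {ω | ∀ j < k + 1, X ω j = Function.update (ext h) k b j} := by
    intro ω hω
    have h1 : ∀ j < k, X ω j = ext (fun j => X ω j) j := fun j hj => by simp [ext, hj]
    simp only [Set.mem_iUnion]
    refine ⟨fun j => X ω j, X ω k, ?_, fun j hj => ?_⟩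
    · simp only [Finset.mem_filter, Finset.mem_univ, true_and, hth]
      rw [← iter_congr h1]; exact hω
    · rcases Nat.lt_succ_iff_lt_or_eq.1 hj with hj | rfl
      · rw [Function.update_of_ne hj.ne]; exact h1 j hj
      · rw [Function.update_self]
  have hδ : 0 ≤ δ := le_trans (Finset.sum_nonneg fun b _ => Finset.prod_nonneg fun j _ =>
    (m.isLaw_trajProb θ₀ _).nonneg _) (hbad θ₀)
  calc _ ≤ P.real (⋃ h, ⋃ b ∈ Finset.univ.filter (bad (th h)),
        {ω | ∀ j < k + 1, X ω j = Function.update (ext h) k b j}) := measureReal_mono hsub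
    _ ≤ ∑ h, ∑ b with bad (th h) b,
        P.real {ω | ∀ j < k + 1, X ω j = Function.update (ext h) k b j} :=
      (measureReal_iUnion_fintype_le _).trans
        (Finset.sum_le_sum fun h _ => measureReal_biUnion_finset_le _ _)
    _ ≤ ∑ h, P.real (ev h) * δ := by
      refine Finset.sum_le_sum fun h _ => ?_
      simp only [hstep, ← Finset.mul_sum]
      exact mul_le_mul_of_nonneg_left (hbad _) measureReal_nonneg
    _ ≤ δ := by
      rw [← Finset.sum_mul]; exact mul_le_of_le_one_left hδ hsum

end Run

end Model

end DSAC

namespace DSAC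

namespace Model

variable {ι : Type u₁} {S : ι → Type u₂} {A : ι → Type u₃} {p : ι → ℕ} {d : ℕ}
  [Fintype ι] [DecidableEq ι]
  [∀ i, Fintype (S i)] [∀ i, DecidableEq (S i)] [∀ i, Fintype (A i)] [∀ i, DecidableEq (A i)]

/-! ### The normal equations of the critic -/

section Critic

variable (m : Model ι S A p d) (θ : Param p)

/-- The Hessian of the critic objectives, as an operator. -/
noncomputable def criticOp (v : EuclideanSpace ℝ (Fin d)) : EuclideanSpace ℝ (Fin d) :=
  ∑ x, m.occ θ x • (m.qLin v x • m.φ x)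

/-- The right-hand side of the normal equation of the local critic objective. -/
noncomputable def criticVec (i : ι) : EuclideanSpace ℝ (Fin d) :=
  ∑ x, (m.occ θ x * m.localShadowQ i θ x) • m.φ x

/-- The right-hand side of the normal equation of the averaged critic objective. -/
noncomputable def criticVecAvg : EuclideanSpace ℝ (Fin d) :=
  (1 / (Fintype.card ι : ℝ)) • ∑ i, m.criticVec θ i

theorem qLin_add (v w : EuclideanSpace ℝ (Fin d)) (x : (∀ i, S i) × (∀ i, A i)) :
    m.qLin (v + w) x = m.qLin v x + m.qLin w x := inner_add_right _ _ _

theorem qLin_sub (v w : EuclideanSpace ℝ (Fin d)) (x : (∀ i, S i) × (∀ i, A i)) :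
    m.qLin (v - w) x = m.qLin v x - m.qLin w x := inner_sub_right _ _ _

theorem qLin_smul (c : ℝ) (w : EuclideanSpace ℝ (Fin d)) (x : (∀ i, S i) × (∀ i, A i)) :
    m.qLin (c • w) x = c * m.qLin w x := real_inner_smul_right _ _ _

theorem abs_qLin_le {Cφ : ℝ} (h : m.FeatureAssumption Cφ) (w : EuclideanSpace ℝ (Fin d))
    (x : (∀ i, S i) × (∀ i, A i)) : |m.qLin w x| ≤ Cφ * ‖w‖ :=
  (abs_real_inner_le_norm _ _).trans (mul_le_mul_of_nonneg_right (h x) (norm_nonneg w))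

theorem criticOp_add (v w : EuclideanSpace ℝ (Fin d)) :
    m.criticOp θ (v + w) = m.criticOp θ v + m.criticOp θ w := by
  simp only [criticOp, qLin_add, add_smul, smul_add, Finset.sum_add_distrib]

theorem criticOp_smul (c : ℝ) (w : EuclideanSpace ℝ (Fin d)) :
    m.criticOp θ (c • w) = c • m.criticOp θ w := by
  simp only [criticOp, qLin_smul, mul_smul, Finset.smul_sum, smul_comm c]

/-- The critic operator as a linear map. -/
noncomputable def criticLin : EuclideanSpace ℝ (Fin d) →ₗ[ℝ] EuclideanSpace ℝ (Fin d) where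
  toFun := m.criticOp θ
  map_add' := m.criticOp_add θ
  map_smul' := m.criticOp_smul θ

theorem criticOp_sub (v w : EuclideanSpace ℝ (Fin d)) :
    m.criticOp θ (v - w) = m.criticOp θ v - m.criticOp θ w := map_sub (m.criticLin θ) v w

theorem inner_criticOp (v w : EuclideanSpace ℝ (Fin d)) :
    inner ℝ (m.criticOp θ v) w = ∑ x, m.occ θ x * (m.qLin v x * m.qLin w x) := by
  simp only [criticOp, sum_inner, real_inner_smul_left]
  rfl

theorem inner_criticOp_self_nonneg (v : EuclideanSpace ℝ (Fin d)) :
    0 ≤ inner ℝ (m.criticOp θ v) v := by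
  rw [inner_criticOp]
  exact Finset.sum_nonneg fun x _ => mul_nonneg (m.occ_nonneg θ x) (mul_self_nonneg _)

/-- The loss is quadratic in the critic, so its second-order expansion is exact. The quadratic part
is the same for all agents; only the linear part sees the local reward. -/
theorem localCriticLoss_add (i : ι) (w v : EuclideanSpace ℝ (Fin d)) :
    m.localCriticLoss i θ (w + v) = m.localCriticLoss i θ w +
      inner ℝ (m.criticOp θ w - m.criticVec θ i) v + 1 / 2 * inner ℝ (m.criticOp θ v) v := by
  rw [inner_sub_left, inner_criticOp, inner_criticOp, criticVec, sum_inner]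
  simp only [localCriticLoss, discExp_initLaw, smul_eq_mul, real_inner_smul_left, qLin_add,
    Finset.mul_sum, ← Finset.sum_add_distrib, ← Finset.sum_sub_distrib]
  refine Finset.sum_congr rfl fun x _ => ?_
  have : inner ℝ (m.φ x) v = m.qLin v x := rfl
  rw [this]; ring

theorem avgCriticLoss_add [Nonempty ι] (w v : EuclideanSpace ℝ (Fin d)) :
    (1 / (Fintype.card ι : ℝ)) * ∑ i, m.localCriticLoss i θ (w + v) =
      (1 / (Fintype.card ι : ℝ)) * ∑ i, m.localCriticLoss i θ w +
      inner ℝ (m.criticOp θ w - m.criticVecAvg θ) v + 1 / 2 * inner ℝ (m.criticOp θ v) v := by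
  have hN : (Fintype.card ι : ℝ) ≠ 0 := by
    exact_mod_cast Fintype.card_ne_zero
  simp only [localCriticLoss_add, Finset.sum_add_distrib, inner_sub_left, Finset.sum_sub_distrib,
    Finset.sum_const, Finset.card_univ, nsmul_eq_mul, criticVecAvg, real_inner_smul_left, sum_inner]
  field_simp

/-- For a convex quadratic, minimizing means that the gradient vanishes. This replaces `w*` by the
solution of a linear system. -/
theorem isCriticOpt_iff [Nonempty ι] (w : EuclideanSpace ℝ (Fin d)) :
    m.IsCriticOpt θ w ↔ m.criticOp θ w = m.criticVecAvg θ := by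
  constructor
  · intro h
    set u := m.criticOp θ w - m.criticVecAvg θ with hu
    set c := inner ℝ (m.criticOp θ u) u with hc
    have hc0 : 0 ≤ c := m.inner_criticOp_self_nonneg θ u
    have h1 : ∀ t : ℝ, t * ‖u‖ ^ 2 ≤ t ^ 2 * c / 2 := by
      intro t
      have h2 := h (w + (-t) • u)
      rw [avgCriticLoss_add, criticOp_smul, real_inner_smul_left, real_inner_smul_right,
        real_inner_smul_right, ← hu, real_inner_self_eq_norm_sq, ← hc] at h2
      linarith
    -- Nearly the optimal length of a gradient step. The denominator is `c + 1` because the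
    -- curvature `c` along the gradient may be zero.
    have h2 := h1 (‖u‖ ^ 2 / (c + 1))
    have h3 : ‖u‖ ^ 2 / (c + 1) * ‖u‖ ^ 2 = (‖u‖ ^ 2) ^ 2 / (c + 1) := by ring
    have h4 : (‖u‖ ^ 2 / (c + 1)) ^ 2 * c / 2 ≤ (‖u‖ ^ 2) ^ 2 / (c + 1) / 2 := by
      rw [div_pow, pow_two (c + 1), ← div_div, div_mul_eq_mul_div, mul_div_assoc]
      gcongr
      refine mul_le_of_le_one_right (by positivity) ?_
      rw [div_le_one (by positivity)]; linarith
    have h5 : (‖u‖ ^ 2) ^ 2 / (c + 1) ≤ 0 := by linarith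
    have h6 : (‖u‖ ^ 2) ^ 2 ≤ 0 := by
      by_contra hcon
      exact absurd h5 (not_le.2 (div_pos (not_le.1 hcon) (by linarith)))
    have h7 : ‖u‖ = 0 := by
      have := pow_eq_zero_iff (two_ne_zero) |>.1 (le_antisymm h6 (sq_nonneg _))
      exact pow_eq_zero_iff (two_ne_zero) |>.1 this
    exact sub_eq_zero.1 (norm_eq_zero.1 h7)
  · intro h v
    have h1 := m.avgCriticLoss_add θ w (v - w)
    rw [h, sub_self, inner_zero_left, add_sub_cancel] at h1
    rw [h1]
    have := m.inner_criticOp_self_nonneg θ (v - w)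
    linarith

variable {m θ}

/-- Testing strong convexity at the midpoint of `v` and `-v` cancels the target values. What remains
is a bound on the Hessian, which no longer depends on the shadow Q-function; convexity of the global
loss thus serves the local losses too. -/
theorem CriticSC.le_inner {μ : ℝ} (h : m.CriticSC μ θ) (v : EuclideanSpace ℝ (Fin d)) :
    μ * ‖v‖ ^ 2 ≤ inner ℝ (m.criticOp θ v) v := by
  have h1 := h.2 (Set.mem_univ v) (Set.mem_univ (-v)) 
    (by norm_num : (0 : ℝ) ≤ 1 / 2) (by norm_num : (0 : ℝ) ≤ 1 / 2) (by norm_num)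
  have h2 : (1 / 2 : ℝ) • v + (1 / 2 : ℝ) • -v = (0 : ℝ) • v := by
    rw [smul_neg, add_neg_cancel, zero_smul]
  have h3 : ‖v - -v‖ = 2 * ‖v‖ := by
    rw [sub_neg_eq_add, ← two_smul ℝ v, norm_smul]; simp
  have h4 : (1 / 2 : ℝ) * m.criticLoss θ v + 1 / 2 * m.criticLoss θ (-v) -
      m.criticLoss θ ((0 : ℝ) • v) = 1 / 2 * inner ℝ (m.criticOp θ v) v := by
    rw [inner_criticOp, ← neg_one_smul ℝ v]
    simp only [criticLoss, discExp_initLaw, smul_eq_mul, qLin_smul, Finset.mul_sum,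
      ← Finset.sum_add_distrib, ← Finset.sum_sub_distrib]
    exact Finset.sum_congr rfl fun x _ => by ring
  rw [h2, h3] at h1
  simp only [smul_eq_mul] at h1
  nlinarith

theorem CriticSC.mul_norm_le {μ : ℝ} (h : m.CriticSC μ θ) (v : EuclideanSpace ℝ (Fin d)) :
    μ * ‖v‖ ≤ ‖m.criticOp θ v‖ := by
  rcases eq_or_lt_of_le (norm_nonneg v) with h0 | h0
  · rw [← h0, mul_zero]; exact norm_nonneg _
  · have h1 := (h.le_inner v).trans (real_inner_le_norm _ _)
    rw [pow_two, ← mul_assoc] at h1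
    exact le_of_mul_le_mul_right h1 h0

/-- A bound from below makes the operator injective, hence surjective in finite dimension. -/
theorem CriticSC.exists_isCriticOpt [Nonempty ι] {μ : ℝ} (hμ : 0 < μ) (h : m.CriticSC μ θ) :
    ∃ w, m.IsCriticOpt θ w := by
  have hinj : Function.Injective (m.criticLin θ) := by
    rw [injective_iff_map_eq_zero]
    intro v hv
    have h1 := h.mul_norm_le v
    have h2 : m.criticOp θ v = 0 := hv
    rw [h2, norm_zero] at h1
    have h3 : ‖v‖ ≤ 0 := by
      by_contra hcon
      nlinarith
    exact norm_le_zero_iff.1 h3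
  obtain ⟨w, hw⟩ := LinearMap.injective_iff_surjective.1 hinj (m.criticVecAvg θ)
  exact ⟨w, (m.isCriticOpt_iff θ w).2 hw⟩

/-- Co-coercivity of the Hessian, from the Cauchy–Schwarz inequality weighted with the occupancy
measure of total mass `(1 - γ)⁻¹`. -/
theorem norm_criticOp_sq_le {Cφ : ℝ} (hφ : m.FeatureAssumption Cφ)
    (v : EuclideanSpace ℝ (Fin d)) :
    ‖m.criticOp θ v‖ ^ 2 ≤ criticLip m.γ Cφ * inner ℝ (m.criticOp θ v) v := by
  have h1 : ‖m.criticOp θ v‖ ≤ ∑ x, m.occ θ x * (|m.qLin v x| * Cφ) := by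
    refine (norm_sum_le _ _).trans (Finset.sum_le_sum fun x _ => ?_)
    rw [norm_smul, norm_smul, Real.norm_of_nonneg (m.occ_nonneg θ x), Real.norm_eq_abs]
    exact mul_le_mul_of_nonneg_left (mul_le_mul_of_nonneg_left (hφ x) (abs_nonneg _))
      (m.occ_nonneg θ x)
  have h2 : (∑ x, m.occ θ x * (|m.qLin v x| * Cφ)) ^ 2 ≤
      (∑ x, m.occ θ x * Cφ ^ 2) * ∑ x, m.occ θ x * (m.qLin v x * m.qLin v x) := by
    refine Finset.sum_sq_le_sum_mul_sum_of_sq_eq_mul _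
      (fun x _ => mul_nonneg (m.occ_nonneg θ x) (sq_nonneg _))
      (fun x _ => mul_nonneg (m.occ_nonneg θ x) (mul_self_nonneg _)) fun x _ => ?_
    rw [← abs_mul_abs_self (m.qLin v x)]; ring
  rw [← inner_criticOp, ← Finset.sum_mul, sum_occ] at h2
  refine (pow_le_pow_left₀ (norm_nonneg _) h1 2).trans (h2.trans (le_of_eq ?_))
  rw [criticLip]; ring

/-- In the expanded square, co-coercivity and `η ≤ 1 / L_w` let the second-order term consume at
most half of the first-order term; strong convexity bounds the other half. -/
theorem CriticSC.norm_sub_smul_sq_le {Cφ μ η : ℝ} (hSC : m.CriticSC μ θ)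
    (hφ : m.FeatureAssumption Cφ) (hη₀ : 0 ≤ η) (hη₁ : η ≤ (criticLip m.γ Cφ)⁻¹)
    (v : EuclideanSpace ℝ (Fin d)) :
    ‖v - η • m.criticOp θ v‖ ^ 2 ≤ (1 - η * μ) * ‖v‖ ^ 2 := by
  have hL : 0 ≤ criticLip m.γ Cφ := div_nonneg (sq_nonneg _) (by linarith [m.γ_lt_one])
  have hηL : η * criticLip m.γ Cφ ≤ 1 := by
    rcases hL.eq_or_lt with h0 | h0
    · rw [← h0]; simp
    · exact (mul_le_mul_of_nonneg_right hη₁ hL).trans (inv_mul_cancel₀ h0.ne').le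
  have h0 := m.inner_criticOp_self_nonneg θ v
  have h1 := mul_le_mul_of_nonneg_left (norm_criticOp_sq_le (θ := θ) hφ v) (sq_nonneg η)
  have h2 := hSC.le_inner v
  rw [norm_sub_sq_real, real_inner_smul_right, real_inner_comm, norm_smul, mul_pow,
    Real.norm_eq_abs, sq_abs]
  have h3 : η ^ 2 * (criticLip m.γ Cφ * inner ℝ (m.criticOp θ v) v) ≤
      η * inner ℝ (m.criticOp θ v) v := by
    calc _ = (η * criticLip m.γ Cφ) * (η * inner ℝ (m.criticOp θ v) v) := by ring
      _ ≤ 1 * (η * inner ℝ (m.criticOp θ v) v) :=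
        mul_le_mul_of_nonneg_right hηL (mul_nonneg hη₀ h0)
      _ = _ := one_mul _
  have h4 := mul_le_mul_of_nonneg_left h2 hη₀
  linarith

end Critic

/-! ### Regularity in the policy parameter -/

section Regularity

variable {m : Model ι S A p d}

/-- Bounded scores make the log-policy Lipschitz by the mean value inequality. The bound passes to
the policy because `log x ≤ x - 1` and probabilities are at most one. -/
theorem PolicyAssumption.abs_pol_sub_le {Cπ lθ : ℝ} (h : m.PolicyAssumption Cπ lθ) (i : ι)
    (ϑ ϑ' : EuclideanSpace ℝ (Fin (p i))) (s : ∀ j, S j) (b : A i) :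
    |m.pol i ϑ s b - m.pol i ϑ' s b| ≤ Cπ * ‖ϑ - ϑ'‖ := by
  have hle : ∀ ϑ, m.pol i ϑ s b ≤ 1 := fun ϑ => by
    rw [← m.pol_sum i ϑ s]
    exact Finset.single_le_sum (fun b _ => m.pol_nonneg i ϑ s b) (Finset.mem_univ b)
  have hlog : ∀ ϑ ϑ', Real.log (m.pol i ϑ s b) - Real.log (m.pol i ϑ' s b) ≤ Cπ * ‖ϑ - ϑ'‖ := by
    intro ϑ ϑ'
    refine (le_abs_self _).trans ?_
    have := Convex.norm_image_sub_le_of_norm_fderiv_le (𝕜 := ℝ)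
      (f := fun ϑ => Real.log (m.pol i ϑ s b)) (s := Set.univ) (C := Cπ)
      (fun ϑ _ => h.diff i s b ϑ) (fun ϑ _ => ?_) convex_univ (Set.mem_univ ϑ') (Set.mem_univ ϑ)
    · simpa using this
    · rw [← toDual_gradient, LinearIsometryEquiv.norm_map]
      exact h.score_bdd i ϑ s b
  have key : ∀ ϑ ϑ', m.pol i ϑ s b - m.pol i ϑ' s b ≤ Cπ * ‖ϑ - ϑ'‖ := by
    intro ϑ ϑ'
    have hp := h.pos i ϑ s b
    have hp' := h.pos i ϑ' s b
    have h1 := Real.log_le_sub_one_of_pos (div_pos hp' hp)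
    rw [Real.log_div hp'.ne' hp.ne'] at h1
    have h2 := hlog ϑ ϑ'
    have h3 : 1 - m.pol i ϑ' s b / m.pol i ϑ s b ≤ Cπ * ‖ϑ - ϑ'‖ := by linarith
    have h4 : m.pol i ϑ s b - m.pol i ϑ' s b =
        m.pol i ϑ s b * (1 - m.pol i ϑ' s b / m.pol i ϑ s b) := by field_simp
    have h5 : 0 ≤ Cπ * ‖ϑ - ϑ'‖ :=
      mul_nonneg ((norm_nonneg _).trans (h.score_bdd i ϑ s b)) (norm_nonneg _)
    rw [h4]
    calc _ ≤ m.pol i ϑ s b * (Cπ * ‖ϑ - ϑ'‖) := mul_le_mul_of_nonneg_left h3 hp.le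
      _ ≤ _ := mul_le_of_le_one_left h5 (hle ϑ)
  refine abs_le.2 ⟨?_, key ϑ ϑ'⟩
  have := key ϑ' ϑ
  rw [norm_sub_rev] at this
  linarith

/-- Exchange the factors one at a time; all remaining factors lie in `[0, 1]`. -/
theorem abs_prod_sub_prod_le {κ : Type*} (s : Finset κ) (a b : κ → ℝ) (ha₀ : ∀ i, 0 ≤ a i)
    (ha₁ : ∀ i, a i ≤ 1) (hb₀ : ∀ i, 0 ≤ b i) (hb₁ : ∀ i, b i ≤ 1) :
    |∏ i ∈ s, a i - ∏ i ∈ s, b i| ≤ ∑ i ∈ s, |a i - b i| := by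
  classical
  induction s using Finset.induction_on with
  | empty => simp
  | insert i s hi ih =>
    rw [Finset.prod_insert hi, Finset.prod_insert hi, Finset.sum_insert hi]
    have h1 : a i * ∏ j ∈ s, a j - b i * ∏ j ∈ s, b j =
        (a i - b i) * ∏ j ∈ s, a j + b i * (∏ j ∈ s, a j - ∏ j ∈ s, b j) := by ring
    rw [h1]
    refine (abs_add_le _ _).trans (add_le_add ?_ ?_)
    · rw [abs_mul, abs_of_nonneg (Finset.prod_nonneg fun j _ => ha₀ j)]
      exact mul_le_of_le_one_right (abs_nonneg _)
        (Finset.prod_le_one (fun j _ => ha₀ j) fun j _ => ha₁ j)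
    · rw [abs_mul, abs_of_nonneg (hb₀ i)]
      exact (mul_le_of_le_one_left (abs_nonneg _) (hb₁ i)).trans ih

theorem PolicyAssumption.abs_kernel_sub_le {Cπ lθ : ℝ} (h : m.PolicyAssumption Cπ lθ)
    (hC : 0 ≤ Cπ) (θ θ' : Param p) (x y : (∀ i, S i) × (∀ i, A i)) :
    |m.kernel θ x y - m.kernel θ' x y| ≤ Fintype.card ι * Cπ * ‖θ - θ'‖ := by
  have hle : ∀ (θ : Param p) i, m.pol i (θ i) y.1 (y.2 i) ≤ 1 := fun θ i => by
    rw [← m.pol_sum i (θ i) y.1]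
    exact Finset.single_le_sum (fun b _ => m.pol_nonneg i (θ i) y.1 b) (Finset.mem_univ _)
  have hP : m.P x.1 x.2 y.1 ≤ 1 := by
    rw [← m.P_sum x.1 x.2]
    exact Finset.single_le_sum (fun s _ => m.P_nonneg x.1 x.2 s) (Finset.mem_univ y.1)
  rw [kernel, kernel, ← mul_sub, abs_mul, abs_of_nonneg (m.P_nonneg _ _ _)]
  refine (mul_le_of_le_one_left (abs_nonneg _) hP).trans ?_
  refine (abs_prod_sub_prod_le _ _ _ (fun i => m.pol_nonneg _ _ _ _) (hle θ)
    (fun i => m.pol_nonneg _ _ _ _) (hle θ')).trans ?_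
  calc _ ≤ ∑ _i : ι, Cπ * ‖θ - θ'‖ := by
        refine Finset.sum_le_sum fun i _ => (h.abs_pol_sub_le i _ _ _ _).trans ?_
        exact mul_le_mul_of_nonneg_left (PiLp.norm_apply_le (θ - θ') i) hC
    _ = _ := by simp [mul_assoc]

theorem PolicyAssumption.abs_resolvent_sub_le {Cπ lθ : ℝ} (h : m.PolicyAssumption Cπ lθ)
    (hC : 0 ≤ Cπ) (θ θ' : Param p) (x y : (∀ i, S i) × (∀ i, A i)) :
    |m.resolvent θ x y - m.resolvent θ' x y| ≤
      Fintype.card ((∀ i, S i) × (∀ i, A i)) * (Fintype.card ι * Cπ * ‖θ - θ'‖) *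
        (1 - m.γ)⁻¹ ^ 2 :=
  abs_discVisits_single_sub_le m.γ_nonneg m.γ_lt_one (m.isLaw_kernel θ) (m.isLaw_kernel θ')
    (h.abs_kernel_sub_le hC θ θ') x y

theorem PolicyAssumption.abs_occ_sub_le {Cπ lθ : ℝ} (h : m.PolicyAssumption Cπ lθ)
    (θ θ' : Param p) (x : (∀ i, S i) × (∀ i, A i)) :
    |m.occ θ x - m.occ θ' x| ≤ lθ * ‖θ - θ'‖ :=
  (PiLp.norm_apply_le (m.occ θ - m.occ θ') x).trans (h.occ_lip θ θ')

theorem UtilityAssumption.abs_localShadowReward_le {CF LF Lθ : ℝ}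
    (h : m.UtilityAssumption CF LF Lθ) (i : ι) (θ : Param p) (y : S i × A i) :
    |m.localShadowReward i θ y| ≤ CF := by
  obtain ⟨U, -, hU, hb⟩ := h.grad_bdd i
  exact (hb _ (hU θ)).2 y

/-- Stated for arbitrary vectors in the domain of smoothness, so that it covers the occupancy
measure of another policy as well as an empirical estimate. -/
theorem UtilityAssumption.abs_gradient_sub_localShadowReward_le {CF LF Lθ : ℝ}
    (h : m.UtilityAssumption CF LF Lθ) (hL : 0 ≤ LF) (i : ι) (θ : Param p)
    {l : EuclideanSpace ℝ ((∀ i, S i) × (∀ i, A i))} (h0 : ∀ x, 0 ≤ l x)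
    (h1 : ∑ x, l x ≤ (1 - m.γ)⁻¹) {e : ℝ} (he : ∀ x, |l x - m.occ θ x| ≤ e) (y : S i × A i) :
    |gradient (m.F i) (m.marg i l) y - m.localShadowReward i θ y| ≤
      LF * (Fintype.card ((∀ i, S i) × (∀ i, A i)) * e) := by
  refine (h.grad_lip i _ (m.marg_mem_budget i h0 h1) _ (m.marg_occ_mem_budget i θ) y).trans ?_
  refine mul_le_mul_of_nonneg_left ?_ hL
  rw [← marg_sub]
  refine (m.norm_marg_le i _).trans ?_
  calc _ ≤ ∑ _x : (∀ i, S i) × (∀ i, A i), e := Finset.sum_le_sum fun x _ => he x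
    _ = _ := by simp

theorem sum_resolvent (m : Model ι S A p d) (θ : Param p) (x : (∀ i, S i) × (∀ i, A i)) :
    ∑ y, m.resolvent θ x y = (1 - m.γ)⁻¹ :=
  sum_discVisits m.γ_nonneg m.γ_lt_one (m.isLaw_kernel θ) (isLaw_single x)

theorem UtilityAssumption.abs_localShadowQ_le {CF LF Lθ : ℝ}
    (h : m.UtilityAssumption CF LF Lθ) (i : ι) (θ : Param p) (x : (∀ i, S i) × (∀ i, A i)) :
    |m.localShadowQ i θ x| ≤ CF * (1 - m.γ)⁻¹ := by
  rw [localShadowQ, qOf_eq, ← m.sum_resolvent θ x, Finset.mul_sum]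
  refine (Finset.abs_sum_le_sum_abs _ _).trans (Finset.sum_le_sum fun y _ => ?_)
  rw [abs_mul, abs_of_nonneg (m.resolvent_nonneg θ x y), mul_comm]
  exact mul_le_mul_of_nonneg_right (h.abs_localShadowReward_le i θ _) (m.resolvent_nonneg θ x y)

/-- A bound for a difference of products. -/
theorem abs_mul_sub_mul_le {a a' b b' ea eb Ca Cb : ℝ} (ha : |a - a'| ≤ ea) (hb : |b - b'| ≤ eb)
    (ha' : |a'| ≤ Ca) (hb' : |b| ≤ Cb) : |a * b - a' * b'| ≤ ea * Cb + Ca * eb := by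
  have h : a * b - a' * b' = (a - a') * b + a' * (b - b') := by ring
  rw [h]
  refine (abs_add_le _ _).trans (add_le_add ?_ ?_)
  · rw [abs_mul]
    exact mul_le_mul ha hb' (abs_nonneg _) ((abs_nonneg _).trans ha)
  · rw [abs_mul]
    exact mul_le_mul ha' hb (abs_nonneg _) ((abs_nonneg _).trans ha')

theorem UtilityAssumption.norm_criticVec_le {CF LF Lθ Cφ : ℝ}
    (h : m.UtilityAssumption CF LF Lθ) (hφ : m.FeatureAssumption Cφ) (hCF : 0 ≤ CF)
    (i : ι) (θ : Param p) :
    ‖m.criticVec θ i‖ ≤ CF * Cφ * (1 - m.γ)⁻¹ ^ 2 := by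
  have hg : 0 ≤ (1 - m.γ)⁻¹ := inv_nonneg.2 (by linarith [m.γ_lt_one])
  calc ‖m.criticVec θ i‖ ≤ ∑ x, m.occ θ x * (CF * (1 - m.γ)⁻¹ * Cφ) := by
        refine (norm_sum_le _ _).trans (Finset.sum_le_sum fun x _ => ?_)
        rw [norm_smul, Real.norm_eq_abs, abs_mul, abs_of_nonneg (m.occ_nonneg θ x), mul_assoc]
        exact mul_le_mul_of_nonneg_left (mul_le_mul (h.abs_localShadowQ_le i θ x) (hφ x)
          (norm_nonneg _) (by positivity)) (m.occ_nonneg θ x)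
    _ = _ := by rw [← Finset.sum_mul, sum_occ]; ring

theorem norm_avg_le {E : Type*} [NormedAddCommGroup E] [NormedSpace ℝ E] [Nonempty ι] {f : ι → E}
    {c : ℝ} (h : ∀ i, ‖f i‖ ≤ c) : ‖(1 / (Fintype.card ι : ℝ)) • ∑ i, f i‖ ≤ c := by
  have hN : (0 : ℝ) < Fintype.card ι := by exact_mod_cast Fintype.card_pos
  rw [norm_smul, Real.norm_of_nonneg (by positivity), one_div, inv_mul_le_iff₀ hN]
  refine (norm_sum_le _ _).trans ((Finset.sum_le_sum fun i _ => h i).trans (le_of_eq ?_))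
  simp

end Regularity

/-! ### Lipschitz dependence of the normal equations and of their solution -/

section Lipschitz

variable {γ CF LF Lθ Cπ lθ Cφ ρ : ℝ}

/-- The vector is a polynomial in the occupancy measure, the resolvent and the local reward, each of
which is bounded and Lipschitz in the parameter. -/
theorem exists_norm_criticVec_sub_le (hγ₁ : γ < 1) (hCF : 0 < CF) (hLF : 0 < LF)
    (hCπ : 0 < Cπ) (hlθ : 0 < lθ) (hCφ : 0 < Cφ) :
    ∃ c : ℝ, 0 ≤ c ∧ ∀ m : Model ι S A p d, m.Assumptions γ CF LF Lθ Cπ lθ Cφ ρ →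
      ∀ (θ θ' : Param p) (i : ι), ‖m.criticVec θ i - m.criticVec θ' i‖ ≤ c * ‖θ - θ'‖ := by
  have hg : 0 < (1 - γ)⁻¹ := inv_pos.2 (by linarith)
  set n : ℝ := ((Fintype.card ((∀ i, S i) × (∀ i, A i)) : ℕ) : ℝ) with hn
  have hn0 : 0 ≤ n := Nat.cast_nonneg _
  -- In this order: Lipschitz constants of the resolvent, of the local shadow rewards and of the
  -- local shadow Q-functions.
  set cG := n * (Fintype.card ι * Cπ) * (1 - γ)⁻¹ ^ 2 with hcG
  set cr := LF * (n * lθ) with hcr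
  set cQ := n * (cG * CF + (1 - γ)⁻¹ * cr) with hcQ
  refine ⟨n * ((lθ * (CF * (1 - γ)⁻¹) + (1 - γ)⁻¹ * cQ) * Cφ), by positivity, ?_⟩
  intro m h θ θ' i
  obtain rfl := h.discount
  set D := ‖θ - θ'‖ with hD
  have hocc := h.policy.abs_occ_sub_le θ θ'
  have hG : ∀ x y, |m.resolvent θ x y - m.resolvent θ' x y| ≤ cG * D := fun x y =>
    (h.policy.abs_resolvent_sub_le hCπ.le θ θ' x y).trans (le_of_eq (by rw [hcG]; ring))
  have hr : ∀ y, |m.localShadowReward i θ y - m.localShadowReward i θ' y| ≤ cr * D := fun y =>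
    (h.utility.abs_gradient_sub_localShadowReward_le hLF.le i θ' (m.occ_nonneg θ)
      (m.sum_occ θ).le hocc y).trans (le_of_eq (by rw [hcr]; ring))
  have hQ : ∀ x, |m.localShadowQ i θ x - m.localShadowQ i θ' x| ≤ cQ * D := by
    intro x
    rw [localShadowQ, localShadowQ, qOf_eq, qOf_eq, ← Finset.sum_sub_distrib]
    refine (Finset.abs_sum_le_sum_abs _ _).trans ?_
    calc _ ≤ ∑ _y : (∀ i, S i) × (∀ i, A i), (cG * D * CF + (1 - m.γ)⁻¹ * (cr * D)) := by
          refine Finset.sum_le_sum fun y _ => abs_mul_sub_mul_le (hG x y) (hr _) ?_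
            (h.utility.abs_localShadowReward_le i θ _)
          rw [abs_of_nonneg (m.resolvent_nonneg θ' x y)]
          exact m.resolvent_le θ' x y
      _ = _ := by
          simp only [Finset.sum_const, Finset.card_univ, nsmul_eq_mul, ← hn, hcQ]; ring
  rw [criticVec, criticVec, ← Finset.sum_sub_distrib]
  refine (norm_sum_le _ _).trans ?_
  calc _ ≤ ∑ _x : (∀ i, S i) × (∀ i, A i),
        (lθ * D * (CF * (1 - m.γ)⁻¹) + (1 - m.γ)⁻¹ * (cQ * D)) * Cφ := by
        refine Finset.sum_le_sum fun x _ => ?_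
        rw [← sub_smul, norm_smul, Real.norm_eq_abs]
        refine mul_le_mul (abs_mul_sub_mul_le (hocc x) (hQ x) ?_
          (h.utility.abs_localShadowQ_le i θ x)) (h.feature x) (norm_nonneg _) (by positivity)
        rw [abs_of_nonneg (m.occ_nonneg θ' x)]
        exact m.occ_le θ' x
    _ = _ := by
        simp only [Finset.sum_const, Finset.card_univ, nsmul_eq_mul, ← hn]; ring

theorem norm_criticOp_sub_le {m : Model ι S A p d} (hπ : m.PolicyAssumption Cπ lθ)
    (hφ : m.FeatureAssumption Cφ) (hl : 0 ≤ lθ) (hCφ : 0 ≤ Cφ) (θ θ' : Param p)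
    (v : EuclideanSpace ℝ (Fin d)) :
    ‖m.criticOp θ v - m.criticOp θ' v‖ ≤
      (Fintype.card ((∀ i, S i) × (∀ i, A i)) : ℝ) * (lθ * Cφ ^ 2) * ‖θ - θ'‖ * ‖v‖ := by
  rw [criticOp, criticOp, ← Finset.sum_sub_distrib]
  refine (norm_sum_le _ _).trans ?_
  calc _ ≤ ∑ _x : (∀ i, S i) × (∀ i, A i), lθ * ‖θ - θ'‖ * (Cφ * ‖v‖ * Cφ) := by
        refine Finset.sum_le_sum fun x _ => ?_
        rw [← sub_smul, norm_smul, norm_smul, Real.norm_eq_abs, Real.norm_eq_abs]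
        exact mul_le_mul (hπ.abs_occ_sub_le θ θ' x)
          (mul_le_mul (m.abs_qLin_le hφ v x) (hφ x) (norm_nonneg _) (by positivity))
          (by positivity) (by positivity)
    _ = _ := by
        simp only [Finset.sum_const, Finset.card_univ, nsmul_eq_mul]; ring

theorem IsCriticOpt.norm_le [Nonempty ι] {m : Model ι S A p d} {μ : ℝ} (hμ : 0 < μ)
    (h : m.UtilityAssumption CF LF Lθ) (hφ : m.FeatureAssumption Cφ) (hCF : 0 ≤ CF) {θ : Param p}
    (hSC : m.CriticSC μ θ) {w : EuclideanSpace ℝ (Fin d)} (hw : m.IsCriticOpt θ w) :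
    ‖w‖ ≤ CF * Cφ * (1 - m.γ)⁻¹ ^ 2 / μ := by
  rw [le_div_iff₀ hμ, mul_comm]
  refine (hSC.mul_norm_le w).trans ?_
  rw [(m.isCriticOpt_iff θ w).1 hw]
  exact norm_avg_le fun i => h.norm_criticVec_le hφ hCF i θ

/-- The optimal critic is Lipschitz in the policy parameter. -/
theorem exists_isCriticOpt_lipschitz [Nonempty ι] (hγ₁ : γ < 1) (hCF : 0 < CF)
    (hLF : 0 < LF) (hCπ : 0 < Cπ) (hlθ : 0 < lθ) (hCφ : 0 < Cφ) {μ : ℝ} (hμ : 0 < μ) :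
    ∃ c : ℝ, 0 < c ∧ ∀ m : Model ι S A p d, m.Assumptions γ CF LF Lθ Cπ lθ Cφ ρ →
      ∀ (θ θ' : Param p) (w w' : EuclideanSpace ℝ (Fin d)),
        m.CriticSC μ θ → m.CriticSC μ θ' → m.IsCriticOpt θ w → m.IsCriticOpt θ' w' →
          ‖w - w'‖ ≤ c * ‖θ - θ'‖ := by
  obtain ⟨c, hc0, hc⟩ := exists_norm_criticVec_sub_le (S := S) (A := A) (p := p) (d := d) (ρ := ρ)
    (Lθ := Lθ) hγ₁ hCF hLF hCπ hlθ hCφ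
  have hg : 0 < (1 - γ)⁻¹ := inv_pos.2 (by linarith)
  set a : ℝ := Fintype.card ((∀ i, S i) × (∀ i, A i)) * (lθ * Cφ ^ 2) with ha
  have ha0 : 0 ≤ a := by positivity
  set R := CF * Cφ * (1 - γ)⁻¹ ^ 2 / μ with hR
  have hR0 : 0 ≤ R := by positivity
  refine ⟨(c + a * R) / μ + 1, by positivity, ?_⟩
  intro m h θ θ' w w' hSC hSC' hw hw'
  obtain rfl := h.discount
  have h1 := hw'.norm_le hμ h.utility h.feature hCF.le hSC'
  rw [isCriticOpt_iff] at hw hw'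
  -- Perturbation of a linear system: the difference of the solutions is mapped to the change of the
  -- right-hand side minus the change of the operator at the bounded solution `w'`, and strong
  -- convexity inverts the map.
  have h2 : m.criticOp θ (w - w') = (m.criticVecAvg θ - m.criticVecAvg θ') -
      (m.criticOp θ w' - m.criticOp θ' w') := by
    rw [criticOp_sub, hw, hw']; abel
  have h3 : ‖m.criticVecAvg θ - m.criticVecAvg θ'‖ ≤ c * ‖θ - θ'‖ := by
    rw [criticVecAvg, criticVecAvg, ← smul_sub, ← Finset.sum_sub_distrib]
    exact norm_avg_le fun i => hc m h θ θ' i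
  have h4 := norm_criticOp_sub_le h.policy h.feature hlθ.le hCφ.le θ θ' w'
  rw [← ha] at h4
  have h5 : a * ‖θ - θ'‖ * ‖w'‖ ≤ a * ‖θ - θ'‖ * R :=
    mul_le_mul_of_nonneg_left h1 (by positivity)
  have h6 := hSC.mul_norm_le (w - w')
  rw [h2] at h6
  have h7 : μ * ‖w - w'‖ ≤ (c + a * R) * ‖θ - θ'‖ := by
    refine h6.trans ((norm_sub_le _ _).trans ?_)
    linarith
  rw [add_mul, div_mul_eq_mul_div, one_mul]
  refine le_add_of_le_of_nonneg ?_ (norm_nonneg _)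
  rw [le_div_iff₀ hμ, mul_comm]; exact h7

end Lipschitz

end Model

end DSAC

namespace DSAC

/-! ### Contraction of the consensus error -/

section Consensus

variable {ι : Type*} [Fintype ι] [DecidableEq ι]

open Matrix in
/-- A symmetric doubly stochastic matrix contracts the vectors of zero sum. -/
theorem sum_sq_mulVec_le {M : Matrix ι ι ℝ} (hD : M ∈ doublyStochastic ℝ ι) (hM : M.IsHermitian)
    {ρ : ℝ} (hρ₁ : ρ < 1)
    (hρ : ∀ k : Fin (Fintype.card ι), (k : ℕ) ≠ 0 → |hM.eigenvalues₀ k| ≤ ρ)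
    (v : ι → ℝ) (hv : ∑ i, v i = 0) :
    ∑ i, (M *ᵥ v) i ^ 2 ≤ ρ ^ 2 * ∑ i, v i ^ 2 := by
  set b := hM.eigenvectorBasis with hb
  have hin : ∀ (k : ι) (x : ι → ℝ), inner ℝ (b k) (WithLp.toLp 2 x) = x ⬝ᵥ ⇑(b k) := by
    intro k x
    simp [EuclideanSpace.inner_eq_star_dotProduct]
  have hT : Mᵀ = M := by
    have := hM.eq
    rwa [Matrix.conjTranspose_eq_transpose_of_trivial] at this
  have heig : ∀ (k : ι) (x : ι → ℝ), inner ℝ (b k) (WithLp.toLp 2 (M *ᵥ x)) =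
      hM.eigenvalues k * inner ℝ (b k) (WithLp.toLp 2 x) := by
    intro k x
    rw [hin, hin, dotProduct_comm, dotProduct_mulVec, ← mulVec_transpose, hT,
      hM.mulVec_eigenvectorBasis k, smul_dotProduct, smul_eq_mul, dotProduct_comm]
  have hnorm : ∀ x : ι → ℝ, ∑ k, (inner ℝ (b k) (WithLp.toLp 2 x)) ^ 2 = ∑ i, x i ^ 2 := by
    intro x
    rw [b.sum_sq_inner_right, EuclideanSpace.norm_sq_eq]
    simp
  set one : ι → ℝ := 1 with hone
  have h1 : M *ᵥ one = one := mulVec_one_of_mem_doublyStochastic hD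
  -- Only eigenvectors with small eigenvalue meet `v`. The constant vector is fixed by `M`, so it is
  -- orthogonal to every eigenvector whose eigenvalue is at most `ρ < 1`. If one exceptional
  -- eigenvector met `v`, orthogonality of `v` to the constants would make the constant vector
  -- orthogonal to that eigenvector too, hence zero.
  have hk : ∀ k, inner ℝ (b k) (WithLp.toLp 2 v) ≠ 0 → |hM.eigenvalues k| ≤ ρ := by
    intro k hk
    by_contra hlarge
    set σ := (Fintype.equivOfCardEq (Fintype.card_fin (Fintype.card ι)) : _ ≃ ι) with hσ
    -- In the decreasing enumeration only index zero is exempt from the bound, so there is at most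
    -- one exceptional eigenvector.
    have hk0 : ((σ.symm k : Fin (Fintype.card ι)) : ℕ) = 0 := by
      by_contra h
      exact hlarge (hρ _ h)
    have hother : ∀ l, l ≠ k → inner ℝ (b l) (WithLp.toLp 2 one) = (0 : ℝ) := by
      intro l hl
      have hl0 : ((σ.symm l : Fin (Fintype.card ι)) : ℕ) ≠ 0 := by
        intro h
        exact hl (σ.symm.injective (Fin.ext (h.trans hk0.symm)))
      have h2 : |hM.eigenvalues l| ≤ ρ := hρ _ hl0
      have h3 := heig l one
      rw [h1] at h3
      have h4 : (1 - hM.eigenvalues l) * inner ℝ (b l) (WithLp.toLp 2 one) = 0 := by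
        rw [sub_mul, one_mul, ← h3, sub_self]
      rcases mul_eq_zero.1 h4 with h5 | h5
      · linarith [(abs_le.1 h2).2]
      · exact h5
    have h6 := b.sum_inner_mul_inner (WithLp.toLp 2 one) (WithLp.toLp 2 v)
    have h7 : inner ℝ (WithLp.toLp 2 one) (WithLp.toLp 2 v) = (0 : ℝ) := by
      simp [EuclideanSpace.inner_eq_star_dotProduct, hone, dotProduct, hv]
    rw [h7, Finset.sum_eq_single k (fun l _ hl => by rw [real_inner_comm, hother l hl, zero_mul])
      (by simp)] at h6
    have h8 : inner ℝ (WithLp.toLp 2 one) (b k) = (0 : ℝ) := by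
      rcases mul_eq_zero.1 h6 with h | h
      · exact h
      · exact absurd h hk
    have h9 := hnorm one
    rw [Finset.sum_eq_zero] at h9
    · simp only [hone, Pi.one_apply, one_pow, Finset.sum_const, Finset.card_univ, nsmul_eq_mul,
        mul_one] at h9
      have : Nonempty ι := ⟨k⟩
      exact Fintype.card_ne_zero (α := ι) (by exact_mod_cast h9.symm)
    · intro l _
      by_cases hl : l = k
      · rw [hl, real_inner_comm, h8]; simp
      · rw [hother l hl]; simp
  rw [← hnorm (M *ᵥ v), ← hnorm v, Finset.mul_sum]
  refine Finset.sum_le_sum fun k _ => ?_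
  rw [heig, mul_pow]
  by_cases h0 : inner ℝ (b k) (WithLp.toLp 2 v) = (0 : ℝ)
  · rw [h0]; simp
  · refine mul_le_mul_of_nonneg_right ?_ (sq_nonneg _)
    rw [← sq_abs]
    exact pow_le_pow_left₀ (abs_nonneg _) (hk k h0) 2

/-- The average of a family of vectors. -/
noncomputable def avg {E : Type*} [NormedAddCommGroup E] [NormedSpace ℝ E] (w : ι → E) : E :=
  (1 / (Fintype.card ι : ℝ)) • ∑ i, w i

/-- The consensus error of a family of vectors. -/
noncomputable def consensusSq {E : Type*} [NormedAddCommGroup E] [NormedSpace ℝ E] (w : ι → E) :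
    ℝ := ∑ i, ‖w i - avg w‖ ^ 2

section

variable {E : Type*} [NormedAddCommGroup E] [NormedSpace ℝ E]

omit [DecidableEq ι] in
theorem card_smul_avg [Nonempty ι] (w : ι → E) : (Fintype.card ι : ℝ) • avg w = ∑ i, w i := by
  have hN : (Fintype.card ι : ℝ) ≠ 0 := by exact_mod_cast Fintype.card_ne_zero
  rw [avg, smul_smul, mul_one_div_cancel hN, one_smul]

omit [DecidableEq ι] in
theorem avg_const [Nonempty ι] (w : E) : avg (fun _ : ι => w) = w := by
  have hN : (Fintype.card ι : ℝ) ≠ 0 := by exact_mod_cast Fintype.card_ne_zero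
  rw [avg, Finset.sum_const, Finset.card_univ, ← Nat.cast_smul_eq_nsmul ℝ, smul_smul,
    one_div_mul_cancel hN, one_smul]

omit [DecidableEq ι] in
theorem avg_sub (v w : ι → E) : avg (fun i => v i - w i) = avg v - avg w := by
  simp only [avg, Finset.sum_sub_distrib, smul_sub]

omit [DecidableEq ι] in
theorem avg_smul (c : ℝ) (w : ι → E) : avg (fun i => c • w i) = c • avg w := by
  simp only [avg, ← Finset.smul_sum, smul_comm c]

omit [DecidableEq ι] in
theorem sum_sub_avg [Nonempty ι] (w : ι → E) : ∑ i, (w i - avg w) = 0 := by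
  rw [Finset.sum_sub_distrib, ← card_smul_avg, Finset.sum_const, Finset.card_univ,
    ← Nat.cast_smul_eq_nsmul ℝ, sub_self]

omit [DecidableEq ι] in
theorem norm_avg_le_of_le [Nonempty ι] {w : ι → E} {c : ℝ} (h : ∀ i, ‖w i‖ ≤ c) :
    ‖avg w‖ ≤ c := by
  classical exact Model.norm_avg_le h

omit [DecidableEq ι] in
theorem consensusSq_nonneg (w : ι → E) : 0 ≤ consensusSq w :=
  Finset.sum_nonneg fun _ _ => sq_nonneg _

omit [DecidableEq ι] in
theorem consensusSq_const [Nonempty ι] (w : E) : consensusSq (fun _ : ι => w) = 0 := by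
  simp [consensusSq, avg_const]

end

end Consensus

namespace Model

variable {ι : Type u₁} {S : ι → Type u₂} {A : ι → Type u₃} {p : ι → ℕ} {d : ℕ}
  [Fintype ι] [DecidableEq ι]
  [∀ i, Fintype (S i)] [∀ i, DecidableEq (S i)] [∀ i, Fintype (A i)] [∀ i, DecidableEq (A i)]

/-! ### One round of averaging over the network -/

section Mixing

variable {m : Model ι S A p d} {ρ : ℝ}

/-- Entries off the edges are nonnegative and not positive, so the restriction to neighbours omits
only zero weights. -/
theorem MixingAssumption.mix_eq (h : m.MixingAssumption ρ) (w : ι → EuclideanSpace ℝ (Fin d))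
    (i : ι) : m.mix w i = ∑ j, m.M j i • w j := by
  classical
  rw [mix, Finset.sum_filter]
  refine Finset.sum_congr rfl fun j _ => ?_
  split_ifs with hadj
  · rfl
  · rw [le_antisymm (not_lt.1 fun hpos => hadj ((h.2.1 j i).1 hpos))
      (nonneg_of_mem_doublyStochastic h.1), zero_smul]

theorem MixingAssumption.avg_mix (h : m.MixingAssumption ρ) (w : ι → EuclideanSpace ℝ (Fin d)) :
    avg (m.mix w) = avg w := by
  simp only [avg, h.mix_eq]
  rw [Finset.sum_comm]
  simp only [← Finset.sum_smul, sum_row_of_mem_doublyStochastic h.1, one_smul]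

theorem MixingAssumption.norm_mix_le (h : m.MixingAssumption ρ)
    {w : ι → EuclideanSpace ℝ (Fin d)} {c : ℝ} (hw : ∀ i, ‖w i‖ ≤ c) (i : ι) :
    ‖m.mix w i‖ ≤ c := by
  rw [h.mix_eq]
  refine (norm_sum_le _ _).trans ?_
  calc _ ≤ ∑ j, m.M j i * c := by
        refine Finset.sum_le_sum fun j _ => ?_
        have h0 : 0 ≤ m.M j i := nonneg_of_mem_doublyStochastic h.1
        rw [norm_smul, Real.norm_of_nonneg h0]
        exact mul_le_mul_of_nonneg_left (hw j) h0
    _ = c := by rw [← Finset.sum_mul, sum_col_of_mem_doublyStochastic h.1, one_mul]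

/-- Mixing preserves the mean, so it acts on the deviations alone; these have zero sum in each
coordinate, and the scalar contraction applies coordinatewise. -/
theorem MixingAssumption.consensusSq_mix_le [Nonempty ι] (h : m.MixingAssumption ρ)
    (hρ₁ : ρ < 1) (w : ι → EuclideanSpace ℝ (Fin d)) :
    consensusSq (m.mix w) ≤ ρ ^ 2 * consensusSq w := by
  obtain ⟨hM, hρ⟩ := h.2.2
  have hdev : ∀ i, m.mix w i - avg (m.mix w) = ∑ j, m.M i j • (w j - avg w) := by
    intro i
    rw [h.avg_mix, h.mix_eq]
    simp only [smul_sub, Finset.sum_sub_distrib, ← Finset.sum_smul,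
      sum_row_of_mem_doublyStochastic h.1, one_smul]
    congr 1
    refine Finset.sum_congr rfl fun j _ => ?_
    rw [← hM.apply j i]; rfl
  have hc := fun c : Fin d => sum_sq_mulVec_le h.1 hM hρ₁ hρ (fun j => (w j - avg w) c) (by
    have := congrArg (fun v : EuclideanSpace ℝ (Fin d) => v c) (sum_sub_avg w)
    simpa using this)
  have hn : ∀ v : EuclideanSpace ℝ (Fin d), ‖v‖ ^ 2 = ∑ c, v c ^ 2 := fun v => by
    simp [EuclideanSpace.norm_sq_eq]
  simp only [consensusSq, hdev, hn]
  rw [Finset.sum_comm, Finset.sum_comm (f := fun i c => (w i - avg w) c ^ 2), Finset.mul_sum]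
  refine Finset.sum_le_sum fun c _ => le_of_eq_of_le (Finset.sum_congr rfl fun i _ => ?_) (hc c)
  simp [Matrix.mulVec, dotProduct]

end Mixing

/-! ### Accuracy of the stochastic gradients -/

section Gradients

variable {γ CF LF Lθ Cπ lθ Cφ ρ : ℝ}

theorem criticVec_eq (m : Model ι S A p d) (θ : Param p) (i : ι) :
    m.criticVec θ i = ∑ x, (∑ y, m.occ θ x * m.resolvent θ x y *
      m.localShadowReward i θ (y.1 i, y.2 i)) • m.φ x := by
  simp only [criticVec, localShadowQ, qOf_eq, Finset.mul_sum, mul_assoc]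

/-- Accurate batches yield accurate stochastic critic gradients. -/
theorem exists_norm_criticGrad_sub_le (hγ₁ : γ < 1) (hCF : 0 < CF) (hLF : 0 < LF)
    (hCφ : 0 < Cφ) (E : ℝ) (hE : 0 < E) :
    ∃ c : ℝ, 0 < c ∧ ∀ m : Model ι S A p d, m.Assumptions γ CF LF Lθ Cπ lθ Cφ ρ →
      ∀ (θ : Param p) {B H : ℕ} (b : Fin B → Fin (H + 1) → (∀ i, S i) × (∀ i, A i)) (e : ℝ),
        0 ≤ e → e ≤ E → m.Accurate b θ e → ∀ (i : ι) (w : EuclideanSpace ℝ (Fin d)),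
        ‖m.criticGrad i b w - (m.criticOp θ w - m.criticVec θ i)‖ ≤ c * e * (1 + ‖w‖) := by
  have hg : 0 < (1 - γ)⁻¹ := inv_pos.2 (by linarith)
  set n : ℝ := ((Fintype.card ((∀ i, S i) × (∀ i, A i)) : ℕ) : ℝ) with hn
  have hn0 : 0 ≤ n := Nat.cast_nonneg _
  -- A bound for the estimated rewards. The constant `CF` is guaranteed only near true occupancy
  -- measures, so the estimation error is added to it.
  set Cr := CF + LF * (n * E) with hCr
  set a := n * (n * (Cr + (1 - γ)⁻¹ ^ 2 * (LF * n))) * Cφ with ha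
  have ha0 : 0 ≤ a := by positivity
  refine ⟨n * Cφ ^ 2 + a + 1, by positivity, ?_⟩
  intro m h θ B H b e he heE hacc i w
  obtain rfl := h.discount
  have hr : ∀ y, |m.empReward i b y - m.localShadowReward i θ y| ≤ LF * (n * e) := by
    intro y
    rw [empReward, empOcc_eq]
    exact h.utility.abs_gradient_sub_localShadowReward_le hLF.le i θ (m.avgVisit_nonneg b)
      (m.sum_avgVisit_le b) hacc.1 y
  have hr' : ∀ y, |m.empReward i b y| ≤ Cr := by
    intro y
    have h1 := abs_sub_abs_le_abs_sub (m.empReward i b y) (m.localShadowReward i θ y)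
    have h2 := h.utility.abs_localShadowReward_le i θ y
    have h3 : LF * (n * e) ≤ LF * (n * E) := by gcongr
    linarith [hr y]
  have hoG : ∀ x y, |m.occ θ x * m.resolvent θ x y| ≤ (1 - m.γ)⁻¹ ^ 2 := by
    intro x y
    rw [abs_of_nonneg (mul_nonneg (m.occ_nonneg θ x) (m.resolvent_nonneg θ x y)), pow_two]
    exact mul_le_mul (m.occ_le θ x) (m.resolvent_le θ x y) (m.resolvent_nonneg θ x y) hg.le
  have h1 : ‖∑ x, m.avgVisit b x • (m.qLin w x • m.φ x) - m.criticOp θ w‖ ≤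
      n * Cφ ^ 2 * e * ‖w‖ := by
    rw [criticOp, ← Finset.sum_sub_distrib]
    refine (norm_sum_le _ _).trans ?_
    calc _ ≤ ∑ _x : (∀ i, S i) × (∀ i, A i), e * (Cφ * ‖w‖ * Cφ) := by
          refine Finset.sum_le_sum fun x _ => ?_
          rw [← sub_smul, norm_smul, norm_smul, Real.norm_eq_abs, Real.norm_eq_abs]
          exact mul_le_mul (hacc.1 x) (mul_le_mul (m.abs_qLin_le h.feature w x) (h.feature x)
            (norm_nonneg _) (by positivity)) (by positivity) he
      _ = _ := by
          simp only [Finset.sum_const, Finset.card_univ, nsmul_eq_mul, ← hn]; ring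
  have h2 : ‖∑ x, (∑ y, m.avgPair b x y * m.empReward i b (y.1 i, y.2 i)) • m.φ x -
      m.criticVec θ i‖ ≤ a * e := by
    rw [criticVec_eq, ← Finset.sum_sub_distrib]
    refine (norm_sum_le _ _).trans ?_
    calc _ ≤ ∑ _x : (∀ i, S i) × (∀ i, A i),
          (n * (e * Cr + (1 - m.γ)⁻¹ ^ 2 * (LF * (n * e)))) * Cφ := by
          refine Finset.sum_le_sum fun x _ => ?_
          rw [← sub_smul, norm_smul, Real.norm_eq_abs, ← Finset.sum_sub_distrib]
          refine mul_le_mul ?_ (h.feature x) (norm_nonneg _) (by positivity)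
          refine (Finset.abs_sum_le_sum_abs _ _).trans ?_
          calc _ ≤ ∑ _y : (∀ i, S i) × (∀ i, A i),
                (e * Cr + (1 - m.γ)⁻¹ ^ 2 * (LF * (n * e))) :=
                Finset.sum_le_sum fun y _ =>
                  abs_mul_sub_mul_le (hacc.2 x y) (hr _) (hoG x y) (hr' _)
            _ = _ := by simp only [Finset.sum_const, Finset.card_univ, nsmul_eq_mul, ← hn]
      _ = _ := by
          simp only [Finset.sum_const, Finset.card_univ, nsmul_eq_mul, ← hn, ha]; ring
  rw [criticGrad_eq, sub_sub_sub_comm]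
  refine (norm_sub_le _ _).trans ((add_le_add h1 h2).trans ?_)
  have h3 : 0 ≤ a * e * ‖w‖ := by positivity
  have h4 : 0 ≤ n * Cφ ^ 2 * e := by positivity
  have h5 : 0 ≤ e * (1 + ‖w‖) := by positivity
  linarith

theorem norm_criticOp_le {m : Model ι S A p d} (hφ : m.FeatureAssumption Cφ) (hCφ : 0 ≤ Cφ)
    (θ : Param p) (v : EuclideanSpace ℝ (Fin d)) :
    ‖m.criticOp θ v‖ ≤ criticLip m.γ Cφ * ‖v‖ := by
  calc _ ≤ ∑ x, m.occ θ x * (Cφ * ‖v‖ * Cφ) := by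
        refine (norm_sum_le _ _).trans (Finset.sum_le_sum fun x _ => ?_)
        rw [norm_smul, norm_smul, Real.norm_of_nonneg (m.occ_nonneg θ x), Real.norm_eq_abs]
        exact mul_le_mul_of_nonneg_left (mul_le_mul (m.abs_qLin_le hφ v x) (hφ x)
          (norm_nonneg _) (by positivity)) (m.occ_nonneg θ x)
    _ = _ := by
        rw [← Finset.sum_mul, sum_occ, criticLip]; ring

theorem norm_sum_qLin_smul_score_le {m : Model ι S A p d} (hφ : m.FeatureAssumption Cφ)
    (hπ : m.PolicyAssumption Cπ lθ) (hCφ : 0 ≤ Cφ) (θ : Param p) (i : ι)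
    (c : (∀ i, S i) × (∀ i, A i) → ℝ) (w : EuclideanSpace ℝ (Fin d)) :
    ‖∑ x, c x • (m.qLin w x • m.score i (θ i) x.1 (x.2 i))‖ ≤
      (∑ x, |c x|) * (Cφ * Cπ * ‖w‖) := by
  rw [Finset.sum_mul]
  refine (norm_sum_le _ _).trans (Finset.sum_le_sum fun x _ => ?_)
  rw [norm_smul, norm_smul, Real.norm_eq_abs, Real.norm_eq_abs, mul_right_comm]
  exact mul_le_mul_of_nonneg_left (mul_le_mul (m.abs_qLin_le hφ w x)
    (hπ.score_bdd i _ _ _) (norm_nonneg _) (by positivity)) (abs_nonneg _)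

theorem actorDir_eq (m : Model ι S A p d) (i : ι) (θ : Param p)
    (w : EuclideanSpace ℝ (Fin d)) : m.actorDir i θ w =
      ∑ x, m.occ θ x • (m.qLin w x • m.score i (θ i) x.1 (x.2 i)) :=
  m.discExp_initLaw θ _

theorem actorDir_sub (m : Model ι S A p d) (i : ι) (θ : Param p)
    (v w : EuclideanSpace ℝ (Fin d)) :
    m.actorDir i θ (v - w) = m.actorDir i θ v - m.actorDir i θ w := by
  simp only [actorDir_eq, qLin_sub, sub_smul, smul_sub, Finset.sum_sub_distrib]

theorem norm_actorDir_le {m : Model ι S A p d} (hφ : m.FeatureAssumption Cφ)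
    (hπ : m.PolicyAssumption Cπ lθ) (hCφ : 0 ≤ Cφ) (i : ι) (θ : Param p)
    (w : EuclideanSpace ℝ (Fin d)) :
    ‖m.actorDir i θ w‖ ≤ Cφ * Cπ / (1 - m.γ) * ‖w‖ := by
  rw [actorDir_eq]
  refine (norm_sum_qLin_smul_score_le hφ hπ hCφ θ i _ w).trans (le_of_eq ?_)
  simp only [abs_of_nonneg (m.occ_nonneg θ _), sum_occ]
  rw [div_eq_mul_inv]; ring

theorem norm_actorGrad_sub_le {m : Model ι S A p d} (hφ : m.FeatureAssumption Cφ)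
    (hπ : m.PolicyAssumption Cπ lθ) (hCφ : 0 ≤ Cφ) (hCπ : 0 ≤ Cπ) (i : ι) (θ : Param p) {B H : ℕ}
    {b : Fin B → Fin (H + 1) → (∀ i, S i) × (∀ i, A i)} {e : ℝ} (hacc : m.Accurate b θ e)
    (w : EuclideanSpace ℝ (Fin d)) :
    ‖m.actorGrad i θ b w - m.actorDir i θ w‖ ≤
      (Fintype.card ((∀ i, S i) × (∀ i, A i)) : ℝ) * (Cφ * Cπ) * e * ‖w‖ := by
  rw [actorDir_eq, actorGrad_eq, ← Finset.sum_sub_distrib]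
  simp only [← sub_smul]
  refine (norm_sum_qLin_smul_score_le hφ hπ hCφ θ i _ w).trans ?_
  calc _ ≤ (∑ _x : (∀ i, S i) × (∀ i, A i), e) * (Cφ * Cπ * ‖w‖) :=
        mul_le_mul_of_nonneg_right (Finset.sum_le_sum fun x _ => hacc.1 x) (by positivity)
    _ = _ := by
        simp only [Finset.sum_const, Finset.card_univ, nsmul_eq_mul]; ring

end Gradients

/-! ### The objective -/

section Objective

variable {m : Model ι S A p d} {CF LF Lθ : ℝ}

/-- The mean value inequality on a ball gives the constant `Lθ` in place of the sharp `Lθ / 2`; the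
cap `1 / (4 * Lθ)` on the actor step leaves room for this. -/
theorem UtilityAssumption.objective_add_ge (h : m.UtilityAssumption CF LF Lθ) (hL : 0 ≤ Lθ)
    (θ v : Param p) :
    m.objective θ + inner ℝ (gradient m.objective θ) v - Lθ * ‖v‖ ^ 2 ≤ m.objective (θ + v) := by
  have h1 := Convex.norm_image_sub_le_of_norm_fderiv_le' (𝕜 := ℝ) (f := m.objective)
    (φ := fderiv ℝ m.objective θ) (s := Metric.closedBall θ ‖v‖) (C := Lθ * ‖v‖) (x := θ)
    (y := θ + v) (fun x _ => h.obj_diff x) (fun x hx => ?_) (convex_closedBall _ _)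
    (Metric.mem_closedBall_self (norm_nonneg v)) (by simp)
  · rw [add_sub_cancel_left, ← inner_gradient_left, Real.norm_eq_abs] at h1
    have := (abs_le.1 h1).1
    nlinarith
  · rw [← toDual_gradient, ← toDual_gradient, ← map_sub, LinearIsometryEquiv.norm_map]
    refine (h.obj_smooth x θ).trans (mul_le_mul_of_nonneg_left ?_ hL)
    rw [← dist_eq_norm]; exact hx

theorem norm_le_sum_abs {κ : Type*} [Fintype κ] (l : EuclideanSpace ℝ κ) :
    ‖l‖ ≤ ∑ y, |l y| := by
  rw [EuclideanSpace.norm_eq, Real.sqrt_le_left (Finset.sum_nonneg fun y _ => abs_nonneg _)]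
  exact Finset.sum_sq_le_sq_sum_of_nonneg fun y _ => norm_nonneg (l y)

theorem norm_le_of_mem_budget {i : ι} {l : EuclideanSpace ℝ (S i × A i)} (hl : l ∈ m.budget i) :
    ‖l‖ ≤ (1 - m.γ)⁻¹ := by
  refine (norm_le_sum_abs l).trans (le_of_eq_of_le ?_ hl.2)
  exact Finset.sum_congr rfl fun y _ => abs_of_nonneg (hl.1 y)

/-- A segment between two occupancy measures may leave the neighbourhood where the gradient bound is
assumed, but it stays in this convex set, where gradients are Lipschitz. -/
theorem convex_budget (m : Model ι S A p d) (i : ι) : Convex ℝ (m.budget i) := by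
  intro l hl l' hl' a b ha hb hab
  refine ⟨fun y => ?_, ?_⟩
  · simp only [PiLp.add_apply, PiLp.smul_apply, smul_eq_mul]
    have := hl.1 y
    have := hl'.1 y
    positivity
  · simp only [PiLp.add_apply, PiLp.smul_apply, smul_eq_mul, Finset.sum_add_distrib,
      ← Finset.mul_sum]
    calc _ ≤ a * (1 - m.γ)⁻¹ + b * (1 - m.γ)⁻¹ :=
          add_le_add (mul_le_mul_of_nonneg_left hl.2 ha) (mul_le_mul_of_nonneg_left hl'.2 hb)
      _ = _ := by rw [← add_mul, hab, one_mul]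

/-- The objective has bounded oscillation. -/
theorem exists_abs_objective_sub_le [Nonempty ι] {γ CF LF Lθ Cπ lθ Cφ ρ : ℝ} (hγ₁ : γ < 1)
    (hCF : 0 < CF) (hLF : 0 < LF) :
    ∃ c : ℝ, 0 ≤ c ∧ ∀ m : Model ι S A p d, m.Assumptions γ CF LF Lθ Cπ lθ Cφ ρ →
      ∀ θ θ' : Param p, |m.objective θ - m.objective θ'| ≤ c := by
  have hg : 0 < (1 - γ)⁻¹ := inv_pos.2 (by linarith)
  set n : ℝ := ∑ i, ((Fintype.card (S i × A i) : ℕ) : ℝ) with hn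
  have hn0 : 0 ≤ n := Finset.sum_nonneg fun i _ => Nat.cast_nonneg _
  set Cg := CF + LF * (2 * (1 - γ)⁻¹) with hCg
  refine ⟨n * Cg * (2 * (1 - γ)⁻¹), by positivity, ?_⟩
  intro m h θ θ'
  obtain rfl := h.discount
  have hdist : ∀ i, ∀ l ∈ m.budget i, ∀ l' ∈ m.budget i, ‖l - l'‖ ≤ 2 * (1 - m.γ)⁻¹ := by
    intro i l hl l' hl'
    have := norm_sub_le l l'
    linarith [norm_le_of_mem_budget hl, norm_le_of_mem_budget hl']
  have hi : ∀ i, ‖m.F i (m.marg i (m.occ θ)) - m.F i (m.marg i (m.occ θ'))‖ ≤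
      n * Cg * (2 * (1 - m.γ)⁻¹) := by
    intro i
    have hb := m.marg_occ_mem_budget i
    -- Compare the gradient at `l` with the one at a true occupancy measure, where it is bounded by
    -- `CF`; the domain has bounded diameter.
    have hgrad : ∀ l ∈ m.budget i, ‖fderiv ℝ (m.F i) l‖ ≤ n * Cg := by
      intro l hl
      rw [← toDual_gradient, LinearIsometryEquiv.norm_map]
      refine (norm_le_sum_abs _).trans ?_
      calc _ ≤ ∑ _y : S i × A i, Cg := by
            refine Finset.sum_le_sum fun y _ => ?_
            have h1 := h.utility.grad_lip i l hl _ (hb θ) y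
            have h2 := h.utility.abs_localShadowReward_le i θ y
            have h3 := abs_sub_abs_le_abs_sub (gradient (m.F i) l y)
              (gradient (m.F i) (m.marg i (m.occ θ)) y)
            have h4 := mul_le_mul_of_nonneg_left (hdist i l hl _ (hb θ)) hLF.le
            rw [localShadowReward] at h2
            linarith
        _ = ((Fintype.card (S i × A i) : ℕ) : ℝ) * Cg := by
            simp only [Finset.sum_const, Finset.card_univ, nsmul_eq_mul]
        _ ≤ n * Cg := by
            refine mul_le_mul_of_nonneg_right ?_ (by positivity)
            exact Finset.single_le_sum (f := fun i => ((Fintype.card (S i × A i) : ℕ) : ℝ))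
              (fun i _ => Nat.cast_nonneg _) (Finset.mem_univ i)
    refine (Convex.norm_image_sub_le_of_norm_fderiv_le (fun l hl => h.utility.diff i l hl) hgrad
      (m.convex_budget i) (hb θ') (hb θ)).trans ?_
    exact mul_le_mul_of_nonneg_left (hdist i _ (hb θ) _ (hb θ')) (by positivity)
  rw [objective, objective, utility, utility, ← mul_sub, ← Finset.sum_sub_distrib]
  exact norm_avg_le hi

end Objective

end Model

end DSAC

namespace DSAC

/-! ### Scalar recursions -/

/-- Completing the square. Of the two available factors `ρ`, one is kept as the contraction rate and
the other is spent on separating the noise. -/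
theorem sq_mul_add_sq_le {ρ s t : ℝ} (hρ₀ : 0 ≤ ρ) (hρ₁ : ρ < 1) :
    ρ ^ 2 * (s + t) ^ 2 ≤ ρ * s ^ 2 + t ^ 2 / (1 - ρ) := by
  have h1 : 0 < 1 - ρ := by linarith
  have h2 : 0 ≤ ρ * ((1 - ρ) * s - ρ * t) ^ 2 + (1 - ρ ^ 2) * t ^ 2 := by
    have : 0 ≤ 1 - ρ ^ 2 := by nlinarith
    positivity
  have h3 : ρ * s ^ 2 + t ^ 2 / (1 - ρ) - ρ ^ 2 * (s + t) ^ 2 =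
      (ρ * ((1 - ρ) * s - ρ * t) ^ 2 + (1 - ρ ^ 2) * t ^ 2) / (1 - ρ) := by
    field_simp; ring
  have h4 := div_nonneg h2 h1.le
  linarith

/-- One step of a contraction with drift `s` and noise `t`. -/
theorem sq_le_of_contraction {x D D' P U s t : ℝ} (hx₀ : 0 < x) (hx₁ : x ≤ 1) (hU : 0 ≤ U)
    (hD' : 0 ≤ D') (hP : P ^ 2 ≤ (1 - x) * U ^ 2) (hUD : U ≤ D + s) (hDP : D' ≤ P + t) :
    D' ^ 2 ≤ (1 - x / 2) * D ^ 2 + 4 / x * s ^ 2 + 5 / x * t ^ 2 := by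
  -- Young's inequality with weight `x / 4`, used once for the noise and once for the drift. Each
  -- use spends a quarter of the contraction, so that `1 - x / 2` remains.
  have young : ∀ a b : ℝ, (a + b) ^ 2 ≤ (1 + x / 4) * a ^ 2 + (1 + 4 / x) * b ^ 2 := by
    intro a b
    have : (1 + x / 4) * a ^ 2 + (1 + 4 / x) * b ^ 2 - (a + b) ^ 2 =
        (x / 2 * a - 2 * b) ^ 2 / x := by field_simp; ring
    have h := div_nonneg (sq_nonneg (x / 2 * a - 2 * b)) hx₀.le
    linarith
  have h1 : D' ^ 2 ≤ (P + t) ^ 2 := pow_le_pow_left₀ hD' hDP 2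
  have h2 : U ^ 2 ≤ (D + s) ^ 2 := pow_le_pow_left₀ hU hUD 2
  have h3 := young P t
  have h4 := young D s
  have h5 : (1 + x / 4) * P ^ 2 ≤ (1 - 3 * x / 4) * U ^ 2 := by
    nlinarith [mul_nonneg (sq_nonneg x) (sq_nonneg U), sq_nonneg P]
  have h6 : (1 - 3 * x / 4) * U ^ 2 ≤
      (1 - 3 * x / 4) * ((1 + x / 4) * D ^ 2 + (1 + 4 / x) * s ^ 2) :=
    mul_le_mul_of_nonneg_left (h2.trans h4) (by linarith)
  have h7 : (1 - 3 * x / 4) * ((1 + x / 4) * D ^ 2) ≤ (1 - x / 2) * D ^ 2 := by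
    nlinarith [mul_nonneg (sq_nonneg x) (sq_nonneg D)]
  have h8 : (1 - 3 * x / 4) * ((1 + 4 / x) * s ^ 2) ≤ 4 / x * s ^ 2 := by
    rw [← mul_assoc]
    refine mul_le_mul_of_nonneg_right ?_ (sq_nonneg s)
    have : (1 - 3 * x / 4) * (1 + 4 / x) = 4 / x - 2 - 3 * x / 4 := by field_simp; ring
    rw [this]; linarith
  have h9 : (1 + 4 / x) * t ^ 2 ≤ 5 / x * t ^ 2 := by
    refine mul_le_mul_of_nonneg_right ?_ (sq_nonneg t)
    have : 5 / x = 1 / x + 4 / x := by ring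
    rw [this]
    have : 1 ≤ 1 / x := by rw [le_div_iff₀ hx₀]; linarith
    linarith
  linarith

/-- The step-size-weighted sum of squared gradients controlled by the coupled recursions of the
objective `J`, the critic error `D` and the consensus error `E`. -/
theorem sum_le_of_recursions {J D E N G η ηθ e : ℕ → ℝ} {r μ b a W ρ Cw cE cD cA cB cJ : ℝ}
    {T : ℕ} (hT : 1 ≤ T) (hη : ∀ k, 0 < η k) (hanti : Antitone η) (hr : 0 ≤ r) (hμ : 0 < μ)
    (hb : 0 ≤ b) (ha : 0 ≤ a) (hρ₁ : ρ < 1) (hcD : 0 ≤ cD)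
    (hcA : 0 ≤ cA) (hθ₀ : ∀ k, 0 ≤ ηθ k) (hθ₁ : ∀ k, ηθ k ≤ r * η (k + 1))
    (hsmall : 8 * r ^ 2 * b * Cw ^ 2 / μ ^ 2 ≤ 1 / 4) (hρ₀ : 0 ≤ ρ)
    (hG : ∀ k, 0 ≤ G k) (hE₀ : E 0 = 0) (hEn : ∀ k, 0 ≤ E k)
    (hE : ∀ k ≤ T, E (k + 1) ≤ ρ * E k + cE * η k ^ 2)
    (hDn : ∀ k ≤ T, 0 ≤ D k) (hDB : ∀ k ≤ T, D k ≤ cB)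
    (hD : ∀ k, k + 1 ≤ T → D (k + 1) ≤ (1 - η (k + 1) * μ / 2) * D k +
      4 / (η (k + 1) * μ) * (Cw ^ 2 * ηθ k ^ 2 * G k) + cD * (η (k + 1) * e (k + 1) ^ 2))
    (hJ : ∀ k ≤ T, J k + ηθ k / 2 * N k + ηθ k / 4 * G k -
      ηθ k / 2 * (2 * b * D k + 6 * (a * E (k + 1) + W + cA * e k ^ 2)) ≤ J (k + 1))
    (hosc : ∀ k, J k - J 1 ≤ cJ) :
    ∑ k ∈ Finset.Icc 1 T, ηθ k * N k ≤
      2 * (cJ + 2 * r * b / μ * cB + r * η 0 * b * cB +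
        (2 * r * b / μ * cD + 3 * r * cA) * ∑ k ∈ Finset.range (T + 1), η k * e k ^ 2 +
        3 * r * a * (cE / (1 - ρ)) * ∑ k ∈ Finset.range (T + 1), η k ^ 3) +
      6 * W * ∑ k ∈ Finset.Icc 1 T, ηθ k := by
  -- The weight of the critic error in the Lyapunov function: with it, the decay `κ * (η μ / 2) * D`
  -- equals `r * η * b * D`, which dominates the critic error in the ascent inequality.
  set κ := 2 * r * b / μ with hκ
  have hκ0 : 0 ≤ κ := by positivity
  have hcB : 0 ≤ cB := (hDn 0 (Nat.zero_le T)).trans (hDB 0 (Nat.zero_le T))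
  -- consensus error
  have hcons : ∑ k ∈ Finset.range (T + 1), η (k + 1) * E (k + 1) ≤
      cE / (1 - ρ) * ∑ k ∈ Finset.range (T + 1), η k ^ 3 := by
    have h1 : ∑ k ∈ Finset.range (T + 1), η (k + 1) * E (k + 1) ≤
        ∑ k ∈ Finset.range (T + 1), (ρ * (η k * E k) + cE * η k ^ 3) := by
      refine Finset.sum_le_sum fun k hk => ?_
      have hk' : k ≤ T := Nat.lt_succ_iff.1 (Finset.mem_range.1 hk)
      calc η (k + 1) * E (k + 1) ≤ η k * E (k + 1) :=
            mul_le_mul_of_nonneg_right (hanti (Nat.le_succ k)) (hEn _)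
        _ ≤ η k * (ρ * E k + cE * η k ^ 2) := mul_le_mul_of_nonneg_left (hE k hk') (hη k).le
        _ = _ := by ring
    rw [Finset.sum_add_distrib, ← Finset.mul_sum, ← Finset.mul_sum] at h1
    have h2 : ∑ k ∈ Finset.range (T + 1), η k * E k ≤
        ∑ k ∈ Finset.range (T + 1), η (k + 1) * E (k + 1) := by
      -- The sum starts with a vanishing term, so the unshifted sum is at most the shifted one and
      -- can be absorbed with factor `ρ < 1`.
      rw [Finset.sum_range_succ', hE₀, mul_zero, add_zero]
      exact Finset.sum_le_sum_of_subset_of_nonneg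
        (Finset.range_subset_range.2 (Nat.le_succ T))
        fun k _ _ => mul_nonneg (hη _).le (hEn _)
    have h3 := mul_le_mul_of_nonneg_left h2 hρ₀
    rw [div_mul_eq_mul_div, le_div_iff₀ (by linarith)]
    linarith
  -- one step of the Lyapunov function
  have hstep : ∀ k, k + 1 ≤ T → ηθ k / 2 * N k ≤ (J (k + 1) - κ * D (k + 1)) - (J k - κ * D k) +
      3 * ηθ k * (a * E (k + 1) + W + cA * e k ^ 2) + κ * cD * (η (k + 1) * e (k + 1) ^ 2) := by
    intro k hk
    have hk' : k ≤ T := (Nat.le_succ k).trans hk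
    have hx := hη (k + 1)
    have h1 := mul_le_mul_of_nonneg_left (hD k hk) hκ0
    have h2 : κ * (η (k + 1) * μ / 2 * D k) = r * η (k + 1) * (b * D k) := by
      rw [hκ]; field_simp
    have h3 : ηθ k * (b * D k) ≤ r * η (k + 1) * (b * D k) :=
      mul_le_mul_of_nonneg_right (hθ₁ k) (mul_nonneg hb (hDn k hk'))
    -- The drift of the critic target is paid by the term with `G` in the ascent inequality; this is
    -- where the ratio of actor to critic step sizes must be small.
    have h4 : κ * (4 / (η (k + 1) * μ) * (Cw ^ 2 * ηθ k ^ 2 * G k)) ≤ ηθ k / 4 * G k := by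
      have h5 : κ * (4 / (η (k + 1) * μ) * (Cw ^ 2 * ηθ k ^ 2 * G k)) =
          (8 * r * b * Cw ^ 2 / μ ^ 2) * ηθ k * G k * (ηθ k / η (k + 1)) := by
        rw [hκ]; field_simp; ring
      have h6 : ηθ k / η (k + 1) ≤ r := by rw [div_le_iff₀ hx]; exact hθ₁ k
      rw [h5]
      have h7 : 0 ≤ ηθ k * G k := mul_nonneg (hθ₀ k) (hG k)
      calc _ ≤ (8 * r * b * Cw ^ 2 / μ ^ 2) * ηθ k * G k * r := by
            refine mul_le_mul_of_nonneg_left h6 ?_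
            rw [mul_assoc]
            exact mul_nonneg (by positivity) h7
        _ = (8 * r ^ 2 * b * Cw ^ 2 / μ ^ 2) * (ηθ k * G k) := by ring
        _ ≤ 1 / 4 * (ηθ k * G k) := mul_le_mul_of_nonneg_right hsmall h7
        _ = _ := by ring
    have h8 := hJ k hk'
    have h9 : κ * ((1 - η (k + 1) * μ / 2) * D k + 4 / (η (k + 1) * μ) *
        (Cw ^ 2 * ηθ k ^ 2 * G k) + cD * (η (k + 1) * e (k + 1) ^ 2)) =
        κ * D k - κ * (η (k + 1) * μ / 2 * D k) +
          κ * (4 / (η (k + 1) * μ) * (Cw ^ 2 * ηθ k ^ 2 * G k)) +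
          κ * cD * (η (k + 1) * e (k + 1) ^ 2) := by ring
    rw [h9, h2] at h1
    linarith
  -- Telescoping has to stop at `T`: there is no recursion for the critic error of index `T + 1`.
  -- The last actor step is therefore treated apart, with the crude bound `cB`.
  have hsum : ∀ n, 1 ≤ n → n ≤ T → ∑ k ∈ Finset.Ico 1 n, ηθ k / 2 * N k ≤
      (J n - κ * D n) - (J 1 - κ * D 1) +
      ∑ k ∈ Finset.Ico 1 n, 3 * ηθ k * (a * E (k + 1) + W + cA * e k ^ 2) +
      ∑ k ∈ Finset.Ico 1 n, κ * cD * (η (k + 1) * e (k + 1) ^ 2) := by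
    intro n hn
    induction n, hn using Nat.le_induction with
    | base => intro _; simp
    | succ n hn ih =>
      intro hnT
      have := ih ((Nat.le_succ n).trans hnT)
      rw [Finset.sum_Ico_succ_top hn, Finset.sum_Ico_succ_top hn, Finset.sum_Ico_succ_top hn]
      linarith [hstep n hnT]
  have hIcc : Finset.Icc 1 T = Finset.Ico 1 (T + 1) := by
    ext k; simp [Nat.lt_succ_iff]
  -- the last step
  have hlast : ηθ T / 2 * N T ≤ J (T + 1) - J T + r * η 0 * b * cB +
      3 * ηθ T * (a * E (T + 1) + W + cA * e T ^ 2) := by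
    have h1 := hJ T le_rfl
    have h2 : 0 ≤ ηθ T / 4 * G T := mul_nonneg (by linarith [hθ₀ T]) (hG T)
    have h3 : ηθ T * (b * D T) ≤ r * η 0 * (b * cB) := by
      refine mul_le_mul ((hθ₁ T).trans ?_) ?_ (mul_nonneg hb (hDn T le_rfl))
        (mul_nonneg hr (hη 0).le)
      · exact mul_le_mul_of_nonneg_left (hanti (Nat.zero_le _)) hr
      · exact mul_le_mul_of_nonneg_left (hDB T le_rfl) hb
    linarith
  have hz : ∑ k ∈ Finset.Icc 1 T, 3 * ηθ k * (a * E (k + 1) + W + cA * e k ^ 2) ≤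
      3 * r * a * (cE / (1 - ρ) * ∑ k ∈ Finset.range (T + 1), η k ^ 3) +
      3 * W * ∑ k ∈ Finset.Icc 1 T, ηθ k +
      3 * r * cA * ∑ k ∈ Finset.range (T + 1), η k * e k ^ 2 := by
    have hsub : Finset.Icc 1 T ⊆ Finset.range (T + 1) := by
      intro k hk
      simp only [Finset.mem_Icc, Finset.mem_range] at hk ⊢; omega
    have h1 : ∑ k ∈ Finset.Icc 1 T, ηθ k * E (k + 1) ≤
        r * ∑ k ∈ Finset.range (T + 1), η (k + 1) * E (k + 1) := by
      rw [Finset.mul_sum]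
      refine (Finset.sum_le_sum fun k _ => ?_).trans (Finset.sum_le_sum_of_subset_of_nonneg hsub
        fun k _ _ => mul_nonneg hr (mul_nonneg (hη _).le (hEn _)))
      rw [← mul_assoc]
      exact mul_le_mul_of_nonneg_right (hθ₁ k) (hEn _)
    have h2 : ∑ k ∈ Finset.Icc 1 T, ηθ k * e k ^ 2 ≤
        r * ∑ k ∈ Finset.range (T + 1), η k * e k ^ 2 := by
      rw [Finset.mul_sum]
      refine (Finset.sum_le_sum fun k _ => ?_).trans (Finset.sum_le_sum_of_subset_of_nonneg hsub
        fun k _ _ => mul_nonneg hr (mul_nonneg (hη _).le (sq_nonneg _)))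
      rw [← mul_assoc]
      refine mul_le_mul_of_nonneg_right ((hθ₁ k).trans ?_) (sq_nonneg _)
      exact mul_le_mul_of_nonneg_left (hanti (Nat.le_succ k)) hr
    have h3 : ∑ k ∈ Finset.Icc 1 T, 3 * ηθ k * (a * E (k + 1) + W + cA * e k ^ 2) =
        3 * a * ∑ k ∈ Finset.Icc 1 T, ηθ k * E (k + 1) + 3 * W * ∑ k ∈ Finset.Icc 1 T, ηθ k +
        3 * cA * ∑ k ∈ Finset.Icc 1 T, ηθ k * e k ^ 2 := by
      simp only [Finset.mul_sum, ← Finset.sum_add_distrib]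
      exact Finset.sum_congr rfl fun k _ => by ring
    have h4 := mul_le_mul_of_nonneg_left (h1.trans (mul_le_mul_of_nonneg_left hcons hr))
      (by positivity : 0 ≤ 3 * a)
    have h5 := mul_le_mul_of_nonneg_left h2 (by positivity : 0 ≤ 3 * cA)
    rw [h3]; linarith
  have hy : ∑ k ∈ Finset.Ico 1 T, κ * cD * (η (k + 1) * e (k + 1) ^ 2) ≤
      κ * cD * ∑ k ∈ Finset.range (T + 1), η k * e k ^ 2 := by
    rw [← Finset.mul_sum]
    refine mul_le_mul_of_nonneg_left ?_ (mul_nonneg hκ0 hcD)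
    rw [Finset.sum_Ico_add' (fun k => η k * e k ^ 2) 1 T 1]
    refine Finset.sum_le_sum_of_subset_of_nonneg ?_
      fun k _ _ => mul_nonneg (hη _).le (sq_nonneg _)
    intro k hk
    simp only [Finset.mem_Ico, Finset.mem_range] at hk ⊢; omega
  have htot : ∑ k ∈ Finset.Icc 1 T, ηθ k / 2 * N k ≤ cJ + κ * cB + r * η 0 * b * cB +
      ∑ k ∈ Finset.Icc 1 T, 3 * ηθ k * (a * E (k + 1) + W + cA * e k ^ 2) +
      ∑ k ∈ Finset.Ico 1 T, κ * cD * (η (k + 1) * e (k + 1) ^ 2) := by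
    have h1 := hsum T hT le_rfl
    rw [hIcc, Finset.sum_Ico_succ_top hT, Finset.sum_Ico_succ_top hT]
    have h2 := mul_le_mul_of_nonneg_left (hDB 1 hT) hκ0
    have h3 := mul_nonneg hκ0 (hDn T le_rfl)
    linarith [hosc (T + 1)]
  have hdouble : ∑ k ∈ Finset.Icc 1 T, ηθ k * N k = 2 * ∑ k ∈ Finset.Icc 1 T, ηθ k / 2 * N k := by
    rw [Finset.mul_sum]
    exact Finset.sum_congr rfl fun k _ => by ring
  rw [hdouble]
  linarith

end DSAC

/-! ### Boundedness of the critics and the ratio of the step sizes -/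

namespace DSAC

/-- The noise may be large in the first `k₀` iterations, where the radius grows by the affine map;
from then on sufficiently large balls are invariant. The resulting bound does not depend on `T`. -/
theorem bound_of_eventually_stable {Q : ℕ → ℝ → Prop} {c R : ℝ} {k₀ T : ℕ} (hc : 1 ≤ c)
    (hR : 0 ≤ R) (hmono : ∀ k r r', r ≤ r' → Q k r → Q k r') (h0 : Q 0 R)
    (hgrow : ∀ k ≤ T, ∀ r, 0 ≤ r → Q k r → Q (k + 1) (c * (1 + r)))
    (hstable : ∀ k, k₀ ≤ k → k ≤ T → ∀ r, R ≤ r → Q k r → Q (k + 1) r) :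
    ∀ k ≤ T + 1, Q k ((fun r => c * (1 + r))^[k₀] R) := by
  set f : ℝ → ℝ := fun r => c * (1 + r) with hf
  have hf1 : ∀ r, 0 ≤ r → r ≤ f r := fun r hr => by
    have : 1 * (1 + r) ≤ c * (1 + r) := mul_le_mul_of_nonneg_right hc (by linarith)
    simp only [hf]; linarith
  have hge : ∀ n, R ≤ f^[n] R := by
    intro n
    induction n with
    | zero => exact le_rfl
    | succ n ih =>
      rw [Function.iterate_succ_apply']
      exact ih.trans (hf1 _ (hR.trans ih))
  have hmonoit : Monotone fun n => f^[n] R := monotone_nat_of_le_succ fun n => by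
    rw [Function.iterate_succ_apply']
    exact hf1 _ (hR.trans (hge n))
  have key : ∀ k ≤ T + 1, Q k (f^[min k k₀] R) := by
    intro k
    induction k with
    | zero => intro _; simpa using h0
    | succ k ih =>
      intro hk
      have hk' : k ≤ T := Nat.le_of_succ_le_succ hk
      have h1 := ih (Nat.le_succ_of_le hk')
      rcases lt_or_ge k k₀ with hlt | hge'
      · rw [min_eq_left hlt.le] at h1
        rw [min_eq_left (Nat.succ_le_of_lt hlt), Function.iterate_succ_apply']
        exact hgrow k hk' _ (hR.trans (hge k)) h1
      · rw [min_eq_right hge'] at h1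
        rw [min_eq_right (hge'.trans (Nat.le_succ k))]
        exact hstable k hge' hk' _ (hge k₀) h1
  exact fun k hk => hmono k _ _ (hmonoit (min_le_right k k₀)) (key k hk)

/-- The ratio of the actor step size to the critic step size. -/
noncomputable def stepRatio (N : ℕ) (γ Cπ Cφ μw Cw : ℝ) : ℝ :=
  (1 - γ) * μw / (Cw * Cφ * Cπ) * (1 / max (4 * √(3 * N)) (6 * √10))

theorem actorStepSize_le_ratio (N : ℕ) (γ Lθ Cπ Cφ μw Cw η : ℝ) :
    actorStepSize N γ Lθ Cπ Cφ μw Cw η ≤ stepRatio N γ Cπ Cφ μw Cw * η := by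
  refine (min_le_left _ _).trans (le_of_eq ?_)
  rw [stepRatio]; ring

theorem stepRatio_denom_pos (N : ℕ) : 0 < max (4 * √(3 * N)) (6 * √10) :=
  lt_max_of_lt_right (by positivity)

theorem stepRatio_pos {N : ℕ} {γ Cπ Cφ μw Cw : ℝ} (hγ₁ : γ < 1) (hCπ : 0 < Cπ) (hCφ : 0 < Cφ)
    (hμ : 0 < μw) (hCw : 0 < Cw) : 0 < stepRatio N γ Cπ Cφ μw Cw := by
  have h1 : 0 < 1 - γ := by linarith
  have h2 := stepRatio_denom_pos N
  rw [stepRatio]; positivity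

theorem actorStepSize_pos {N : ℕ} {γ Lθ Cπ Cφ μw Cw η : ℝ} (hγ₁ : γ < 1) (hL : 0 < Lθ)
    (hCπ : 0 < Cπ) (hCφ : 0 < Cφ) (hμ : 0 < μw) (hCw : 0 < Cw) (hη : 0 < η) :
    0 < actorStepSize N γ Lθ Cπ Cφ μw Cw η := by
  have h1 : 0 < 1 - γ := by linarith
  have h2 := stepRatio_denom_pos N
  exact lt_min (by positivity) (by positivity)

/-- The first entry of the maximum makes its square at least `48 * N`, so after cancellation the
left side is at most `1 / 6`. -/
theorem stepRatio_small {N : ℕ} {γ Cπ Cφ μw Cw : ℝ} (hN : 0 < N) (hγ₁ : γ < 1) (hCπ : 0 < Cπ)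
    (hCφ : 0 < Cφ) (hμ : 0 < μw) (hCw : 0 < Cw) :
    8 * stepRatio N γ Cπ Cφ μw Cw ^ 2 * (N * (Cφ * Cπ / (1 - γ)) ^ 2) * Cw ^ 2 / μw ^ 2 ≤
      1 / 4 := by
  have h1 : 0 < 1 - γ := by linarith
  have h2 := stepRatio_denom_pos N
  have hN' : (0 : ℝ) < N := by exact_mod_cast hN
  set R := max (4 * √(3 * N)) (6 * √10) with hR
  have h3 : 48 * (N : ℝ) ≤ R ^ 2 := by
    have h4 : 4 * √(3 * N) ≤ R := le_max_left _ _
    have h5 := pow_le_pow_left₀ (by positivity) h4 2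
    rw [mul_pow, Real.sq_sqrt (by positivity)] at h5
    linarith
  have h6 : 8 * stepRatio N γ Cπ Cφ μw Cw ^ 2 * (N * (Cφ * Cπ / (1 - γ)) ^ 2) * Cw ^ 2 / μw ^ 2 =
      8 * N / R ^ 2 := by
    rw [stepRatio, ← hR]; field_simp
  rw [h6, div_le_div_iff₀ (by positivity) (by norm_num)]
  linarith

namespace Model

variable {ι : Type u₁} {S : ι → Type u₂} {A : ι → Type u₃} {p : ι → ℕ} {d : ℕ}
  [Fintype ι] [DecidableEq ι]
  [∀ i, Fintype (S i)] [∀ i, DecidableEq (S i)] [∀ i, Fintype (A i)] [∀ i, DecidableEq (A i)]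

/-! ### One iteration of the algorithm -/

section OneStep

variable {m : Model ι S A p d} {γ CF LF Lθ Cπ lθ Cφ ρ : ℝ} {B H : ℕ}
  {b : Fin B → Fin (H + 1) → (∀ i, S i) × (∀ i, A i)} {θ : Param p}
  {w : ι → EuclideanSpace ℝ (Fin d)} {η : ℝ}

theorem norm_sub_smul_criticGrad_le {t Bv : ℝ} {i : ι} {v : EuclideanSpace ℝ (Fin d)}
    (hη : 0 ≤ η) (hBv : ‖m.criticVec θ i‖ ≤ Bv)
    (ht : ‖m.criticGrad i b v - (m.criticOp θ v - m.criticVec θ i)‖ ≤ t) :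
    ‖v - η • m.criticGrad i b v‖ ≤ ‖v - η • m.criticOp θ v‖ + η * (Bv + t) := by
  have h : v - η • m.criticGrad i b v = (v - η • m.criticOp θ v) + η • (m.criticVec θ i -
      (m.criticGrad i b v - (m.criticOp θ v - m.criticVec θ i))) := by
    simp only [smul_sub]; abel
  rw [h]
  refine (norm_add_le _ _).trans (add_le_add le_rfl ?_)
  rw [norm_smul, Real.norm_of_nonneg hη]
  exact mul_le_mul_of_nonneg_left ((norm_sub_le _ _).trans (add_le_add hBv ht)) hη

/-- Large critics grow at most geometrically. -/
theorem norm_sub_smul_criticGrad_le_of_le {c Bv r : ℝ} {i : ι} {v : EuclideanSpace ℝ (Fin d)}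
    (hφ : m.FeatureAssumption Cφ) (hCφ : 0 < Cφ) (hη₀ : 0 ≤ η) (hη₁ : η ≤ (criticLip m.γ Cφ)⁻¹)
    (hc : 0 ≤ c) (hBv₀ : 0 ≤ Bv) (hBv : ‖m.criticVec θ i‖ ≤ Bv)
    (ht : ‖m.criticGrad i b v - (m.criticOp θ v - m.criticVec θ i)‖ ≤ c * (1 + ‖v‖))
    (hv : ‖v‖ ≤ r) :
    ‖v - η • m.criticGrad i b v‖ ≤ (2 + (criticLip m.γ Cφ)⁻¹ * (Bv + c)) * (1 + r) := by
  have hL : 0 < criticLip m.γ Cφ := div_pos (by positivity) (by linarith [m.γ_lt_one])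
  have h0 := norm_nonneg v
  have h1 : ‖v - η • m.criticOp θ v‖ ≤ 2 * r := by
    refine (norm_sub_le _ _).trans ?_
    rw [norm_smul, Real.norm_of_nonneg hη₀]
    have h2 : η * ‖m.criticOp θ v‖ ≤ (criticLip m.γ Cφ)⁻¹ * (criticLip m.γ Cφ * ‖v‖) :=
      mul_le_mul hη₁ (norm_criticOp_le hφ hCφ.le θ v) (norm_nonneg _) (inv_nonneg.2 hL.le)
    rw [inv_mul_cancel_left₀ hL.ne'] at h2
    linarith
  have h3 : η * (Bv + c * (1 + ‖v‖)) ≤ (criticLip m.γ Cφ)⁻¹ * ((Bv + c) * (1 + r)) := by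
    refine mul_le_mul hη₁ ?_ (by positivity) (inv_nonneg.2 hL.le)
    have h4 : Bv ≤ Bv * (1 + r) := le_mul_of_one_le_right hBv₀ (by linarith)
    have h5 : c * (1 + ‖v‖) ≤ c * (1 + r) := by gcongr
    linarith
  have := norm_sub_smul_criticGrad_le hη₀ hBv ht
  linarith

/-- Under strong convexity, accurate critic steps preserve large balls. -/
theorem norm_sub_smul_criticGrad_le_self {c Bv r μ : ℝ} {i : ι} {v : EuclideanSpace ℝ (Fin d)}
    (hφ : m.FeatureAssumption Cφ) (hμ : 0 < μ) (hSC : m.CriticSC μ θ)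
    (hη₀ : 0 ≤ η) (hη₁ : η ≤ (criticLip m.γ Cφ)⁻¹)
    (hc₀ : 0 ≤ c) (hc : c ≤ μ / 4) (hBv : ‖m.criticVec θ i‖ ≤ Bv)
    (ht : ‖m.criticGrad i b v - (m.criticOp θ v - m.criticVec θ i)‖ ≤ c * (1 + ‖v‖))
    (hr₁ : (criticLip m.γ Cφ)⁻¹ * (Bv + μ / 4) ≤ r) (hr₂ : 4 / μ * (Bv + μ / 4) ≤ r)
    (hv : ‖v‖ ≤ r) : ‖v - η • m.criticGrad i b v‖ ≤ r := by
  have hB0 : 0 ≤ Bv := (norm_nonneg _).trans hBv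
  have h1 := norm_sub_smul_criticGrad_le hη₀ hBv ht
  have h2 := hSC.norm_sub_smul_sq_le hφ hη₀ hη₁ v
  -- The zero vector is separated because a nonzero one is needed to conclude `η * μ ≤ 1` from the
  -- contraction estimate; strong convexity alone says nothing about `μ` when `d = 0`.
  rcases (norm_nonneg v).eq_or_lt with h0 | h0
  · rw [← h0] at h1 h2
    have h3 : ‖v - η • m.criticOp θ v‖ = 0 := by
      have : ‖v - η • m.criticOp θ v‖ ^ 2 ≤ 0 := by simpa using h2
      exact pow_eq_zero_iff two_ne_zero |>.1 (le_antisymm this (sq_nonneg _))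
    rw [h3] at h1
    refine h1.trans (le_trans ?_ hr₁)
    rw [zero_add]
    exact mul_le_mul hη₁ (by linarith) (by linarith) (hη₀.trans hη₁)
  · have h3 : 0 ≤ 1 - η * μ := by
      by_contra hneg
      have : (1 - η * μ) * ‖v‖ ^ 2 < 0 := mul_neg_of_neg_of_pos (not_le.1 hneg) (by positivity)
      linarith [sq_nonneg ‖v - η • m.criticOp θ v‖]
    have hημ : 0 ≤ η * μ := by positivity
    have h4 : ‖v - η • m.criticOp θ v‖ ≤ (1 - η * μ / 2) * ‖v‖ := by
      refine le_of_sq_le_sq (h2.trans ?_) (mul_nonneg (by linarith) h0.le)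
      rw [mul_pow]
      refine mul_le_mul_of_nonneg_right ?_ (sq_nonneg _)
      nlinarith [sq_nonneg (η * μ)]
    -- As `c ≤ μ / 4`, the part of the noise proportional to the critic consumes only half of the
    -- decay `η * μ / 2`; the other half beats the constant part on large balls.
    have h5 : η * (Bv + c * (1 + ‖v‖)) ≤ η * (Bv + μ / 4 + μ / 4 * ‖v‖) := by
      refine mul_le_mul_of_nonneg_left ?_ hη₀
      nlinarith
    have h6 : (1 - η * μ / 4) * ‖v‖ ≤ (1 - η * μ / 4) * r :=
      mul_le_mul_of_nonneg_left hv (by linarith)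
    have h7 : η * (Bv + μ / 4) ≤ η * μ / 4 * r := by
      have h8 : Bv + μ / 4 ≤ μ / 4 * r := by
        have := mul_le_mul_of_nonneg_left hr₂ (by positivity : 0 ≤ μ / 4)
        calc Bv + μ / 4 = μ / 4 * (4 / μ * (Bv + μ / 4)) := by field_simp
          _ ≤ _ := this
      calc _ ≤ η * (μ / 4 * r) := mul_le_mul_of_nonneg_left h8 hη₀
        _ = _ := by ring
    linarith

/-- Before mixing, the local gradients move the deviations from the mean by at most `2 * η * G`;
mixing then contracts. -/
theorem consensusSq_criticStep_le [Nonempty ι] (h : m.MixingAssumption ρ) (hρ₀ : 0 ≤ ρ)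
    (hρ₁ : ρ < 1) (hη : 0 ≤ η) {G : ℝ} (hG : ∀ i, ‖m.criticGrad i b (w i)‖ ≤ G) :
    consensusSq (m.criticStep η 1 b w) ≤
      ρ * consensusSq w + Fintype.card ι * (2 * G) ^ 2 / (1 - ρ) * η ^ 2 := by
  have h1 : m.criticStep η 1 b w = m.mix fun i => w i - η • m.criticGrad i b (w i) := rfl
  have hρ : 0 < 1 - ρ := by linarith
  rw [h1]
  refine (h.consensusSq_mix_le hρ₁ _).trans ?_
  simp only [consensusSq, avg_sub, avg_smul]
  rw [Finset.mul_sum, Finset.mul_sum]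
  calc _ ≤ ∑ i, (ρ * ‖w i - avg w‖ ^ 2 + (η * (2 * G)) ^ 2 / (1 - ρ)) := by
        refine Finset.sum_le_sum fun i _ => ?_
        refine le_trans ?_ (sq_mul_add_sq_le hρ₀ hρ₁)
        refine mul_le_mul_of_nonneg_left (pow_le_pow_left₀ (norm_nonneg _) ?_ 2) (sq_nonneg ρ)
        rw [sub_sub_sub_comm, ← smul_sub]
        refine (norm_sub_le _ _).trans (add_le_add le_rfl ?_)
        rw [norm_smul, Real.norm_of_nonneg hη]
        refine mul_le_mul_of_nonneg_left ?_ hη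
        refine (norm_sub_le _ _).trans ?_
        linarith [hG i, norm_avg_le_of_le hG]
    _ = _ := by
        rw [Finset.sum_add_distrib]
        simp only [Finset.sum_const, Finset.card_univ, nsmul_eq_mul]
        ring

/-- Mixing keeps the mean, and the exact local gradients are affine with a common linear part. Their
mean is therefore the exact gradient at the mean, and the disagreement of the agents does not enter.
-/
theorem norm_avg_criticStep_sub_le [Nonempty ι] (h : m.MixingAssumption ρ) (hη : 0 ≤ η) {t : ℝ}
    (ht : ∀ i, ‖m.criticGrad i b (w i) - (m.criticOp θ (w i) - m.criticVec θ i)‖ ≤ t)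
    {ws : EuclideanSpace ℝ (Fin d)} (hws : m.IsCriticOpt θ ws) :
    ‖avg (m.criticStep η 1 b w) - ws‖ ≤
      ‖(avg w - ws) - η • m.criticOp θ (avg w - ws)‖ + η * t := by
  have h1 : m.criticStep η 1 b w = m.mix fun i => w i - η • m.criticGrad i b (w i) := rfl
  have h2 : avg (fun i => m.criticOp θ (w i) - m.criticVec θ i) = m.criticOp θ (avg w - ws) := by
    rw [avg_sub, criticOp_sub, (m.isCriticOpt_iff θ ws).1 hws]
    congr 1
    have hlin : ∀ v, m.criticOp θ v = m.criticLin θ v := fun _ => rfl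
    simp only [avg, hlin, map_smul, map_sum]
  have h3 : avg (fun i => m.criticGrad i b (w i)) = m.criticOp θ (avg w - ws) +
      avg (fun i => m.criticGrad i b (w i) - (m.criticOp θ (w i) - m.criticVec θ i)) := by
    rw [avg_sub (fun i => m.criticGrad i b (w i)), h2, add_sub_cancel]
  rw [h1, h.avg_mix, avg_sub, avg_smul, h3, smul_add]
  have h4 : ∀ u g z : EuclideanSpace ℝ (Fin d), u - (g + z) - ws = (u - ws - g) - z := by
    intro u g z; abel
  rw [h4]
  refine (norm_sub_le _ _).trans (add_le_add le_rfl ?_)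
  rw [norm_smul, Real.norm_of_nonneg hη]
  exact mul_le_mul_of_nonneg_left (norm_avg_le_of_le ht) hη

/-- The direction of the actor step. -/
noncomputable def actorVec (m : Model ι S A p d) (θ : Param p)
    (b : Fin B → Fin (H + 1) → (∀ i, S i) × (∀ i, A i)) (w : ι → EuclideanSpace ℝ (Fin d)) :
    Param p := WithLp.toLp 2 (fun i => m.actorGrad i θ b (w i))

theorem norm_actorVec_sub_sq_le [Nonempty ι] (hφ : m.FeatureAssumption Cφ)
    (hπ : m.PolicyAssumption Cπ lθ) (hCφ : 0 ≤ Cφ) (hCπ : 0 ≤ Cπ) {e R W : ℝ} (he : 0 ≤ e)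
    (hacc : m.Accurate b θ e) (hR : ∀ i, ‖w i‖ ≤ R) (hW : m.ModelError W)
    {ws : EuclideanSpace ℝ (Fin d)} (hws : m.IsCriticOpt θ ws) :
    ‖m.actorVec θ b w - gradient m.objective θ‖ ^ 2 ≤
      2 * (Fintype.card ι * (Cφ * Cπ / (1 - m.γ)) ^ 2) * ‖avg w - ws‖ ^ 2 +
      6 * ((Cφ * Cπ / (1 - m.γ)) ^ 2 * consensusSq w + W +
        Fintype.card ι * (Fintype.card ((∀ i, S i) × (∀ i, A i)) * (Cφ * Cπ) * R) ^ 2 * e ^ 2) := by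
  set β := Cφ * Cπ / (1 - m.γ) with hβ
  have hβ0 : 0 ≤ β := div_nonneg (by positivity) (by linarith [m.γ_lt_one])
  set n : ℝ := ((Fintype.card ((∀ i, S i) × (∀ i, A i)) : ℕ) : ℝ) with hn
  have hi : ∀ i, ‖m.actorGrad i θ b (w i) - gradient m.objective θ i‖ ^ 2 ≤
      2 * (β * ‖avg w - ws‖) ^ 2 + 6 * ((β * ‖w i - avg w‖) ^ 2 +
        ‖gradient m.objective θ i - m.actorDir i θ ws‖ ^ 2 + (n * (Cφ * Cπ) * R * e) ^ 2) := by
    intro i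
    -- Four sources of error: distance of the mean critic from the optimum, disagreement, model
    -- error and sampling. The first is split off with factor two, the others share the factor `2 *
    -- 3`.
    have h1 : m.actorGrad i θ b (w i) - gradient m.objective θ i =
        m.actorDir i θ (avg w - ws) + (m.actorDir i θ (w i - avg w) +
          (m.actorDir i θ ws - gradient m.objective θ i) +
          (m.actorGrad i θ b (w i) - m.actorDir i θ (w i))) := by
      simp only [actorDir_sub]; abel
    have h2 : ‖m.actorDir i θ (avg w - ws)‖ ≤ β * ‖avg w - ws‖ := norm_actorDir_le hφ hπ hCφ i θ _
    have h3 : ‖m.actorDir i θ (w i - avg w)‖ ≤ β * ‖w i - avg w‖ := norm_actorDir_le hφ hπ hCφ i θ _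
    have h4 : ‖m.actorGrad i θ b (w i) - m.actorDir i θ (w i)‖ ≤ n * (Cφ * Cπ) * R * e := by
      refine (norm_actorGrad_sub_le hφ hπ hCφ hCπ i θ hacc (w i)).trans ?_
      have : n * (Cφ * Cπ) * e * ‖w i‖ ≤ n * (Cφ * Cπ) * e * R :=
        mul_le_mul_of_nonneg_left (hR i) (by positivity)
      refine this.trans (le_of_eq (by ring))
    have h5 : ‖m.actorGrad i θ b (w i) - gradient m.objective θ i‖ ≤ β * ‖avg w - ws‖ +
        (β * ‖w i - avg w‖ + ‖gradient m.objective θ i - m.actorDir i θ ws‖ +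
          n * (Cφ * Cπ) * R * e) := by
      rw [h1]
      refine (norm_add_le _ _).trans (add_le_add h2 ((norm_add_le _ _).trans (add_le_add
        ((norm_add_le _ _).trans (add_le_add h3 ?_)) h4)))
      rw [norm_sub_rev]
    refine (pow_le_pow_left₀ (norm_nonneg _) h5 2).trans ?_
    have two : ∀ a b : ℝ, (a + b) ^ 2 ≤ 2 * a ^ 2 + 2 * b ^ 2 := fun a b => by
      nlinarith [sq_nonneg (a - b)]
    have three : ∀ a b c : ℝ, (a + b + c) ^ 2 ≤ 3 * (a ^ 2 + b ^ 2 + c ^ 2) := fun a b c => by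
      nlinarith [sq_nonneg (a - b), sq_nonneg (b - c), sq_nonneg (a - c)]
    refine (two _ _).trans ?_
    have := three (β * ‖w i - avg w‖) ‖gradient m.objective θ i - m.actorDir i θ ws‖
      (n * (Cφ * Cπ) * R * e)
    linarith
  have hsum : ‖m.actorVec θ b w - gradient m.objective θ‖ ^ 2 =
      ∑ i, ‖m.actorGrad i θ b (w i) - gradient m.objective θ i‖ ^ 2 := by
    rw [PiLp.norm_sq_eq_of_L2]; rfl
  rw [hsum]
  refine (Finset.sum_le_sum fun i _ => hi i).trans ?_
  have hW' := hW θ ws hws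
  simp only [Finset.sum_add_distrib, ← Finset.mul_sum, mul_pow, Finset.sum_const, Finset.card_univ,
    nsmul_eq_mul, consensusSq]
  nlinarith

/-- The inner product of gradient and step is polarized into three squares. Smoothness consumes half
of the squared step direction, and the other half is kept to pay for the drift of the critic target.
-/
theorem objective_actorStep_ge (h : m.UtilityAssumption CF LF Lθ) (hL : 0 < Lθ) (hη₀ : 0 ≤ η)
    (hη₁ : η ≤ 1 / (4 * Lθ)) :
    m.objective θ + η / 2 * ‖gradient m.objective θ‖ ^ 2 + η / 4 * ‖m.actorVec θ b w‖ ^ 2 -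
      η / 2 * ‖m.actorVec θ b w - gradient m.objective θ‖ ^ 2 ≤
      m.objective (m.actorStep η b θ w) := by
  have h1 := h.objective_add_ge hL.le θ (η • m.actorVec θ b w)
  have h2 : m.actorStep η b θ w = θ + η • m.actorVec θ b w := rfl
  rw [h2]
  refine le_trans ?_ h1
  rw [real_inner_smul_right, norm_smul, Real.norm_of_nonneg hη₀]
  have h3 := norm_sub_sq_real (m.actorVec θ b w) (gradient m.objective θ)
  rw [real_inner_comm] at h3
  have h4 : η * Lθ ≤ 1 / 4 := by
    rw [le_div_iff₀ (by positivity)] at hη₁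
    linarith
  have h5 : Lθ * (η * ‖m.actorVec θ b w‖) ^ 2 ≤ η / 4 * ‖m.actorVec θ b w‖ ^ 2 := by
    have : η * ‖m.actorVec θ b w‖ ^ 2 * (η * Lθ) ≤ η * ‖m.actorVec θ b w‖ ^ 2 * (1 / 4) :=
      mul_le_mul_of_nonneg_left h4 (by positivity)
    linarith
  rw [h3]
  linarith

end OneStep

/-! ### Convergence along accurate runs -/

section Convergence

variable {γ CF LF Lθ Cπ lθ Cφ ρ : ℝ}

set_option maxHeartbeats 1600000 in
/-- The weighted sum of the squared gradients along a run with accurate batches. -/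
theorem exists_sum_gradSq_le [Nonempty ι] (hγ₁ : γ < 1) (hCF : 0 < CF) (hLF : 0 < LF)
    (hLθ : 0 < Lθ) (hCπ : 0 < Cπ) (hCφ : 0 < Cφ) (hρ₀ : 0 ≤ ρ) (hρ₁ : ρ < 1) {μ : ℝ}
    (hμ : 0 < μ) {Cw : ℝ} (hCw : 0 < Cw) {cA : ℝ} (hcA : 0 < cA) (D : ℝ) :
    ∃ e₀ : ℝ, 0 < e₀ ∧ ∀ k₀ : ℕ, ∃ C : ℝ, 0 < C ∧
      ∀ m : Model ι S A p d, m.Assumptions γ CF LF Lθ Cπ lθ Cφ ρ →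
      (∀ (θ θ' : Param p) (w w' : EuclideanSpace ℝ (Fin d)),
        m.CriticSC μ θ → m.CriticSC μ θ' → m.IsCriticOpt θ w → m.IsCriticOpt θ' w' →
          ‖w - w'‖ ≤ Cw * ‖θ - θ'‖) →
      ∀ W : ℝ, m.ModelError W →
      ∀ (θ₀ : Param p) (w₀ : EuclideanSpace ℝ (Fin d)), ‖w₀‖ ≤ D →
      ∀ sch : Schedule, sch.rounds = 1 → (∀ k, 0 < sch.ηw k) →
        (∀ k, sch.ηw k ≤ (criticLip γ Cφ)⁻¹) → Antitone sch.ηw →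
        (∀ k, sch.ηθ k = actorStepSize (Fintype.card ι) γ Lθ Cπ Cφ μ Cw (sch.ηw (k + 1))) →
      ∀ (e : ℕ → ℝ) (T : ℕ), 1 ≤ T → (∀ k, 0 ≤ e k) → (∀ k, e k ≤ 1) →
        (∀ k, k₀ ≤ k → k ≤ T → e k ≤ e₀) →
      ∀ x : ∀ k, Fin (sch.B k) → Fin (sch.H k + 1) → (∀ i, S i) × (∀ i, A i),
        (∀ k ≤ T, m.Accurate (x k) (m.iter sch θ₀ w₀ x k).1 (cA * e k)) →
        (∀ k ≤ T, m.CriticSC μ (m.iter sch θ₀ w₀ x k).1) →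
        ∑ k ∈ Finset.Icc 1 T, sch.ηθ k * m.gradSq sch θ₀ w₀ x k ≤
          C * (1 + ∑ k ∈ Finset.range (T + 1), sch.ηw k * e k ^ 2 +
            ∑ k ∈ Finset.range (T + 1), sch.ηw k ^ 3) +
          6 * W * ∑ k ∈ Finset.Icc 1 T, sch.ηθ k := by
  obtain ⟨c₁, hc₁, hgradc⟩ := exists_norm_criticGrad_sub_le (S := S) (A := A) (p := p) (d := d)
    (ρ := ρ) (Lθ := Lθ) (Cπ := Cπ) (lθ := lθ) hγ₁ hCF hLF hCφ cA hcA
  obtain ⟨cJ, hcJ, hosc⟩ := exists_abs_objective_sub_le (S := S) (A := A) (p := p) (d := d)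
    (ρ := ρ) (Lθ := Lθ) (Cπ := Cπ) (lθ := lθ) (Cφ := Cφ) hγ₁ hCF hLF
  have hg : 0 < (1 - γ)⁻¹ := inv_pos.2 (by linarith)
  have hg' : 0 < 1 - γ := by linarith
  set L := criticLip γ Cφ with hL
  have hL0 : 0 < L := div_pos (by positivity) hg'
  set N : ℝ := (Fintype.card ι : ℝ) with hN
  have hN0 : 0 < N := Nat.cast_pos.2 Fintype.card_pos
  set n : ℝ := ((Fintype.card ((∀ i, S i) × (∀ i, A i)) : ℕ) : ℝ) with hn
  set Bv := CF * Cφ * (1 - γ)⁻¹ ^ 2 with hBv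
  have hBv0 : 0 < Bv := by positivity
  set c := c₁ * cA with hc
  have hc0 : 0 < c := by positivity
  -- Below this accuracy the critic noise is at most `μ / 4`, as the invariance of large balls
  -- requires. The threshold is fixed before `k₀`, which may thus depend on it.
  refine ⟨μ / (4 * c), by positivity, fun k₀ => ?_⟩
  set R₀ := |D| + L⁻¹ * (Bv + μ / 4) + 4 / μ * (Bv + μ / 4) with hR₀
  have hRa : 0 ≤ L⁻¹ * (Bv + μ / 4) := by positivity
  have hRb : 0 ≤ 4 / μ * (Bv + μ / 4) := by positivity
  have hR₀0 : 0 ≤ R₀ := by positivity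
  set c₃ := 2 + L⁻¹ * (Bv + c) with hc₃
  have hc₃1 : 1 ≤ c₃ := by
    have : 0 ≤ L⁻¹ * (Bv + c) := by positivity
    linarith
  set R := (fun r => c₃ * (1 + r))^[k₀] R₀ with hR
  -- Absolute values keep the constants visibly nonnegative; that `R` is nonnegative is inferred
  -- later, when it is seen to bound a norm.
  set G₀ := L * |R| + Bv + c * (1 + |R|) with hG₀
  have hG₀0 : 0 ≤ G₀ := by positivity
  set r := stepRatio (Fintype.card ι) γ Cπ Cφ μ Cw with hr
  have hr0 : 0 < r := stepRatio_pos hγ₁ hCπ hCφ hμ hCw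
  set β := Cφ * Cπ / (1 - γ) with hβ
  have hβ0 : 0 < β := by positivity
  set cE := N * (2 * G₀) ^ 2 / (1 - ρ) with hcE
  have hρ' : 0 < 1 - ρ := by linarith
  have hcE0 : 0 ≤ cE := by positivity
  set cD := 5 * (c * (1 + |R|)) ^ 2 / μ with hcD
  have hcD0 : 0 ≤ cD := by positivity
  set cB := (|R| + Bv / μ) ^ 2 with hcB
  have hcB0 : 0 ≤ cB := sq_nonneg _
  set cE2 := N * (n * (Cφ * Cπ) * R) ^ 2 * cA ^ 2 with hcE2
  have hcE20 : 0 ≤ cE2 := by positivity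
  set K₁ := 2 * (cJ + 2 * r * (N * β ^ 2) / μ * cB + r * L⁻¹ * (N * β ^ 2) * cB) with hK₁
  set K₂ := 2 * (2 * r * (N * β ^ 2) / μ * cD + 3 * r * cE2) with hK₂
  set K₃ := 2 * (3 * r * β ^ 2 * (cE / (1 - ρ))) with hK₃
  have hK₁0 : 0 ≤ K₁ := by positivity
  have hK₂0 : 0 ≤ K₂ := by positivity
  have hK₃0 : 0 ≤ K₃ := by positivity
  refine ⟨K₁ + K₂ + K₃ + 1, by positivity, ?_⟩
  intro m h hlip W hW θ₀ w₀ hw₀ sch hrounds hη hηL hanti hηθ e T hT he₀ he₁ hesmall x hacc hSC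
  obtain rfl := h.discount
  set th : ℕ → Param p := fun k => (m.iter sch θ₀ w₀ x k).1 with hth
  set w : ℕ → ι → EuclideanSpace ℝ (Fin d) := fun k => (m.iter sch θ₀ w₀ x k).2 with hw
  have hwstep : ∀ k, w (k + 1) = m.criticStep (sch.ηw k) 1 (x k) (w k) := fun k => by
    have : w (k + 1) = m.criticStep (sch.ηw k) sch.rounds (x k) (w k) := rfl
    rw [this, hrounds]
  have hwmix : ∀ k, w (k + 1) = m.mix fun i => w k i - sch.ηw k • m.criticGrad i (x k) (w k i) :=
    hwstep
  have hthstep : ∀ k, th (k + 1) = m.actorStep (sch.ηθ k) (x k) (th k) (w (k + 1)) := fun k => rfl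
  have hthdist : ∀ k, th (k + 1) = th k + sch.ηθ k • m.actorVec (th k) (x k) (w (k + 1)) :=
    fun k => rfl
  have hηθ0 : ∀ k, 0 < sch.ηθ k := fun k => by
    rw [hηθ]; exact actorStepSize_pos hγ₁ hLθ hCπ hCφ hμ hCw (hη _)
  have hηθ1 : ∀ k, sch.ηθ k ≤ r * sch.ηw (k + 1) := fun k => by
    rw [hηθ]; exact actorStepSize_le_ratio _ _ _ _ _ _ _ _
  have hηθ2 : ∀ k, sch.ηθ k ≤ 1 / (4 * Lθ) := fun k => by
    rw [hηθ]; exact min_le_right _ _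
  have hvec : ∀ k i, ‖m.criticVec (th k) i‖ ≤ Bv := fun k i =>
    h.utility.norm_criticVec_le h.feature hCF.le i _
  have herr : ∀ k ≤ T, ∀ i v, ‖m.criticGrad i (x k) v -
      (m.criticOp (th k) v - m.criticVec (th k) i)‖ ≤ c * e k * (1 + ‖v‖) := by
    intro k hk i v
    have := hgradc m h (th k) (x k) (cA * e k) (mul_nonneg hcA.le (he₀ k))
      (mul_le_of_le_one_right hcA.le (he₁ k)) (hacc k hk) i v
    rwa [← mul_assoc] at this
  have herr' : ∀ k ≤ T, ∀ i v, ‖m.criticGrad i (x k) v -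
      (m.criticOp (th k) v - m.criticVec (th k) i)‖ ≤ c * (1 + ‖v‖) := by
    intro k hk i v
    refine (herr k hk i v).trans ?_
    exact mul_le_mul_of_nonneg_right (mul_le_of_le_one_right hc0.le (he₁ k)) (by positivity)
  -- the critics stay bounded
  have hbdd : ∀ k ≤ T + 1, ∀ i, ‖w k i‖ ≤ R := by
    refine bound_of_eventually_stable (Q := fun k r => ∀ i, ‖w k i‖ ≤ r) hc₃1 hR₀0
      (fun k r r' hrr hq i => (hq i).trans hrr) (fun i => ?_) ?_ ?_
    · have : ‖w 0 i‖ ≤ D := hw₀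
      linarith [le_abs_self D]
    · intro k hk r hr hq i
      rw [hwmix]
      exact h.mixing.norm_mix_le (fun i => norm_sub_smul_criticGrad_le_of_le h.feature hCφ
        (hη k).le (hηL k) hc0.le hBv0.le (hvec k i) (herr' k hk i _) (hq i)) i
    · intro k hk₀ hk r hr hq i
      rw [hwmix]
      have hce : c * e k ≤ μ / 4 := by
        have := mul_le_mul_of_nonneg_left (hesmall k hk₀ hk) hc0.le
        refine this.trans (le_of_eq ?_)
        field_simp
      exact h.mixing.norm_mix_le (fun i => norm_sub_smul_criticGrad_le_self h.feature hμ
        (hSC k hk) (hη k).le (hηL k) (mul_nonneg hc0.le (he₀ k)) hce (hvec k i)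
        (herr k hk i _) (by linarith [abs_nonneg D]) (by linarith [abs_nonneg D]) (hq i)) i
  have hR0 : 0 ≤ R := (norm_nonneg _).trans (hbdd 0 (Nat.zero_le _) (Classical.arbitrary ι))
  have hRabs : |R| = R := abs_of_nonneg hR0
  have hgbd : ∀ k ≤ T, ∀ i, ‖m.criticGrad i (x k) (w k i)‖ ≤ G₀ := by
    intro k hk i
    have h1 := herr' k hk i (w k i)
    have h2 := hbdd k (Nat.le_succ_of_le hk) i
    have h3 := norm_criticOp_le h.feature hCφ.le (th k) (w k i)
    have h4 := norm_sub_norm_le (m.criticGrad i (x k) (w k i))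
      (m.criticOp (th k) (w k i) - m.criticVec (th k) i)
    have h5 := norm_sub_le (m.criticOp (th k) (w k i)) (m.criticVec (th k) i)
    have h6 : L * ‖w k i‖ ≤ L * R := by gcongr
    have h7 : c * (1 + ‖w k i‖) ≤ c * (1 + R) := by gcongr
    rw [hG₀, hRabs]
    linarith [hvec k i]
  -- Optimal critics exist up to index `T`; beyond it the value zero is never used.
  have hopt : ∀ k, ∃ v, k ≤ T → m.IsCriticOpt (th k) v := by
    intro k
    by_cases hk : k ≤ T
    · obtain ⟨v, hv⟩ := (hSC k hk).exists_isCriticOpt hμ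
      exact ⟨v, fun _ => hv⟩
    · exact ⟨0, fun h => absurd h hk⟩
  choose ws hws using hopt
  -- The critic error of index `k` compares the updated critics `w (k + 1)` with the optimum at `th
  -- k`: these are the critics that the actor step at `th k` uses.
  have main := sum_le_of_recursions (J := fun k => m.objective (th k))
    (D := fun k => ‖avg (w (k + 1)) - ws k‖ ^ 2) (E := fun k => consensusSq (w k))
    (N := fun k => m.gradSq sch θ₀ w₀ x k)
    (G := fun k => ‖m.actorVec (th k) (x k) (w (k + 1))‖ ^ 2) (η := sch.ηw) (ηθ := sch.ηθ) (e := e)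
    (r := r) (μ := μ) (b := N * β ^ 2) (a := β ^ 2) (W := W) (ρ := ρ) (Cw := Cw) (cE := cE)
    (cD := cD) (cA := cE2) (cB := cB) (cJ := cJ) hT hη hanti hr0.le hμ (by positivity)
    (by positivity) hρ₁ hcD0 hcE20 (fun k => (hηθ0 k).le) hηθ1
    (stepRatio_small Fintype.card_pos hγ₁ hCπ hCφ hμ hCw) hρ₀ (fun k => sq_nonneg _)
    (consensusSq_const w₀) (fun k => consensusSq_nonneg _) ?_ (fun k _ => sq_nonneg _) ?_ ?_ ?_ ?_
  · refine main.trans (add_le_add ?_ le_rfl)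
    have s1 : 0 ≤ ∑ k ∈ Finset.range (T + 1), sch.ηw k * e k ^ 2 :=
      Finset.sum_nonneg fun k _ => mul_nonneg (hη k).le (sq_nonneg _)
    have s2 : 0 ≤ ∑ k ∈ Finset.range (T + 1), sch.ηw k ^ 3 :=
      Finset.sum_nonneg fun k _ => pow_nonneg (hη k).le 3
    set s₁ := ∑ k ∈ Finset.range (T + 1), sch.ηw k * e k ^ 2
    set s₂ := ∑ k ∈ Finset.range (T + 1), sch.ηw k ^ 3
    have s3 : r * sch.ηw 0 * (N * β ^ 2) * cB ≤ r * L⁻¹ * (N * β ^ 2) * cB := by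
      have := hηL 0
      gcongr
    have s4 : 2 * (cJ + 2 * r * (N * β ^ 2) / μ * cB + r * sch.ηw 0 * (N * β ^ 2) * cB +
        (2 * r * (N * β ^ 2) / μ * cD + 3 * r * cE2) * s₁ + 3 * r * β ^ 2 * (cE / (1 - ρ)) * s₂) ≤
        K₁ + K₂ * s₁ + K₃ * s₂ := by
      rw [hK₁, hK₂, hK₃]; linarith
    refine s4.trans ?_
    have : 0 ≤ (K₂ + K₃ + 1) + (K₁ + K₃ + 1) * s₁ + (K₁ + K₂ + 1) * s₂ := by positivity
    linarith
  · intro k hk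
    simp only [hwstep]
    exact consensusSq_criticStep_le h.mixing hρ₀ hρ₁ (hη k).le (hgbd k hk)
  · intro k hk
    refine pow_le_pow_left₀ (norm_nonneg _) ((norm_sub_le _ _).trans (add_le_add ?_ ?_)) 2
    · rw [hRabs]; exact norm_avg_le_of_le (hbdd (k + 1) (Nat.succ_le_succ hk))
    · exact (hws k hk).norm_le hμ h.utility h.feature hCF.le (hSC k hk)
  · intro k hk
    have hk' : k ≤ T := (Nat.le_succ k).trans hk
    set u := avg (w (k + 1)) - ws (k + 1) with hu
    have hx : 0 < sch.ηw (k + 1) * μ := mul_pos (hη _) hμ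
    have hcontr := (hSC (k + 1) hk).norm_sub_smul_sq_le h.feature (hη (k + 1)).le (hηL (k + 1))
    have hnoise : ‖avg (w (k + 1 + 1)) - ws (k + 1)‖ ≤
        ‖u - sch.ηw (k + 1) • m.criticOp (th (k + 1)) u‖ +
          sch.ηw (k + 1) * (c * e (k + 1) * (1 + |R|)) := by
      rw [hwstep (k + 1)]
      refine norm_avg_criticStep_sub_le h.mixing (hη (k + 1)).le (fun i => ?_) (hws (k + 1) hk)
      refine (herr (k + 1) hk i _).trans ?_
      have := hbdd (k + 1) (Nat.le_succ_of_le hk) i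
      rw [hRabs]
      exact mul_le_mul_of_nonneg_left (by linarith) (mul_nonneg hc0.le (he₀ _))
    have hdrift : ‖u‖ ≤ ‖avg (w (k + 1)) - ws k‖ +
        Cw * (sch.ηθ k * ‖m.actorVec (th k) (x k) (w (k + 1))‖) := by
      have h1 := hlip (th k) (th (k + 1)) (ws k) (ws (k + 1)) (hSC k hk') (hSC (k + 1) hk)
        (hws k hk') (hws (k + 1) hk)
      rw [hthdist k, sub_add_cancel_left, norm_neg, norm_smul,
        Real.norm_of_nonneg (hηθ0 k).le] at h1
      have h2 : u = (avg (w (k + 1)) - ws k) + (ws k - ws (k + 1)) := by rw [hu]; abel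
      rw [h2]
      exact (norm_add_le _ _).trans (add_le_add le_rfl h1)
    -- In the second case the contraction factor is negative, so every vector is zero and the
    -- recursion is trivial.
    rcases le_or_gt (sch.ηw (k + 1) * μ) 1 with hx1 | hx1
    · have key := sq_le_of_contraction hx hx1 (norm_nonneg u) (norm_nonneg _) (hcontr u) hdrift
        hnoise
      refine key.trans (le_of_eq ?_)
      have hη' := (hη (k + 1)).ne'
      rw [hcD]
      congr 1
      · ring
      · field_simp
    · have hzero : ∀ v : EuclideanSpace ℝ (Fin d), ‖v‖ = 0 := by
        intro v
        have h1 := (sq_nonneg _).trans (hcontr v)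
        have h2 : ‖v‖ ^ 2 ≤ 0 := by
          by_contra hpos
          have := mul_neg_of_neg_of_pos (by linarith : 1 - sch.ηw (k + 1) * μ < 0)
            (not_le.1 hpos)
          linarith
        exact pow_eq_zero_iff two_ne_zero |>.1 (le_antisymm h2 (sq_nonneg _))
      simp only [hzero]
      have := hη (k + 1)
      have := hηθ0 k
      have : 0 ≤ 4 / (sch.ηw (k + 1) * μ) *
        (Cw ^ 2 * sch.ηθ k ^ 2 * ‖m.actorVec (th k) (x k) (w (k + 1))‖ ^ 2) := by positivity
      have : 0 ≤ cD * (sch.ηw (k + 1) * e (k + 1) ^ 2) := by positivity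
      simp only [ne_eq, OfNat.ofNat_ne_zero, not_false_eq_true, zero_pow, mul_zero, zero_add]
      linarith
  · intro k hk
    have h1 := objective_actorStep_ge (θ := th k) (b := x k) (w := w (k + 1)) h.utility hLθ
      (hηθ0 k).le (hηθ2 k)
    have h2 := norm_actorVec_sub_sq_le (b := x k) (w := w (k + 1)) h.feature h.policy hCφ.le hCπ.le
      (mul_nonneg hcA.le (he₀ k)) (hacc k hk) (hbdd (k + 1) (Nat.succ_le_succ hk)) hW (hws k hk)
    rw [← hthstep] at h1
    have h3 := mul_le_mul_of_nonneg_left h2 (by linarith [hηθ0 k] : 0 ≤ sch.ηθ k / 2)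
    refine le_trans ?_ h1
    have h4 : m.gradSq sch θ₀ w₀ x k = ‖gradient m.objective (th k)‖ ^ 2 := rfl
    have h5 : cE2 * e k ^ 2 = N * (n * (Cφ * Cπ) * R) ^ 2 * (cA * e k) ^ 2 := by
      rw [hcE2]; ring
    simp only [h4, h5]
    linarith
  · intro k
    exact (le_abs_self _).trans (hosc m h _ _)

end Convergence

end Model

end DSAC

namespace DSAC

/-! ### Union bound -/

/-- A countable union bound with outer measures: neither the bad sets nor `S` need be measurable,
and bounds for finite partial sums replace summability. -/
theorem one_sub_le_measureReal_of_countable {Ω I : Type*} [MeasurableSpace Ω] [Countable I]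
    {P : Measure Ω} [IsProbabilityMeasure P] {bad : I → Set Ω} {δ : I → ℝ} {δ' : ℝ}
    (hδ : ∀ i, 0 ≤ δ i) (hbad : ∀ i, P.real (bad i) ≤ δ i) (hsum : ∀ s : Finset I, ∑ i ∈ s, δ i ≤ δ')
    {S : Set Ω} (hS : ∀ᵐ ω ∂P, (∀ i, ω ∉ bad i) → ω ∈ S) : 1 - δ' ≤ P.real S := by
  have hδ' : 0 ≤ δ' := by simpa using hsum ∅
  have h1 : P (⋃ i, bad i) ≤ ENNReal.ofReal δ' := by
    refine (measure_iUnion_le _).trans ?_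
    rw [ENNReal.tsum_eq_iSup_sum]
    refine iSup_le fun s => ?_
    calc ∑ i ∈ s, P (bad i) ≤ ∑ i ∈ s, ENNReal.ofReal (δ i) :=
          Finset.sum_le_sum fun i _ => by
            rw [← ofReal_measureReal]; exact ENNReal.ofReal_le_ofReal (hbad i)
      _ = ENNReal.ofReal (∑ i ∈ s, δ i) := (ENNReal.ofReal_sum_of_nonneg fun i _ => hδ i).symm
      _ ≤ _ := ENNReal.ofReal_le_ofReal (hsum s)
  have h2 : P.real (⋃ i, bad i) ≤ δ' := ENNReal.toReal_le_of_le_ofReal hδ' h1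
  have h3 : P.real ((⋃ i, bad i)ᶜ) ≤ P.real S := by
    refine ENNReal.toReal_mono (measure_ne_top _ _) (measure_mono_ae ?_)
    filter_upwards [hS] with ω hω hmem
    exact hω fun i hi => hmem (Set.mem_iUnion.2 ⟨i, hi⟩)
  have h4 : (1 : ℝ) ≤ P.real (⋃ i, bad i) + P.real ((⋃ i, bad i)ᶜ) := by
    rw [← probReal_univ (μ := P), ← Set.union_compl_self (⋃ i, bad i)]
    exact measureReal_union_le _ _
  linarith

theorem sum_inv_succ_sq_le (s : Finset ℕ) :
    ∑ k ∈ s, 1 / ((k : ℝ) + 1) ^ 2 ≤ Real.pi ^ 2 / 6 := by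
  have h := sum_le_hasSum (s.map ⟨Nat.succ, Nat.succ_injective⟩)
    (fun n _ => (by positivity : (0 : ℝ) ≤ 1 / (n : ℝ) ^ 2)) hasSum_zeta_two
  simpa using h

theorem one_le_log_of_three_le {x : ℝ} (hx : 3 ≤ x) : 1 ≤ Real.log x := by
  rw [Real.le_log_iff_exp_le (by linarith)]
  linarith [Real.exp_one_lt_d9]

/-! ### Powers and logarithms -/

theorem rpow_neg_three_halves {ε : ℝ} (hε : 0 < ε) : ε ^ (-(3 / 2) : ℝ) = (√ε ^ 3)⁻¹ := by
  rw [Real.rpow_neg hε.le, Real.sqrt_eq_rpow, ← Real.rpow_mul_natCast hε.le]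
  norm_num

theorem log_rpow_neg_three_halves {ε : ℝ} (hε : 0 < ε) :
    Real.log (ε ^ (-(3 / 2) : ℝ)) = 3 / 2 * Real.log (1 / ε) := by
  rw [Real.log_rpow hε, one_div, Real.log_inv]; ring

theorem log_one_div_nonneg {ε : ℝ} (hε : 0 < ε) (hε₁ : ε < 1) : 0 ≤ Real.log (1 / ε) :=
  Real.log_nonneg (by rw [one_div]; exact one_le_inv_iff₀.2 ⟨hε, hε₁.le⟩)

theorem one_le_rpow_neg_three_halves {ε : ℝ} (hε : 0 < ε) (hε₁ : ε < 1) :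
    1 ≤ ε ^ (-(3 / 2) : ℝ) :=
  Real.one_le_rpow_of_pos_of_le_one_of_nonpos hε hε₁.le (by norm_num)

/-- Up to a constant the cap on the actor step never binds, because the comparison value `t` is at
most one. -/
theorem actorStepSize_ge {N : ℕ} {γ Lθ Cπ Cφ μw Cw η t : ℝ} (hγ₁ : γ < 1) (hL : 0 < Lθ)
    (hCπ : 0 < Cπ) (hCφ : 0 < Cφ) (hμ : 0 < μw) (hCw : 0 < Cw) (ht0 : 0 ≤ t) (ht1 : t ≤ 1)
    (htη : t ≤ η) :
    min (stepRatio N γ Cπ Cφ μw Cw) (1 / (4 * Lθ)) * t ≤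
      actorStepSize N γ Lθ Cπ Cφ μw Cw η := by
  have hr : 0 < stepRatio N γ Cπ Cφ μw Cw := stepRatio_pos hγ₁ hCπ hCφ hμ hCw
  have hq : (0 : ℝ) < 1 / (4 * Lθ) := by positivity
  refine le_min ?_ ?_
  · calc min (stepRatio N γ Cπ Cφ μw Cw) (1 / (4 * Lθ)) * t
        ≤ stepRatio N γ Cπ Cφ μw Cw * η :=
          mul_le_mul (min_le_left _ _) htη ht0 hr.le
      _ = _ := by rw [stepRatio]; ring
  · calc min (stepRatio N γ Cπ Cφ μw Cw) (1 / (4 * Lθ)) * t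
        ≤ 1 / (4 * Lθ) * 1 := mul_le_mul (min_le_right _ _) ht1 ht0 hq.le
      _ = _ := mul_one _

/-! ### The diminishing step sizes -/

theorem rpow_neg_third_pos (k : ℕ) : 0 < ((k : ℝ) + 1) ^ (-(1 / 3) : ℝ) := by positivity

theorem rpow_neg_third_le_one (k : ℕ) : ((k : ℝ) + 1) ^ (-(1 / 3) : ℝ) ≤ 1 :=
  Real.rpow_le_one_of_one_le_of_nonpos (by linarith [Nat.cast_nonneg (α := ℝ) k]) (by norm_num)

theorem rpow_neg_third_sq (k : ℕ) :
    (((k : ℝ) + 1) ^ (-(1 / 3) : ℝ)) ^ 2 = ((k : ℝ) + 1) ^ (-(2 / 3) : ℝ) := by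
  rw [← Real.rpow_mul_natCast (by positivity)]; norm_num

theorem rpow_neg_third_cube (k : ℕ) :
    (((k : ℝ) + 1) ^ (-(1 / 3) : ℝ)) ^ 3 = ((k : ℝ) + 1)⁻¹ := by
  rw [← Real.rpow_mul_natCast (by positivity), ← Real.rpow_neg_one]; norm_num

theorem antitone_rpow_neg_third : Antitone fun k : ℕ => ((k : ℝ) + 1) ^ (-(1 / 3) : ℝ) := by
  intro k l hkl
  have : (k : ℝ) ≤ l := by exact_mod_cast hkl
  exact Real.rpow_le_rpow_of_nonpos (by positivity) (by linarith) (by norm_num)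

theorem antitone_dimStep (γ Cφ : ℝ) : Antitone (dimStep γ Cφ) := fun _ _ hkl =>
  min_le_min_right _ (antitone_rpow_neg_third hkl)

theorem dimStep_pos {γ Cφ : ℝ} (hγ₁ : γ < 1) (hCφ : 0 < Cφ) (k : ℕ) : 0 < dimStep γ Cφ k :=
  lt_min (rpow_neg_third_pos k)
    (inv_pos.2 (div_pos (by positivity) (by linarith)))

/-- For `T ≥ 2` one has `T + 1 ≤ T ^ 2`, and the additive constants are absorbed since `log T ≥ log
2`. -/
theorem sum_inv_succ_le_log {T : ℕ} (hT : 2 ≤ T) :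
    1 + 2 * ∑ k ∈ Finset.range (T + 1), ((k : ℝ) + 1)⁻¹ ≤ 10 * Real.log T := by
  have h1 := harmonic_le_one_add_log (T + 1)
  have h2 : ((harmonic (T + 1) : ℚ) : ℝ) = ∑ k ∈ Finset.range (T + 1), ((k : ℝ) + 1)⁻¹ := by
    simp [harmonic]
  have hT' : (2 : ℝ) ≤ T := by exact_mod_cast hT
  have h3 : Real.log ((T + 1 : ℕ) : ℝ) ≤ 2 * Real.log T := by
    have : 2 * Real.log T = Real.log ((T : ℝ) ^ 2) := by rw [Real.log_pow]; norm_num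
    rw [this]
    refine Real.log_le_log (by positivity) ?_
    push_cast
    nlinarith
  have h4 : Real.log 2 ≤ Real.log T := Real.log_le_log two_pos hT'
  have := Real.log_two_gt_d9
  rw [← h2]
  linarith

/-! ### The number of iterations with diminishing parameters -/

/-- A number of iterations that guarantees the accuracy `ε`. -/
noncomputable def horizon (ε : ℝ) : ℕ := ⌈2 * ε ^ (-(3 / 2) : ℝ) * (1 + Real.log (1 / ε)) ^ 2⌉₊

section Horizon

variable {ε : ℝ}

theorem one_le_rpow_mul_log_sq (hε : 0 < ε) (hε₁ : ε < 1) :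
    1 ≤ ε ^ (-(3 / 2) : ℝ) * (1 + Real.log (1 / ε)) ^ 2 :=
  one_le_mul_of_one_le_of_one_le (one_le_rpow_neg_three_halves hε hε₁)
    (one_le_pow₀ (by linarith [log_one_div_nonneg hε hε₁]))

theorem le_horizon (ε : ℝ) :
    2 * (ε ^ (-(3 / 2) : ℝ) * (1 + Real.log (1 / ε)) ^ 2) ≤ horizon ε := by
  rw [← mul_assoc]; exact Nat.le_ceil _

theorem horizon_le (hε : 0 < ε) (hε₁ : ε < 1) :
    (horizon ε : ℝ) ≤ 3 * (ε ^ (-(3 / 2) : ℝ) * (1 + Real.log (1 / ε)) ^ 2) := by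
  have h1 := one_le_rpow_mul_log_sq hε hε₁
  have h2 := (Nat.ceil_lt_add_one (a := 2 * ε ^ (-(3 / 2) : ℝ) * (1 + Real.log (1 / ε)) ^ 2)
    (by positivity)).le
  rw [horizon]
  linarith

theorem two_le_horizon (hε : 0 < ε) (hε₁ : ε < 1) : 2 ≤ horizon ε := by
  have h1 := one_le_rpow_mul_log_sq hε hε₁
  have : (2 : ℝ) ≤ horizon ε := by linarith [le_horizon ε]
  exact_mod_cast this

theorem log_four_mul_le (hε : 0 < ε) (hε₁ : ε < 1) :
    Real.log (4 * (ε ^ (-(3 / 2) : ℝ) * (1 + Real.log (1 / ε)) ^ 2)) ≤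
      4 * (1 + Real.log (1 / ε)) := by
  have hl := log_one_div_nonneg hε hε₁
  have h1 : (0 : ℝ) < 1 + Real.log (1 / ε) := by linarith
  have h2 : (0 : ℝ) < ε ^ (-(3 / 2) : ℝ) := Real.rpow_pos_of_pos hε _
  rw [Real.log_mul (by norm_num) (by positivity), Real.log_mul h2.ne' (by positivity),
    log_rpow_neg_three_halves hε, Real.log_pow]
  have h3 := Real.log_le_sub_one_of_pos h1
  have h4 : Real.log 4 = 2 * Real.log 2 := by
    rw [show (4 : ℝ) = 2 ^ 2 by norm_num, Real.log_pow]; norm_num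
  have := Real.log_two_lt_d9
  push_cast
  linarith

/-- The squared logarithm in the horizon becomes the power `4 / 3` under the exponent `2 / 3`, which
is enough to cancel `log T`, itself of order `1 + log (1 / ε)`. -/
theorem log_horizon_div_le (hε : 0 < ε) (hε₁ : ε < 1) :
    Real.log (horizon ε) / (horizon ε : ℝ) ^ (2 / 3 : ℝ) ≤ 4 * ε := by
  set a := 1 + Real.log (1 / ε) with ha
  have hl := log_one_div_nonneg hε hε₁
  have ha1 : 1 ≤ a := by linarith
  have hy := one_le_rpow_mul_log_sq hε hε₁
  have hlow := le_horizon ε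
  have hup := horizon_le hε hε₁
  rw [← ha] at hy hlow hup
  have hT : (0 : ℝ) < horizon ε := by linarith
  have h1 : Real.log (horizon ε) ≤ 4 * a :=
    (Real.log_le_log hT (by linarith)).trans (log_four_mul_le hε hε₁)
  have h2 : ε⁻¹ * a ≤ (horizon ε : ℝ) ^ (2 / 3 : ℝ) := by
    calc ε⁻¹ * a ≤ ε⁻¹ * a ^ (4 / 3 : ℝ) := by
          gcongr
          exact Real.self_le_rpow_of_one_le ha1 (by norm_num)
      _ = (ε ^ (-(3 / 2) : ℝ) * a ^ 2) ^ (2 / 3 : ℝ) := by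
          rw [Real.mul_rpow (by positivity) (by positivity), ← Real.rpow_mul hε.le,
            ← Real.rpow_natCast a 2, ← Real.rpow_mul (by positivity), ← Real.rpow_neg_one]
          norm_num
      _ ≤ _ := Real.rpow_le_rpow (by positivity) (by linarith) (by norm_num)
  rw [div_le_iff₀ (by positivity)]
  calc Real.log (horizon ε) ≤ 4 * a := h1
    _ = 4 * ε * (ε⁻¹ * a) := by field_simp
    _ ≤ _ := by gcongr

end Horizon

/-! ### The number of samples -/

theorem const_samples_le {N : ℕ} {γ Lθ Cπ Cφ μw Cw K : ℝ} (hN : 0 < N) (hγ₁ : γ < 1) (hK : 1 ≤ K) :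
    ∃ c : ℝ, 0 < c ∧ ∀ (δ ε : ℝ) (T H : ℕ) (η : ℝ), 0 < δ → δ < 1 → 0 < ε → ε < 1 →
      T ≤ K * ε ^ (-(3 / 2) : ℝ) → H ≤ K * (1 + Real.log (1 / ε)) / (1 - γ) →
      ((constSchedule N γ Lθ Cπ Cφ μw Cw δ ε T H η).samples T : ℝ) ≤
        c * ε ^ (-(5 / 2) : ℝ) * (1 + Real.log (1 / ε) + Real.log (1 / δ)) ^ 6 := by
  have hg : 0 < 1 - γ := by linarith
  have hN' : (1 : ℝ) ≤ N := by exact_mod_cast hN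
  have hNK : 1 ≤ 6 * N * K := by nlinarith
  set c₁ := Real.log (6 * N * K) + 2 with hc₁
  have hlogNK := Real.log_nonneg hNK
  have hc₁0 : 0 < c₁ := by linarith
  set c₂ := K / (1 - γ) + 1 with hc₂
  have hc₂0 : 0 < c₂ := by positivity
  refine ⟨2 * K * (2 * c₁) * c₂, by positivity, ?_⟩
  intro δ ε T H η hδ hδ₁ hε hε₁ hT hH
  set l := Real.log (1 / ε) with hl
  set l' := Real.log (1 / δ) with hl'
  have hl0 : 0 ≤ l := log_one_div_nonneg hε hε₁
  have hl'0 : 0 ≤ l' := log_one_div_nonneg hδ hδ₁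
  set Λ := 1 + l + l' with hΛ
  have hΛ1 : 1 ≤ Λ := by linarith
  have hy := one_le_rpow_neg_three_halves hε hε₁
  set y := ε ^ (-(3 / 2) : ℝ) with hyd
  have hT1 : (T : ℝ) + 1 ≤ 2 * K * y := by nlinarith
  set b := Real.log (1 / (δ / (3 * N * (T + 1)))) with hb
  have hb' : b = Real.log (3 * N * (T + 1) / δ) := by rw [hb, one_div_div]
  have hbΛ : b ≤ c₁ * Λ := by
    have h1 : (3 * N * (T + 1) / δ : ℝ) ≤ 6 * N * K * y * (1 / δ) := by
      rw [div_eq_mul_one_div]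
      gcongr ?_ * _
      have := mul_le_mul_of_nonneg_left hT1 (by positivity : (0 : ℝ) ≤ 3 * N)
      linarith
    have h2 := Real.log_le_log (by positivity) h1
    rw [Real.log_mul (by positivity) (by positivity), Real.log_mul (by positivity) (by positivity),
      log_rpow_neg_three_halves hε, ← hl, ← hl'] at h2
    rw [hb', hc₁]
    have h3 := le_mul_of_one_le_right hlogNK hΛ1
    linarith
  -- With `ε < 1` this makes the unrounded batch size at least one, so rounding up costs at most a
  -- factor of two.
  have hb1 : 1 ≤ b := by
    rw [hb']
    refine one_le_log_of_three_le ?_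
    rw [le_div_iff₀ hδ]
    have : (1 : ℝ) ≤ N * (T + 1) := by nlinarith [Nat.cast_nonneg (α := ℝ) T]
    linarith
  have hB : (⌈b / ε⌉₊ : ℝ) ≤ 2 * c₁ * Λ * ε⁻¹ := by
    have h1 := (Nat.ceil_lt_add_one (a := b / ε) (by positivity)).le
    have h2 : 1 ≤ b / ε := by rw [le_div_iff₀ hε]; linarith
    have h3 : b / ε ≤ c₁ * Λ * ε⁻¹ := by rw [div_eq_mul_inv]; gcongr
    linarith
  have hHΛ : (H : ℝ) + 1 ≤ c₂ * Λ := by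
    have h1 : K * (1 + l) / (1 - γ) = K / (1 - γ) * (1 + l) := by ring
    have h2 : K / (1 - γ) * (1 + l) ≤ K / (1 - γ) * Λ :=
      mul_le_mul_of_nonneg_left (by linarith) (by positivity)
    rw [hc₂]
    linarith
  have hsam : ((constSchedule N γ Lθ Cπ Cφ μw Cw δ ε T H η).samples T : ℝ) =
      ((T : ℝ) + 1) * ((⌈b / ε⌉₊ : ℝ) * (H + 1)) := by
    simp [Schedule.samples, constSchedule, hb]
  have hpow : y * ε⁻¹ = ε ^ (-(5 / 2) : ℝ) := by
    rw [hyd, ← Real.rpow_neg_one, ← Real.rpow_add hε]; norm_num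
  rw [hsam]
  calc ((T : ℝ) + 1) * ((⌈b / ε⌉₊ : ℝ) * (H + 1))
      ≤ (2 * K * y) * ((2 * c₁ * Λ * ε⁻¹) * (c₂ * Λ)) := by gcongr
    _ = 2 * K * (2 * c₁) * c₂ * (y * ε⁻¹) * Λ ^ 2 := by ring
    _ ≤ 2 * K * (2 * c₁) * c₂ * (y * ε⁻¹) * Λ ^ 6 := by
        have := pow_le_pow_right₀ hΛ1 (by norm_num : 2 ≤ 6)
        gcongr
    _ = _ := by rw [hpow]

theorem adaptive_samples_le {N : ℕ} {γ Lθ Cπ Cφ μw Cw K : ℝ} (hN : 0 < N) (hγ₁ : γ < 1)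
    (hK : 1 ≤ K) :
    ∃ c : ℝ, 0 < c ∧ ∀ (δ ε : ℝ) (H : ℕ → ℕ), 0 < δ → δ < 1 → 0 < ε → ε < 1 →
      (∀ k : ℕ, H k ≤ K * (1 + Real.log ((k : ℝ) + 1)) / (1 - γ)) →
      ((adaptiveSchedule N γ Lθ Cπ Cφ μw Cw δ H).samples (horizon ε) : ℝ) ≤
        c * ε ^ (-(5 / 2) : ℝ) * (1 + Real.log (1 / ε) + Real.log (1 / δ)) ^ 6 := by
  have hg : 0 < 1 - γ := by linarith
  have hN' : (1 : ℝ) ≤ N := by exact_mod_cast hN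
  have hpi := Real.pi_gt_three
  have hNpi : 1 ≤ N * Real.pi ^ 2 := by nlinarith
  set c₁ := Real.log (N * Real.pi ^ 2) + 8 with hc₁
  have hlogN := Real.log_nonneg hNpi
  have hc₁0 : 0 < c₁ := by linarith
  set c₂ := 5 * K / (1 - γ) + 1 with hc₂
  have hc₂0 : 0 < c₂ := by positivity
  refine ⟨16 * (2 * c₁) * c₂, by positivity, ?_⟩
  intro δ ε H hδ hδ₁ hε hε₁ hH
  set l := Real.log (1 / ε) with hl
  set l' := Real.log (1 / δ) with hl'
  have hl0 : 0 ≤ l := log_one_div_nonneg hε hε₁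
  have hl'0 : 0 ≤ l' := log_one_div_nonneg hδ hδ₁
  set Λ := 1 + l + l' with hΛ
  have hΛ1 : 1 ≤ Λ := by linarith
  have hy1 := one_le_rpow_mul_log_sq hε hε₁
  have hlog4 := log_four_mul_le hε hε₁
  have hup := horizon_le hε hε₁
  rw [← hl] at hy1 hlog4 hup
  set y := ε ^ (-(3 / 2) : ℝ) with hyd
  have hy0 : 0 < y := Real.rpow_pos_of_pos hε _
  set T := horizon ε with hT
  set Q : ℝ := (T : ℝ) + 1 with hQ
  have hQ1 : 1 ≤ Q := by linarith [Nat.cast_nonneg (α := ℝ) T]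
  have hQy : Q ≤ 4 * (y * (1 + l) ^ 2) := by linarith
  have hlogQ : Real.log Q ≤ 4 * (1 + l) := (Real.log_le_log (by linarith) hQy).trans hlog4
  have hterm : ∀ k ∈ Finset.range (T + 1),
      ((⌈Real.log (1 / (2 * δ / (N * Real.pi ^ 2 * ((k : ℝ) + 1) ^ 2))) *
        ((k : ℝ) + 1) ^ (2 / 3 : ℝ)⌉₊ : ℝ) * ((H k : ℝ) + 1)) ≤
      2 * c₁ * Λ * Q ^ (2 / 3 : ℝ) * (c₂ * Λ) := by
    intro k hk
    have hkQ : (k : ℝ) + 1 ≤ Q := by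
      have : (k : ℝ) ≤ T := by exact_mod_cast Nat.lt_succ_iff.1 (Finset.mem_range.1 hk)
      linarith
    have hk1 : (1 : ℝ) ≤ (k : ℝ) + 1 := by linarith [Nat.cast_nonneg (α := ℝ) k]
    have hlogk : Real.log ((k : ℝ) + 1) ≤ 4 * (1 + l) :=
      (Real.log_le_log (by linarith) hkQ).trans hlogQ
    set b := Real.log (1 / (2 * δ / (N * Real.pi ^ 2 * ((k : ℝ) + 1) ^ 2))) with hb
    have hb' : b = Real.log (N * Real.pi ^ 2 * ((k : ℝ) + 1) ^ 2 / (2 * δ)) := by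
      rw [hb, one_div_div]
    have hbΛ : b ≤ c₁ * Λ := by
      have h1 : (N * Real.pi ^ 2 * ((k : ℝ) + 1) ^ 2 / (2 * δ) : ℝ) ≤
          N * Real.pi ^ 2 * ((k : ℝ) + 1) ^ 2 * (1 / δ) := by
        rw [div_eq_mul_one_div]
        gcongr
        linarith
      have h2 := Real.log_le_log (by positivity) h1
      rw [Real.log_mul (by positivity) (by positivity),
        Real.log_mul (by positivity) (by positivity), Real.log_pow, ← hl'] at h2
      rw [hb', hc₁]
      have h3 := le_mul_of_one_le_right hlogN hΛ1
      push_cast at h2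
      linarith
    have hk23 : ((k : ℝ) + 1) ^ (2 / 3 : ℝ) ≤ Q ^ (2 / 3 : ℝ) :=
      Real.rpow_le_rpow (by linarith) hkQ (by norm_num)
    have hQ23 : 1 ≤ Q ^ (2 / 3 : ℝ) := Real.one_le_rpow hQ1 (by norm_num)
    have hc₁Λ : 1 ≤ c₁ * Λ := one_le_mul_of_one_le_of_one_le (by linarith) hΛ1
    have hB : (⌈b * ((k : ℝ) + 1) ^ (2 / 3 : ℝ)⌉₊ : ℝ) ≤ 2 * c₁ * Λ * Q ^ (2 / 3 : ℝ) := by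
      have h1 : b * ((k : ℝ) + 1) ^ (2 / 3 : ℝ) ≤ c₁ * Λ * Q ^ (2 / 3 : ℝ) :=
        mul_le_mul hbΛ hk23 (by positivity) (by positivity)
      have h2 := (Nat.ceil_lt_add_one (a := c₁ * Λ * Q ^ (2 / 3 : ℝ)) (by positivity)).le
      have h3 : (⌈b * ((k : ℝ) + 1) ^ (2 / 3 : ℝ)⌉₊ : ℝ) ≤ ⌈c₁ * Λ * Q ^ (2 / 3 : ℝ)⌉₊ := by
        exact_mod_cast Nat.ceil_mono h1
      have h4 : 1 ≤ c₁ * Λ * Q ^ (2 / 3 : ℝ) := one_le_mul_of_one_le_of_one_le hc₁Λ hQ23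
      linarith
    have hHΛ : (H k : ℝ) + 1 ≤ c₂ * Λ := by
      have h1 : K * (1 + Real.log ((k : ℝ) + 1)) / (1 - γ) ≤ 5 * K / (1 - γ) * Λ := by
        rw [div_mul_eq_mul_div]
        gcongr ?_ / _
        have : K * (1 + Real.log ((k : ℝ) + 1)) ≤ K * (5 * Λ) :=
          mul_le_mul_of_nonneg_left (by linarith) (by linarith)
        linarith
      have := hH k
      rw [hc₂]
      linarith
    exact mul_le_mul hB hHΛ (by positivity) (by positivity)
  have hsam : ((adaptiveSchedule N γ Lθ Cπ Cφ μw Cw δ H).samples T : ℝ) ≤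
      Q * (2 * c₁ * Λ * Q ^ (2 / 3 : ℝ) * (c₂ * Λ)) := by
    have := Finset.sum_le_sum hterm
    rw [Finset.sum_const, Finset.card_range, nsmul_eq_mul] at this
    simpa [Schedule.samples, adaptiveSchedule] using this
  -- Iterations times batch growth. The horizon contributes `ε ^ (-5/2)` and the logarithmic power
  -- `10 / 3`, rounded up to four; two further powers come from the failure level and the episode
  -- length, which makes six.
  have hQ53 : Q * Q ^ (2 / 3 : ℝ) ≤ 16 * ε ^ (-(5 / 2) : ℝ) * Λ ^ 4 := by
    have e1 : Q * Q ^ (2 / 3 : ℝ) = Q ^ (5 / 3 : ℝ) := by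
      rw [← Real.rpow_one_add' (by linarith) (by norm_num)]; norm_num
    have hl1 : 1 ≤ 1 + l := by linarith
    have e2 : (4 * (y * (1 + l) ^ 2)) ^ (5 / 3 : ℝ) =
        4 ^ (5 / 3 : ℝ) * (ε ^ (-(5 / 2) : ℝ) * (1 + l) ^ (10 / 3 : ℝ)) := by
      rw [Real.mul_rpow (by norm_num) (by positivity), Real.mul_rpow hy0.le (by positivity), hyd,
        ← Real.rpow_mul hε.le, ← Real.rpow_natCast (1 + l) 2, ← Real.rpow_mul (by positivity)]
      norm_num
    have e3 : (4 : ℝ) ^ (5 / 3 : ℝ) ≤ 16 := by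
      calc (4 : ℝ) ^ (5 / 3 : ℝ) ≤ 4 ^ (2 : ℝ) :=
            Real.rpow_le_rpow_of_exponent_le (by norm_num) (by norm_num)
        _ = 16 := by norm_num
    have e4 : (1 + l) ^ (10 / 3 : ℝ) ≤ Λ ^ 4 := by
      calc (1 + l) ^ (10 / 3 : ℝ) ≤ (1 + l) ^ (4 : ℝ) :=
            Real.rpow_le_rpow_of_exponent_le hl1 (by norm_num)
        _ = (1 + l) ^ 4 := by norm_cast
        _ ≤ Λ ^ 4 := by gcongr; linarith
    rw [e1]
    calc Q ^ (5 / 3 : ℝ) ≤ (4 * (y * (1 + l) ^ 2)) ^ (5 / 3 : ℝ) :=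
          Real.rpow_le_rpow (by linarith) hQy (by norm_num)
      _ = 4 ^ (5 / 3 : ℝ) * (ε ^ (-(5 / 2) : ℝ) * (1 + l) ^ (10 / 3 : ℝ)) := e2
      _ ≤ 16 * (ε ^ (-(5 / 2) : ℝ) * Λ ^ 4) := by gcongr
      _ = _ := by ring
  refine hsam.trans ?_
  calc Q * (2 * c₁ * Λ * Q ^ (2 / 3 : ℝ) * (c₂ * Λ))
      = (Q * Q ^ (2 / 3 : ℝ)) * (2 * c₁ * c₂ * Λ ^ 2) := by ring
    _ ≤ (16 * ε ^ (-(5 / 2) : ℝ) * Λ ^ 4) * (2 * c₁ * c₂ * Λ ^ 2) := by gcongr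
    _ = _ := by ring

end DSAC

/-! ### Rates along accurate runs, and their probability -/

namespace DSAC

namespace Model

variable {ι : Type u₁} {S : ι → Type u₂} {A : ι → Type u₃} {p : ι → ℕ} {d : ℕ}
  [Fintype ι] [DecidableEq ι]
  [∀ i, Fintype (S i)] [∀ i, DecidableEq (S i)] [∀ i, Fintype (A i)] [∀ i, DecidableEq (A i)]
  {m : Model ι S A p d}

/-- Nothing forces `W` to be nonnegative unless some optimal critic exists; strong convexity at one
parameter provides it. -/
theorem ModelError.nonneg [Nonempty ι] {W μ : ℝ} {θ : Param p} (h : m.ModelError W) (hμ : 0 < μ)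
    (hSC : m.CriticSC μ θ) : 0 ≤ W := by
  obtain ⟨w, hw⟩ := hSC.exists_isCriticOpt hμ
  exact (Finset.sum_nonneg fun i _ => sq_nonneg _).trans (h θ w hw)

open Classical in
/-- If the batches with indices `f i` fail to be accurate with small probabilities, then any
property that almost surely follows from their accuracy holds with high probability. -/
theorem IsRun.one_sub_le_measureReal {sch : Schedule} {θ₀ : Param p}
    {w₀ : EuclideanSpace ℝ (Fin d)} {Ω : Type u₄} [MeasurableSpace Ω] {P : Measure Ω}
    [IsProbabilityMeasure P]
    {X : Ω → ∀ k, Fin (sch.B k) → Fin (sch.H k + 1) → (∀ i, S i) × (∀ i, A i)}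
    (hX : m.IsRun sch θ₀ w₀ P X) {I : Type*} [Countable I] (f : I → ℕ) {e fail : ℕ → ℝ} {δ : ℝ}
    (hfail : ∀ i, 0 ≤ fail (f i))
    (hbad : ∀ i θ, ∑ b : Fin (sch.B (f i)) → Fin (sch.H (f i) + 1) → (∀ i, S i) × (∀ i, A i)
      with ¬ m.Accurate b θ (e (f i)), ∏ j, m.trajProb θ (b j) ≤ fail (f i))
    (hsum : ∀ s : Finset I, ∑ i ∈ s, fail (f i) ≤ δ) {good : Set Ω}
    (hgood : ∀ᵐ ω ∂P, (∀ i, m.Accurate (X ω (f i)) (m.iter sch θ₀ w₀ (X ω) (f i)).1 (e (f i))) →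
      ω ∈ good) :
    1 - δ ≤ P.real good := by
  refine one_sub_le_measureReal_of_countable
    (bad := fun i => {ω | ¬ m.Accurate (X ω (f i)) (m.iter sch θ₀ w₀ (X ω) (f i)).1 (e (f i))})
    hfail (fun i => ?_) hsum ?_
  · exact hX.measureReal_bad_le (f i) (fun θ b => ¬ m.Accurate b θ (e (f i)))
      fun θ => by convert hbad i θ
  · filter_upwards [hgood] with ω hω hn
    exact hω fun i => not_not.1 (hn i)

section Rates

variable {γ CF LF Lθ Cπ lθ Cφ ρ : ℝ}

/-- The constant parameters reach the accuracy `ε` along accurate runs. -/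
theorem exists_weightedAvg_const_le [Nonempty ι] (hγ₁ : γ < 1) (hCF : 0 < CF) (hLF : 0 < LF)
    (hLθ : 0 < Lθ) (hCπ : 0 < Cπ) (hCφ : 0 < Cφ) (hρ₀ : 0 ≤ ρ) (hρ₁ : ρ < 1) {μ : ℝ}
    (hμ : 0 < μ) {Cw : ℝ} (hCw : 0 < Cw) {cA : ℝ} (hcA : 0 < cA) (D : ℝ) {K : ℝ} (hK : 1 ≤ K) :
    ∃ C : ℝ, 0 < C ∧ ∀ m : Model ι S A p d, m.Assumptions γ CF LF Lθ Cπ lθ Cφ ρ →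
      (∀ (θ θ' : Param p) (w w' : EuclideanSpace ℝ (Fin d)),
        m.CriticSC μ θ → m.CriticSC μ θ' → m.IsCriticOpt θ w → m.IsCriticOpt θ' w' →
          ‖w - w'‖ ≤ Cw * ‖θ - θ'‖) →
      ∀ W : ℝ, m.ModelError W →
      ∀ (θ₀ : Param p) (w₀ : EuclideanSpace ℝ (Fin d)), ‖w₀‖ ≤ D →
      ∀ (δ ε : ℝ) (T H : ℕ) (η : ℝ), 0 < ε → ε < 1 →
        K⁻¹ * ε ^ (-(3 / 2) : ℝ) ≤ T → T ≤ K * ε ^ (-(3 / 2) : ℝ) →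
        K⁻¹ * √ε ≤ η → η ≤ K * √ε → η ≤ (criticLip γ Cφ)⁻¹ →
      ∀ sch : Schedule, sch = constSchedule (Fintype.card ι) γ Lθ Cπ Cφ μ Cw δ ε T H η →
      ∀ x : ∀ k, Fin (sch.B k) → Fin (sch.H k + 1) → (∀ i, S i) × (∀ i, A i),
        (∀ k ≤ T, m.Accurate (x k) (m.iter sch θ₀ w₀ x k).1 (cA * √ε)) →
        (∀ k ≤ T, m.CriticSC μ (m.iter sch θ₀ w₀ x k).1) →
        (1 / (T : ℝ)) * ∑ k ∈ Finset.Icc 1 T, m.gradSq sch θ₀ w₀ x k ≤ C * (ε + W) ∧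
          m.weightedAvg sch θ₀ w₀ x T ≤ C * (ε + W) := by
  obtain ⟨e₀, he₀, hmain⟩ := exists_sum_gradSq_le (S := S) (A := A) (p := p) (d := d)
    (lθ := lθ) hγ₁ hCF hLF hLθ hCπ hCφ hρ₀ hρ₁ hμ hCw hcA D
  -- If `√ε` exceeds `e₀`, then `T` is at most `K * (e₀ ^ 3)⁻¹`, hence smaller than this index, and
  -- no late iteration has to be accurate up to `e₀`.
  obtain ⟨C, hC, hmain⟩ := hmain (⌈K * (e₀ ^ 3)⁻¹⌉₊ + 1)
  set c := min (stepRatio (Fintype.card ι) γ Cπ Cφ μ Cw) (1 / (4 * Lθ)) with hc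
  have hc0 : 0 < c := lt_min (stepRatio_pos hγ₁ hCπ hCφ hμ hCw) (by positivity)
  have hK0 : 0 < K := by linarith
  set C₁ := C * (1 + 2 * K ^ 2 + 2 * K ^ 4) with hC₁
  refine ⟨C₁ * K ^ 2 / c + 6, by positivity, ?_⟩
  intro m h hlip W hW θ₀ w₀ hw₀ δ ε T H η hε hε₁ hT hT' hη hη' hηL sch hsch x hacc hSC
  have hW0 : 0 ≤ W := hW.nonneg hμ (hSC 0 (Nat.zero_le _))
  have hy := one_le_rpow_neg_three_halves hε hε₁
  rw [rpow_neg_three_halves hε] at hT hT' hy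
  set y := √ε with hyd
  have hy0 : 0 < y := Real.sqrt_pos.2 hε
  have hy1 : y < 1 := (Real.sqrt_lt' one_pos).2 (by simpa using hε₁)
  have hyε : y ^ 2 = ε := Real.sq_sqrt hε.le
  have hT0 : (0 : ℝ) < T := lt_of_lt_of_le (by positivity) hT
  have hT1 : 1 ≤ T := by exact_mod_cast hT0
  have hη0 : 0 < η := lt_of_lt_of_le (by positivity) hη
  set s := actorStepSize (Fintype.card ι) γ Lθ Cπ Cφ μ Cw η with hs
  have hs0 : 0 < s := actorStepSize_pos hγ₁ hLθ hCπ hCφ hμ hCw hη0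
  have hsge : c * (K⁻¹ * y) ≤ s :=
    actorStepSize_ge hγ₁ hLθ hCπ hCφ hμ hCw (by positivity)
      (mul_le_one₀ (inv_le_one_of_one_le₀ hK) hy0.le hy1.le) hη
  have hηw : ∀ k, sch.ηw k = η := fun k => by rw [hsch]; rfl
  have hηθ : ∀ k, sch.ηθ k = s := fun k => by rw [hsch]; rfl
  have hsum := hmain m h hlip W hW θ₀ w₀ hw₀ sch (by rw [hsch]; rfl) (fun k => by rw [hηw]; exact hη0)
    (fun k => by rw [hηw]; exact hηL) (fun k l _ => by rw [hηw, hηw])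
    (fun k => by rw [hηθ, hηw]) (fun _ => y) T hT1 (fun _ => hy0.le) (fun _ => hy1.le) ?_ x hacc hSC
  swap
  · intro k hk hkT
    by_contra! hlt
    have h1 : (T : ℝ) ≤ K * (e₀ ^ 3)⁻¹ := hT'.trans (by gcongr)
    have h2 := h1.trans (Nat.le_ceil _)
    have h3 : T ≤ ⌈K * (e₀ ^ 3)⁻¹⌉₊ := by exact_mod_cast h2
    omega
  simp only [hηw, hηθ, Finset.sum_const, Finset.card_range, Nat.card_Icc, nsmul_eq_mul,
    ← Finset.mul_sum, Nat.add_sub_cancel] at hsum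
  set G := ∑ k ∈ Finset.Icc 1 T, m.gradSq sch θ₀ w₀ x k with hG
  have hTT : ((T + 1 : ℕ) : ℝ) ≤ 2 * K * (y ^ 3)⁻¹ := by
    push_cast
    nlinarith
  have hs1 : ((T + 1 : ℕ) : ℝ) * (η * y ^ 2) ≤ 2 * K ^ 2 := by
    calc ((T + 1 : ℕ) : ℝ) * (η * y ^ 2) ≤ 2 * K * (y ^ 3)⁻¹ * ((K * y) * y ^ 2) := by gcongr
      _ = 2 * K ^ 2 := by field_simp
  have hs2 : ((T + 1 : ℕ) : ℝ) * η ^ 3 ≤ 2 * K ^ 4 := by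
    calc ((T + 1 : ℕ) : ℝ) * η ^ 3 ≤ 2 * K * (y ^ 3)⁻¹ * (K * y) ^ 3 := by gcongr
      _ = 2 * K ^ 4 := by field_simp
  have hG1 : s * G ≤ C₁ + 6 * W * (T * s) := by
    refine hsum.trans (add_le_add ?_ le_rfl)
    rw [hC₁]
    exact mul_le_mul_of_nonneg_left (by linarith) hC.le
  -- The total actor step is at least of order `1 / ε`, so dividing by it turns bounded quantities
  -- into order `ε`.
  have hTs : c / K ^ 2 ≤ ε * (T * s) := by
    calc c / K ^ 2 = y ^ 2 * ((K⁻¹ * (y ^ 3)⁻¹) * (c * (K⁻¹ * y))) := by field_simp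
      _ ≤ y ^ 2 * (T * s) := by gcongr
      _ = _ := by rw [hyε]
  have hC₁0 : 0 ≤ C₁ := by positivity
  have hG2 : s * G ≤ (C₁ * K ^ 2 / c + 6) * (ε + W) * (T * s) := by
    have h1 : C₁ ≤ C₁ * K ^ 2 / c * (ε * (T * s)) := by
      calc C₁ = C₁ * K ^ 2 / c * (c / K ^ 2) := by field_simp
        _ ≤ _ := by gcongr
    have h2 : 0 ≤ C₁ * K ^ 2 / c * W * (T * s) := by positivity
    have h3 : 0 ≤ 6 * ε * (T * s) := by positivity
    linarith
  have hG3 : 1 / (T : ℝ) * G ≤ (C₁ * K ^ 2 / c + 6) * (ε + W) := by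
    rw [one_div_mul_eq_div, div_le_iff₀ hT0]
    refine le_of_mul_le_mul_left (hG2.trans (le_of_eq ?_)) hs0
    ring
  refine ⟨hG3, le_of_eq_of_le ?_ hG3⟩
  simp only [weightedAvg, hηθ, ← Finset.mul_sum, Finset.sum_const, Nat.card_Icc, nsmul_eq_mul,
    Nat.add_sub_cancel]
  rw [← hG]
  field_simp

/-- The convergence rate of the diminishing parameters along accurate runs. -/
theorem exists_weightedAvg_adaptive_le [Nonempty ι] (hγ₁ : γ < 1) (hCF : 0 < CF) (hLF : 0 < LF)
    (hLθ : 0 < Lθ) (hCπ : 0 < Cπ) (hCφ : 0 < Cφ) (hρ₀ : 0 ≤ ρ) (hρ₁ : ρ < 1) {μ : ℝ}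
    (hμ : 0 < μ) {Cw : ℝ} (hCw : 0 < Cw) {cA : ℝ} (hcA : 0 < cA) (D : ℝ) :
    ∃ C : ℝ, 0 < C ∧ ∀ m : Model ι S A p d, m.Assumptions γ CF LF Lθ Cπ lθ Cφ ρ →
      (∀ (θ θ' : Param p) (w w' : EuclideanSpace ℝ (Fin d)),
        m.CriticSC μ θ → m.CriticSC μ θ' → m.IsCriticOpt θ w → m.IsCriticOpt θ' w' →
          ‖w - w'‖ ≤ Cw * ‖θ - θ'‖) →
      ∀ W : ℝ, m.ModelError W →
      ∀ (θ₀ : Param p) (w₀ : EuclideanSpace ℝ (Fin d)), ‖w₀‖ ≤ D →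
      ∀ (δ : ℝ) (H : ℕ → ℕ) (sch : Schedule),
        sch = adaptiveSchedule (Fintype.card ι) γ Lθ Cπ Cφ μ Cw δ H →
      ∀ x : ∀ k, Fin (sch.B k) → Fin (sch.H k + 1) → (∀ i, S i) × (∀ i, A i),
        (∀ k, m.Accurate (x k) (m.iter sch θ₀ w₀ x k).1 (cA * ((k : ℝ) + 1) ^ (-(1 / 3) : ℝ))) →
        (∀ k, m.CriticSC μ (m.iter sch θ₀ w₀ x k).1) →
        ∀ T : ℕ, 2 ≤ T →
          m.weightedAvg sch θ₀ w₀ x T ≤ C * (Real.log T / (T : ℝ) ^ (2 / 3 : ℝ) + W) := by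
  obtain ⟨e₀, he₀, hmain⟩ := exists_sum_gradSq_le (S := S) (A := A) (p := p) (d := d)
    (lθ := lθ) hγ₁ hCF hLF hLθ hCπ hCφ hρ₀ hρ₁ hμ hCw hcA D
  -- From this index on, `(k + 1) ^ (-1/3)` is at most `e₀`.
  obtain ⟨C, hC, hmain⟩ := hmain ⌈(e₀ ^ 3)⁻¹⌉₊
  set c := min (stepRatio (Fintype.card ι) γ Cπ Cφ μ Cw) (1 / (4 * Lθ)) with hc
  have hc0 : 0 < c := lt_min (stepRatio_pos hγ₁ hCπ hCφ hμ hCw) (by positivity)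
  have hL0 : 0 < (criticLip γ Cφ)⁻¹ := inv_pos.2 (div_pos (by positivity) (by linarith))
  set a := min 1 (criticLip γ Cφ)⁻¹ with ha
  have ha0 : 0 < a := lt_min one_pos hL0
  set c' := c * (a / 2) with hc'
  have hc'0 : 0 < c' := by positivity
  refine ⟨10 * C / c' + 6, by positivity, ?_⟩
  intro m h hlip W hW θ₀ w₀ hw₀ δ H sch hsch x hacc hSC T hT
  have hW0 : 0 ≤ W := hW.nonneg hμ (hSC 0)
  set u : ℕ → ℝ := fun k => ((k : ℝ) + 1) ^ (-(1 / 3) : ℝ) with hu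
  have hu0 : ∀ k, 0 < u k := rpow_neg_third_pos
  have hu1 : ∀ k, u k ≤ 1 := rpow_neg_third_le_one
  have hηw : ∀ k, sch.ηw k = dimStep γ Cφ k := fun k => by rw [hsch]; rfl
  have hηθ : ∀ k, sch.ηθ k =
      actorStepSize (Fintype.card ι) γ Lθ Cπ Cφ μ Cw (dimStep γ Cφ (k + 1)) :=
    fun k => by rw [hsch]; rfl
  have hsum := hmain m h hlip W hW θ₀ w₀ hw₀ sch (by rw [hsch]; rfl)
    (fun k => by rw [hηw]; exact dimStep_pos hγ₁ hCφ k)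
    (fun k => by rw [hηw]; exact min_le_right _ _)
    (fun k l hkl => by rw [hηw, hηw]; exact antitone_dimStep γ Cφ hkl)
    (fun k => by rw [hηθ, hηw]) u T (by omega) (fun k => (hu0 k).le) hu1 ?_ x
    (fun k _ => hacc k) (fun k _ => hSC k)
  swap
  · intro k hk _
    have h1 : (e₀ ^ 3)⁻¹ ≤ (k : ℝ) + 1 := by
      have h2 : (⌈(e₀ ^ 3)⁻¹⌉₊ : ℝ) ≤ k := by exact_mod_cast hk
      linarith [Nat.le_ceil (e₀ ^ 3)⁻¹]
    refine le_of_pow_le_pow_left₀ three_ne_zero he₀.le ?_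
    rw [hu]
    dsimp only
    rw [rpow_neg_third_cube]
    exact inv_le_of_inv_le₀ (by positivity) h1
  have hηu : ∀ k, sch.ηw k ≤ u k := fun k => by rw [hηw]; exact min_le_left _ _
  have hηw0 : ∀ k, 0 < sch.ηw k := fun k => by rw [hηw]; exact dimStep_pos hγ₁ hCφ k
  have hu3 : ∀ k, u k ^ 3 = ((k : ℝ) + 1)⁻¹ := rpow_neg_third_cube
  have hs1 : ∑ k ∈ Finset.range (T + 1), sch.ηw k * u k ^ 2 ≤
      ∑ k ∈ Finset.range (T + 1), ((k : ℝ) + 1)⁻¹ := Finset.sum_le_sum fun k _ => by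
    rw [← hu3, pow_succ' (u k) 2]
    exact mul_le_mul_of_nonneg_right (hηu k) (sq_nonneg _)
  have hs2 : ∑ k ∈ Finset.range (T + 1), sch.ηw k ^ 3 ≤
      ∑ k ∈ Finset.range (T + 1), ((k : ℝ) + 1)⁻¹ := Finset.sum_le_sum fun k _ => by
    rw [← hu3]
    exact pow_le_pow_left₀ (hηw0 k).le (hηu k) 3
  have hT' : (2 : ℝ) ≤ T := by exact_mod_cast hT
  have hT0 : (0 : ℝ) < T := by linarith
  set s := ∑ k ∈ Finset.Icc 1 T, sch.ηθ k with hs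
  -- The actor step of iteration `k` belongs to the critic step of index `k + 1`, whose base `k + 2`
  -- is at most `8 * T`; the cube root of eight is the factor two in `c'`.
  have hstep : ∀ k ∈ Finset.Icc 1 T, c' * (T : ℝ) ^ (-(1 / 3) : ℝ) ≤ sch.ηθ k := by
    intro k hk
    have hkT : (k : ℝ) ≤ T := by exact_mod_cast (Finset.mem_Icc.1 hk).2
    have h1 : a * u (k + 1) ≤ dimStep γ Cφ (k + 1) := by
      refine le_min ?_ ?_
      · exact mul_le_of_le_one_left (hu0 _).le (min_le_left _ _)
      · exact (mul_le_of_le_one_right ha0.le (hu1 _)).trans (min_le_right _ _)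
    have h2 := actorStepSize_ge (N := Fintype.card ι) hγ₁ hLθ hCπ hCφ hμ hCw
      (mul_pos ha0 (hu0 (k + 1))).le (mul_le_one₀ (min_le_left _ _) (hu0 _).le (hu1 _)) h1
    rw [hηθ]
    refine le_trans ?_ h2
    rw [← hc, hc', mul_assoc]
    refine mul_le_mul_of_nonneg_left ?_ hc0.le
    rw [div_mul_eq_mul_div, mul_div_assoc]
    refine mul_le_mul_of_nonneg_left ?_ ha0.le
    calc (T : ℝ) ^ (-(1 / 3) : ℝ) / 2 = (8 * T) ^ (-(1 / 3) : ℝ) := by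
          rw [Real.mul_rpow (by norm_num) hT0.le, show (8 : ℝ) = 2 ^ (3 : ℝ) by norm_num,
            ← Real.rpow_mul (by norm_num)]
          norm_num [Real.rpow_neg_one]
          ring
      _ ≤ u (k + 1) := by
          refine Real.rpow_le_rpow_of_nonpos (by positivity) ?_ (by norm_num)
          push_cast
          linarith
  have hsge : c' * (T : ℝ) ^ (2 / 3 : ℝ) ≤ s := by
    have h1 := Finset.card_nsmul_le_sum _ _ _ hstep
    rw [Nat.card_Icc, Nat.add_sub_cancel, nsmul_eq_mul] at h1
    refine le_of_eq_of_le ?_ h1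
    have h2 : (T : ℝ) ^ (2 / 3 : ℝ) = T * (T : ℝ) ^ (-(1 / 3) : ℝ) := by
      rw [← Real.rpow_one_add' hT0.le (by norm_num)]; norm_num
    rw [h2]; ring
  have hp : 0 < (T : ℝ) ^ (2 / 3 : ℝ) := Real.rpow_pos_of_pos hT0 _
  have hs0 : 0 < s := lt_of_lt_of_le (by positivity) hsge
  have hlog : 0 ≤ Real.log T := Real.log_nonneg (by linarith)
  rw [weightedAvg, ← hs, div_le_iff₀ hs0]
  have h1 : C * (1 + ∑ k ∈ Finset.range (T + 1), sch.ηw k * u k ^ 2 +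
      ∑ k ∈ Finset.range (T + 1), sch.ηw k ^ 3) ≤ C * (10 * Real.log T) :=
    mul_le_mul_of_nonneg_left (by linarith [sum_inv_succ_le_log hT]) hC.le
  have h2 : C * (10 * Real.log T) ≤ 10 * C / c' * (Real.log T / (T : ℝ) ^ (2 / 3 : ℝ)) * s := by
    calc C * (10 * Real.log T) = 10 * C / c' * (Real.log T / (T : ℝ) ^ (2 / 3 : ℝ)) *
          (c' * (T : ℝ) ^ (2 / 3 : ℝ)) := by field_simp
      _ ≤ _ := by gcongr
  have h3 : 0 ≤ 10 * C / c' * W * s := by positivity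
  have h4 : 0 ≤ 6 * (Real.log T / (T : ℝ) ^ (2 / 3 : ℝ)) * s := by positivity
  linarith

end Rates

end Model

end DSAC

/-! ### Assembly of the two parameter regimes -/

theorem theorem1 {ι : Type u₁} {S : ι → Type u₂} {A : ι → Type u₃}
    {p : ι → ℕ} {d : ℕ} [Fintype ι] [DecidableEq ι] [Nonempty ι]
    [∀ i, Fintype (S i)] [∀ i, DecidableEq (S i)] [∀ i, Fintype (A i)] [∀ i, DecidableEq (A i)]
    (γ CF LF Lθ Cπ lθ Cφ μw ρ D : ℝ) (hγ₀ : 0 ≤ γ) (hγ₁ : γ < 1) (hCF : 0 < CF) (hLF : 0 < LF)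
    (hLθ : 0 < Lθ) (hCπ : 0 < Cπ) (hlθ : 0 < lθ) (hCφ : 0 < Cφ) (hμw : 0 < μw) (hρ₀ : 0 ≤ ρ)
    (hρ₁ : ρ < 1) :
    -- the constant `C_w` of the step-size rule: any sufficiently large Lipschitz constant of `w*`
    ∃ C₀ : ℝ, 0 < C₀ ∧
      (∀ m : DSAC.Model ι S A p d, m.Assumptions γ CF LF Lθ Cπ lθ Cφ ρ →
        ∀ (θ θ' : DSAC.Param p) (w w' : EuclideanSpace ℝ (Fin d)),
          m.CriticSC μw θ → m.CriticSC μw θ' → m.IsCriticOpt θ w → m.IsCriticOpt θ' w' →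
            ‖w - w'‖ ≤ C₀ * ‖θ - θ'‖) ∧
      ∀ Cw : ℝ, C₀ ≤ Cw → ∀ K : ℝ, 1 ≤ K →
        ∃ C : ℝ, 0 < C ∧ ∃ q : ℕ, ∃ Tε : ℝ → ℕ,
          (∀ ε : ℝ, 0 < ε → ε < 1 → 2 ≤ Tε ε ∧
            (Tε ε : ℝ) ≤ C * ε ^ (-(3 / 2) : ℝ) * (1 + Real.log (1 / ε)) ^ q) ∧
          ∀ m : DSAC.Model ι S A p d, m.Assumptions γ CF LF Lθ Cπ lθ Cφ ρ →
          ∀ W : ℝ, m.ModelError W →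
          ∀ (θ₀ : DSAC.Param p) (w₀ : EuclideanSpace ℝ (Fin d)), ‖w₀‖ ≤ D →
          ∀ δ : ℝ, 0 < δ → δ < 1 →
          ∀ (Ω : Type u₄) [MeasurableSpace Ω] (P : MeasureTheory.Measure Ω)
            [MeasureTheory.IsProbabilityMeasure P],
          -- (i) constant parameters
          (∀ (ε : ℝ) (T H : ℕ) (η : ℝ), 0 < ε → ε < 1 →
            K⁻¹ * ε ^ (-(3 / 2) : ℝ) ≤ T → T ≤ K * ε ^ (-(3 / 2) : ℝ) →
            γ ^ H ≤ ε → H ≤ K * (1 + Real.log (1 / ε)) / (1 - γ) →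
            K⁻¹ * √ε ≤ η → η ≤ K * √ε → η ≤ (DSAC.criticLip γ Cφ)⁻¹ →
            ∀ sch : DSAC.Schedule,
            sch = DSAC.constSchedule (Fintype.card ι) γ Lθ Cπ Cφ μw Cw δ ε T H η →
            ∀ X, m.IsRun sch θ₀ w₀ P X →
            (∀ᵐ ω ∂P, ∀ k ≤ T, m.CriticSC μw (m.iter sch θ₀ w₀ (X ω) k).1) →
            1 - δ ≤ P.real {ω | (1 / (T : ℝ)) *
                ∑ k ∈ Finset.Icc 1 T, m.gradSq sch θ₀ w₀ (X ω) k ≤ C * (ε + W)} ∧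
            1 - δ ≤ P.real {ω | m.weightedAvg sch θ₀ w₀ (X ω) T ≤ C * (ε + W)} ∧
            (sch.samples T : ℝ) ≤
              C * ε ^ (-(5 / 2) : ℝ) * (1 + Real.log (1 / ε) + Real.log (1 / δ)) ^ q) ∧
          -- (ii) adaptive diminishing parameters
          (∀ H : ℕ → ℕ,
            (∀ k : ℕ, γ ^ H k ≤ ((k : ℝ) + 1) ^ (-(2 / 3) : ℝ)) →
            (∀ k : ℕ, H k ≤ K * (1 + Real.log ((k : ℝ) + 1)) / (1 - γ)) →
            ∀ sch : DSAC.Schedule,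
            sch = DSAC.adaptiveSchedule (Fintype.card ι) γ Lθ Cπ Cφ μw Cw δ H →
            ∀ X, m.IsRun sch θ₀ w₀ P X →
            (∀ᵐ ω ∂P, ∀ k, m.CriticSC μw (m.iter sch θ₀ w₀ (X ω) k).1) →
            1 - δ ≤ P.real {ω | ∀ T : ℕ, 2 ≤ T → m.weightedAvg sch θ₀ w₀ (X ω) T ≤
                C * (Real.log T / (T : ℝ) ^ (2 / 3 : ℝ) + W)} ∧
            ∀ ε : ℝ, 0 < ε → ε < 1 →
              1 - δ ≤ P.real {ω | m.weightedAvg sch θ₀ w₀ (X ω) (Tε ε) ≤ C * (ε + W)} ∧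
              (sch.samples (Tε ε) : ℝ) ≤
                C * ε ^ (-(5 / 2) : ℝ) * (1 + Real.log (1 / ε) + Real.log (1 / δ)) ^ q) := by
  classical
  obtain ⟨C₀, hC₀, hlip⟩ := DSAC.Model.exists_isCriticOpt_lipschitz (S := S) (A := A) (p := p)
    (d := d) (ρ := ρ) (Lθ := Lθ) hγ₁ hCF hLF hCπ hlθ hCφ hμw
  refine ⟨C₀, hC₀, hlip, fun Cw hCw₀ K hK => ?_⟩
  have hCw : 0 < Cw := hC₀.trans_le hCw₀
  obtain ⟨cA, hcA, hfail⟩ := DSAC.Model.exists_sum_not_accurate_le (S := S) (A := A) (p := p)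
    (d := d) hγ₀ hγ₁
  obtain ⟨C₁, hC₁, hconst⟩ := DSAC.Model.exists_weightedAvg_const_le (S := S) (A := A) (p := p)
    (d := d) (lθ := lθ) hγ₁ hCF hLF hLθ hCπ hCφ hρ₀ hρ₁ hμw hCw hcA D hK
  obtain ⟨C₂, hC₂, hadapt⟩ := DSAC.Model.exists_weightedAvg_adaptive_le (S := S) (A := A) (p := p)
    (d := d) (lθ := lθ) hγ₁ hCF hLF hLθ hCπ hCφ hρ₀ hρ₁ hμw hCw hcA D
  have hN : 0 < Fintype.card ι := Fintype.card_pos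
  obtain ⟨C₃, hC₃, hsamc⟩ := DSAC.const_samples_le (Lθ := Lθ) (Cπ := Cπ) (Cφ := Cφ) (μw := μw)
    (Cw := Cw) hN hγ₁ hK
  obtain ⟨C₄, hC₄, hsama⟩ := DSAC.adaptive_samples_le (Lθ := Lθ) (Cπ := Cπ) (Cφ := Cφ) (μw := μw)
    (Cw := Cw) hN hγ₁ hK
  -- One constant for all claims: `3` bounds the horizon, `4 * C₂` comes from inserting the horizon
  -- into the rate, and the exponent `6` is that of the sample counts.
  refine ⟨3 + C₁ + 4 * C₂ + C₂ + C₃ + C₄, by positivity, 6, DSAC.horizon,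
    fun ε hε hε₁ => ⟨DSAC.two_le_horizon hε hε₁, ?_⟩, ?_⟩
  · have hl := DSAC.log_one_div_nonneg hε hε₁
    calc (DSAC.horizon ε : ℝ)
        ≤ 3 * (ε ^ (-(3 / 2) : ℝ) * (1 + Real.log (1 / ε)) ^ 2) := DSAC.horizon_le hε hε₁
      _ ≤ 3 * (ε ^ (-(3 / 2) : ℝ) * (1 + Real.log (1 / ε)) ^ 6) := by
          gcongr
          · linarith
          · norm_num
      _ = 3 * ε ^ (-(3 / 2) : ℝ) * (1 + Real.log (1 / ε)) ^ 6 := by ring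
      _ ≤ _ := by gcongr; linarith
  intro m h W hW θ₀ w₀ hw₀ δ hδ hδ₁ Ω _ P _
  have hlip' : ∀ (θ θ' : DSAC.Param p) (w w' : EuclideanSpace ℝ (Fin d)),
      m.CriticSC μw θ → m.CriticSC μw θ' → m.IsCriticOpt θ w → m.IsCriticOpt θ' w' →
        ‖w - w'‖ ≤ Cw * ‖θ - θ'‖ := fun θ θ' w w' h1 h2 h3 h4 =>
    (hlip m h θ θ' w w' h1 h2 h3 h4).trans
      (mul_le_mul_of_nonneg_right hCw₀ (norm_nonneg _))
  have hN1 : (1 : ℝ) ≤ Fintype.card ι := by exact_mod_cast hN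
  refine ⟨?_, ?_⟩
  · intro ε T H η hε hε₁ hT hT' hH hH' hη hη' hηL sch hsch X hX hSC
    have hT0 : (0 : ℝ) ≤ T := Nat.cast_nonneg T
    set δ₀ : ℝ := δ / (3 * (Fintype.card ι : ℝ) * (T + 1)) with hδ₀
    have hδ₀0 : 0 < δ₀ := by positivity
    have hlog : 1 ≤ Real.log (1 / δ₀) := by
      refine DSAC.one_le_log_of_three_le ?_
      rw [hδ₀, one_div_div, le_div_iff₀ hδ]
      nlinarith
    have hprob : ∀ good : Set Ω, (∀ ω, (∀ k ≤ T, m.Accurate (X ω k)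
        (m.iter sch θ₀ w₀ (X ω) k).1 (cA * √ε)) →
        (∀ k ≤ T, m.CriticSC μw (m.iter sch θ₀ w₀ (X ω) k).1) → ω ∈ good) →
        1 - δ ≤ P.real good := by
      intro good hgood
      refine hX.one_sub_le_measureReal (I := Fin (T + 1)) (fun k => (k : ℕ))
        (e := fun _ => cA * √ε) (fail := fun _ => δ₀) (fun _ => hδ₀0.le) (fun k θ => ?_)
        (fun s => ?_) ?_
      · refine hfail m h.discount θ _ _ (√ε) δ₀ (Real.sqrt_pos.2 hε) ?_ hδ₀0 hlog ?_
        · rw [Real.sq_sqrt hε.le, hsch]; exact hH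
        · rw [Real.sq_sqrt hε.le, hsch, ← div_le_iff₀ hε]
          exact Nat.le_ceil _
      · calc ∑ _k ∈ s, δ₀ = s.card * δ₀ := by rw [Finset.sum_const, nsmul_eq_mul]
          _ ≤ (T + 1) * δ₀ := by
              refine mul_le_mul_of_nonneg_right ?_ hδ₀0.le
              exact_mod_cast (Finset.card_le_univ s).trans (Fintype.card_fin _).le
          _ = δ / (3 * (Fintype.card ι : ℝ)) := by rw [hδ₀]; field_simp
          _ ≤ δ := div_le_self hδ.le (by linarith)
      · filter_upwards [hSC] with ω hω hacc
        exact hgood ω (fun k hk => hacc ⟨k, Nat.lt_succ_of_le hk⟩) hω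
    -- Enlarging the constant requires `ε + W` to be nonnegative, which is known only on the almost
    -- sure event of strong convexity.
    have hle : ∀ ω, (∀ k ≤ T, m.CriticSC μw (m.iter sch θ₀ w₀ (X ω) k).1) →
        C₁ * (ε + W) ≤ (3 + C₁ + 4 * C₂ + C₂ + C₃ + C₄) * (ε + W) := fun ω hω =>
      mul_le_mul_of_nonneg_right (by linarith)
        (by linarith [hW.nonneg hμw (hω 0 (Nat.zero_le _))])
    refine ⟨hprob _ fun ω hacc hω => ?_, hprob _ fun ω hacc hω => ?_, ?_⟩
    · exact (hconst m h hlip' W hW θ₀ w₀ hw₀ δ ε T H η hε hε₁ hT hT' hη hη' hηL sch hsch (X ω)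
        hacc hω).1.trans (hle ω hω)
    · exact (hconst m h hlip' W hW θ₀ w₀ hw₀ δ ε T H η hε hε₁ hT hT' hη hη' hηL sch hsch (X ω)
        hacc hω).2.trans (hle ω hω)
    · rw [hsch]
      refine (hsamc δ ε T H η hδ hδ₁ hε hε₁ hT' hH').trans ?_
      have h1 := DSAC.log_one_div_nonneg hε hε₁
      have h2 := DSAC.log_one_div_nonneg hδ hδ₁
      gcongr
      linarith
  · intro H hH hH' sch hsch X hX hSC
    have hpi := Real.pi_gt_three
    set δk : ℕ → ℝ := fun k => 2 * δ / ((Fintype.card ι : ℝ) * Real.pi ^ 2 * ((k : ℝ) + 1) ^ 2)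
      with hδk
    have hδk0 : ∀ k, 0 < δk k := fun k => by positivity
    have hlog : ∀ k, 1 ≤ Real.log (1 / δk k) := fun k => by
      refine DSAC.one_le_log_of_three_le ?_
      rw [hδk]
      dsimp only
      rw [one_div_div, le_div_iff₀ (by positivity)]
      have h1 : (1 : ℝ) ≤ ((k : ℝ) + 1) ^ 2 :=
        one_le_pow₀ (by linarith [Nat.cast_nonneg (α := ℝ) k])
      have h2 : (9 : ℝ) ≤ Fintype.card ι * Real.pi ^ 2 := by nlinarith
      nlinarith
    have hprob : ∀ good : Set Ω, (∀ ω, (∀ k, m.Accurate (X ω k)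
        (m.iter sch θ₀ w₀ (X ω) k).1 (cA * ((k : ℝ) + 1) ^ (-(1 / 3) : ℝ))) →
        (∀ k, m.CriticSC μw (m.iter sch θ₀ w₀ (X ω) k).1) → ω ∈ good) →
        1 - δ ≤ P.real good := by
      intro good hgood
      -- One union bound over all iterations makes the estimate simultaneous in `T`; by the value of
      -- `ζ(2)` the failure probabilities add up to at most `δ / (3N)`.
      refine hX.one_sub_le_measureReal (I := ℕ) id
        (e := fun k => cA * ((k : ℝ) + 1) ^ (-(1 / 3) : ℝ)) (fail := δk) (fun k => (hδk0 k).le)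
        (fun k θ => ?_) (fun s => ?_) ?_
      · refine hfail m h.discount θ _ _ _ (δk k) (DSAC.rpow_neg_third_pos k) ?_ (hδk0 k)
          (hlog k) ?_
        · rw [DSAC.rpow_neg_third_sq, hsch]; exact hH k
        · rw [DSAC.rpow_neg_third_sq, Real.rpow_neg (by positivity), hsch,
            ← div_eq_mul_inv, le_div_iff₀ (by positivity)]
          exact Nat.le_ceil _
      · calc ∑ k ∈ s, δk k =
              2 * δ / (Fintype.card ι * Real.pi ^ 2) * ∑ k ∈ s, 1 / ((k : ℝ) + 1) ^ 2 := by
              rw [Finset.mul_sum]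
              refine Finset.sum_congr rfl fun k _ => ?_
              rw [hδk]
              field_simp
          _ ≤ 2 * δ / (Fintype.card ι * Real.pi ^ 2) * (Real.pi ^ 2 / 6) :=
              mul_le_mul_of_nonneg_left (DSAC.sum_inv_succ_sq_le s) (by positivity)
          _ = δ / (3 * (Fintype.card ι : ℝ)) := by field_simp; norm_num
          _ ≤ δ := div_le_self hδ.le (by linarith)
      · filter_upwards [hSC] with ω hω hacc
        exact hgood ω hacc hω
    refine ⟨hprob _ fun ω hacc hω T hT => ?_, fun ε hε hε₁ => ⟨hprob _ fun ω hacc hω => ?_, ?_⟩⟩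
    · have hW0 := hW.nonneg hμw (hω 0)
      have hT' : (2 : ℝ) ≤ T := by exact_mod_cast hT
      have hlogT : 0 ≤ Real.log T := Real.log_nonneg (by linarith)
      refine (hadapt m h hlip' W hW θ₀ w₀ hw₀ δ H sch hsch (X ω) hacc hω T hT).trans ?_
      exact mul_le_mul_of_nonneg_right (by linarith) (by positivity)
    · have hW0 := hW.nonneg hμw (hω 0)
      refine (hadapt m h hlip' W hW θ₀ w₀ hw₀ δ H sch hsch (X ω) hacc hω _
        (DSAC.two_le_horizon hε hε₁)).trans ?_
      have h1 := DSAC.log_horizon_div_le hε hε₁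
      calc C₂ * (Real.log (DSAC.horizon ε) / (DSAC.horizon ε : ℝ) ^ (2 / 3 : ℝ) + W)
          ≤ C₂ * (4 * ε + 4 * W) := mul_le_mul_of_nonneg_left (by linarith) hC₂.le
        _ = 4 * C₂ * (ε + W) := by ring
        _ ≤ _ := mul_le_mul_of_nonneg_right (by linarith) (by linarith)
    · rw [hsch]
      refine (hsama δ ε H hδ hδ₁ hε hε₁ hH').trans ?_
      have h1 := DSAC.log_one_div_nonneg hε hε₁
      have h2 := DSAC.log_one_div_nonneg hδ hδ₁
      gcongr
      linarith
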